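/- **Setting.** Work on $\mathbb R^n$ with Lebesgue measure. Cubes have sides parallel to the axes, and for a cube $Q$ and $0\le\alpha<n$ put $\langle f\rangle_{\alpha,p,Q}=\big(|Q|^{-(1-\alpha/n)}\int_Q|f|^p\,dx\big)^{1/p}$, $\langle f\rangle_{p,Q}=\langle f\rangle_{0,p,Q}$, $\langle f\rangle_Q=\langle f\rangle_{1,Q}$. For $1\le p\le\infty$ let $p'$ be the conjugate exponent. A dyadic grid is a family of cubes with side lengths $2^k$ ($k\in\mathbb Z$), any two of which are nested or disjoint, such that for each $k$ the cubes of side length $2^k$ partition $\mathbb R^n$. For $0<\eta\le1$, a subfamily $\mathcal S$ of a dyadic grid is $\eta$-sparse if there are pairwise disjoint measurable sets $E_Q\subseteq Q$ $(Q\in\mathcal S)$ with $|E_Q|\ge\eta|Q|$. **Sparse domination.** We write $T\in S^\alpha(p_0,q_0)$, with parameters $\eta,N$ and constant $K\ge 0$, if $T$ is a (sub)linear operator defined on $C_c^\infty$ (real- or complex-valued functions), $Tf$ is locally integrable for each $f\in C_c^\infty$, and for all $f,g\in C_c^\infty$ there are $\eta$-sparse families $\mathcal S_1,\dots,\mathcal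 S_N$ (which may depend on $f$ and $g$) with $$\Big|\int Tf\,g\,dx\Big|\le K\sum_{j=1}^N\sum_{Q\in\mathcal S_j}\langle f\rangle_{p_0,Q}\,\langle g\rangle_{\alpha,q_0',Q}\,|Q|.$$ **Weights.** A weight is a locally integrable, a.e. positive function. All suprema are over cubes. For $1<r<\infty$, $[v]_{A_r}=\sup_Q\langle v\rangle_Q\langle v^{1-r'}\rangle_Q^{r-1}$; $[v]_{A_1}=\sup_Q\langle v\rangle_Q(\operatorname{ess\,inf}_Qv)^{-1}$; $v\in A_r$ means $[v]_{A_r}<\infty$; $A_\infty=\bigcup_{r\ge1}A_r$, and $[v]_{A_\infty}=\sup_Q v(Q)^{-1}\int_QM(v\chi_Q)\,dx$ is the Fujii–Wilson constant, where $v(Q)=\int_Qv\,dx$ and $Mf(x)=\sup_{Q\ni x}\langle f\rangle_Q$. For $1<s<\infty$, $[v]_{RH_s}=\sup_Q\langle v\rangle_{s,Q}/\langle v\rangle_Q$, and $v\in RH_s$ means $[v]_{RH_s}<\infty$; by convention $RH_1=A_\infty$. Finally $\|f\|_{L^{q,\infty}}=\sup_{y>0}y\,|\{|f|>y\}|^{1/q}$.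 **Theorem 1.3.** Let $0\le\alpha<n$, $1\le p_0\le p\le q<q_0\le\infty$, $\frac1p-\frac1q=\frac{\alpha}{nq_0'}$, $0<\eta\le1$ and $N\in\mathbb N$. There is a constant $C$, depending only on $n,\alpha,p_0,q_0,p,q,\eta,N$, such that the following holds for every $T\in S^\alpha(p_0,q_0)$ with parameters $\eta,N$ and constant $K$, and every weight $w$ with $$w^q\in A_{(1/p_0-1/p)q+1}\cap RH_{(q_0/q)'}.$$ The operator $f\mapsto wT(w^{-1}f)$, initially defined for those $f$ with $w^{-1}f\in C_c^\infty$, extends to a sublinear operator on all of $L^p$ (to a linear one if $T$ is linear) which maps $L^p$ to $L^{q,\infty}$ with $$\|wT(w^{-1}\,\cdot\,)\|_{L^p\to L^{q,\infty}}\le C K\cdot\begin{cases}[w^q]_{A_{(1/p_0-1/p)q+1}}^{1/q}\,[w^q]_{A_\infty}, & q_0=\infty,\\[4pt] [w^q]_{A_{(1/p_0-1/p)q+1}}^{1/q}\,[w^q]_{RH_{(q_0/q)'}}^{(q_0/q)'+\frac2q}, & q_0<\infty.\end{cases}$$ Here linearity, sublinearity and the extension property are understood almost everywhere. In particular $\|w\,Th\|_{L^{q,\infty}}$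 is at most this constant times $\|wh\|_{L^p}$ for every $h\in C_c^\infty$. -/

import Mathlib

open MeasureTheory Set
open scoped ENNReal NNReal ContDiff

noncomputable section

namespace SparseWeak

/-! Everything lives on `ℝⁿ`, modelled as `Fin n → ℝ` with Lebesgue measure `volume`.
Only the measure and the smooth structure of `ℝⁿ` are used, never its norm. -/

/-- A cube `∏ᵢ [aᵢ, aᵢ + ℓ)` in `ℝⁿ` with sides parallel to the axes and side length `ℓ > 0`. -/
structure Cube (n : ℕ) where
  corner : Fin n → ℝ
  side : ℝ
  side_pos : 0 < side

/-- The set of points of a cube. -/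
def Cube.carrier {n : ℕ} (Q : Cube n) : Set (Fin n → ℝ) :=
  Set.pi Set.univ fun i => Set.Ico (Q.corner i) (Q.corner i + Q.side)

/-- The average `⟨f⟩_Q` of a function `f ≥ 0` over a cube. -/
def Cube.avg {n : ℕ} (Q : Cube n) (f : (Fin n → ℝ) → ℝ≥0∞) : ℝ≥0∞ :=
  (volume Q.carrier)⁻¹ * ∫⁻ x in Q.carrier, f x

/-- Dyadic grids: side lengths are powers of two, two cubes are disjoint or nested, and the cubes of
each fixed side length `2 ^ k`, `k ∈ ℤ`, form a partition of `ℝⁿ`. -/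
structure IsDyadicGrid {n : ℕ} (D : Set (Cube n)) : Prop where
  side_eq : ∀ Q ∈ D, ∃ k : ℤ, Q.side = 2 ^ k
  nested : ∀ Q ∈ D, ∀ R ∈ D, Q.carrier ∩ R.carrier = ∅ ∨
    Q.carrier ∩ R.carrier = Q.carrier ∨ Q.carrier ∩ R.carrier = R.carrier
  partition : ∀ (k : ℤ) (x : Fin n → ℝ), ∃! Q : Cube n, Q ∈ D ∧ Q.side = 2 ^ k ∧ x ∈ Q.carrier

/-- `η`-sparse collections of cubes. -/
def IsSparse {n : ℕ} (η : ℝ) (S : Set (Cube n)) : Prop :=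
  (∃ D : Set (Cube n), IsDyadicGrid D ∧ S ⊆ D) ∧
  ∃ E : Cube n → Set (Fin n → ℝ),
    (∀ Q ∈ S, MeasurableSet (E Q) ∧ E Q ⊆ Q.carrier ∧
      ENNReal.ofReal η * volume Q.carrier ≤ volume (E Q)) ∧
    S.PairwiseDisjoint E

/-- The fractional average
`⟨f⟩_{α,p,Q} = (|Q|^{-(1 - α/n)} ∫_Q |f|^p dx)^{1/p}`; `α = 0` gives `⟨f⟩_{p,Q}`. -/
def fracAvg {n : ℕ} {𝕜 : Type*} [RCLike 𝕜] (α p : ℝ) (f : (Fin n → ℝ) → 𝕜) (Q : Cube n) : ℝ≥0∞ :=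
  (volume Q.carrier ^ (-(1 - α / n)) * ∫⁻ x in Q.carrier, ‖f x‖ₑ ^ p) ^ (1 / p)

/-- The sparse form `∑_{Q ∈ S} ⟨f⟩_{p₀,Q} ⟨g⟩_{α,q₀',Q} |Q|`, with `q₀'` the exponent conjugate to
`q₀ ∈ [1, ∞]` (so `q₀' = 1` for `q₀ = ∞`). -/
def sparseForm {n : ℕ} {𝕜 : Type*} [RCLike 𝕜] (α p₀ : ℝ) (q₀ : ℝ≥0∞) (S : Set (Cube n))
    (f g : (Fin n → ℝ) → 𝕜) : ℝ≥0∞ :=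
  ∑' Q : S, fracAvg 0 p₀ f Q.1 * fracAvg α (ENNReal.conjExponent q₀).toReal g Q.1 *
    volume Q.1.carrier

/-- The space `C_c^∞(ℝⁿ)` of test functions. -/
def IsTest {n : ℕ} {𝕜 : Type*} [RCLike 𝕜] (f : (Fin n → ℝ) → 𝕜) : Prop :=
  ContDiff ℝ ∞ f ∧ HasCompactSupport f

/-- `T` is linear (almost everywhere) on the functions satisfying `P`. -/
def LinearOn {n : ℕ} {𝕜 : Type*} [RCLike 𝕜] (P : ((Fin n → ℝ) → 𝕜) → Prop)
    (T : ((Fin n → ℝ) → 𝕜) → (Fin n → ℝ) → 𝕜) : Prop :=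
  (∀ f g, P f → P g → ∀ᵐ x, T (f + g) x = T f x + T g x) ∧
  ∀ (c : 𝕜) (f), P f → ∀ᵐ x, T (c • f) x = c * T f x

/-- `T` is sublinear (almost everywhere) on the functions satisfying `P`. Linear operators are
sublinear. -/
def SublinearOn {n : ℕ} {𝕜 : Type*} [RCLike 𝕜] (P : ((Fin n → ℝ) → 𝕜) → Prop)
    (T : ((Fin n → ℝ) → 𝕜) → (Fin n → ℝ) → 𝕜) : Prop :=
  (∀ f g, P f → P g → ∀ᵐ x, ‖T (f + g) x‖ ≤ ‖T f x‖ + ‖T g x‖) ∧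
  ∀ (c : 𝕜) (f), P f → ∀ᵐ x, ‖T (c • f) x‖ = ‖c‖ * ‖T f x‖

/-- `T ∈ S^α(p₀, q₀)` with parameters `η`, `N` and constant `K`: `T` is a (sub)linear operator on
`C_c^∞` whose values are locally integrable functions (so that the pairing `⟨Tf, g⟩ = ∫ Tf g dx`
makes sense), and for all `f, g ∈ C_c^∞` there are `η`-sparse collections `S_1, …, S_N`, which may
depend on `f` and `g`, with
`|⟨Tf, g⟩| ≤ K ∑_j ∑_{Q ∈ S_j} ⟨f⟩_{p₀,Q} ⟨g⟩_{α,q₀',Q} |Q|`. -/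
structure SparselyDominated {n : ℕ} {𝕜 : Type*} [RCLike 𝕜] (α p₀ : ℝ) (q₀ : ℝ≥0∞) (η : ℝ) (N : ℕ)
    (K : ℝ≥0) (T : ((Fin n → ℝ) → 𝕜) → (Fin n → ℝ) → 𝕜) : Prop where
  sublinear : SublinearOn IsTest T
  locallyIntegrable : ∀ f, IsTest f → LocallyIntegrable (T f)
  dominated : ∀ f g : (Fin n → ℝ) → 𝕜, IsTest f → IsTest g →
    ∃ S : Fin N → Set (Cube n), (∀ j, IsSparse η (S j)) ∧
      ‖∫ x, T f x * g x‖ₑ ≤ K * ∑ j, sparseForm α p₀ q₀ (S j) f g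

/-- Weights: locally integrable functions that are positive almost everywhere. -/
def IsWeight {n : ℕ} (v : (Fin n → ℝ) → ℝ) : Prop :=
  LocallyIntegrable v ∧ ∀ᵐ x, 0 < v x

/-- The Muckenhoupt constant `[v]_{A_r}`, `1 ≤ r < ∞`:
`sup_Q ⟨v⟩_Q ⟨v^{1-r'}⟩_Q^{r-1}` for `r > 1` (here `1 - r' = -1/(r-1)`), and
`sup_Q ⟨v⟩_Q (essinf_Q v)⁻¹` for `r = 1`. -/
def constA {n : ℕ} (r : ℝ) (v : (Fin n → ℝ) → ℝ) : ℝ≥0∞ :=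
  if r = 1 then
    ⨆ Q : Cube n, (Q.avg fun x => ENNReal.ofReal (v x)) *
      (essInf (fun x => ENNReal.ofReal (v x)) (volume.restrict Q.carrier))⁻¹
  else
    ⨆ Q : Cube n, (Q.avg fun x => ENNReal.ofReal (v x)) *
      (Q.avg fun x => ENNReal.ofReal (v x) ^ (-1 / (r - 1))) ^ (r - 1)

/-- The class `A_r`, `1 ≤ r < ∞`. -/
def MemA {n : ℕ} (r : ℝ) (v : (Fin n → ℝ) → ℝ) : Prop :=
  IsWeight v ∧ constA r v < ⊤

/-- The class `A_∞`, the union of the classes `A_r`, `1 ≤ r < ∞`. -/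
def MemAInfty {n : ℕ} (v : (Fin n → ℝ) → ℝ) : Prop :=
  ∃ r : ℝ, 1 ≤ r ∧ MemA r v

/-- The Hardy-Littlewood maximal function `Mf(x) = sup_{Q ∋ x} ⟨f⟩_Q`. -/
def maximal {n : ℕ} (f : (Fin n → ℝ) → ℝ≥0∞) (x : Fin n → ℝ) : ℝ≥0∞ :=
  ⨆ (Q : Cube n) (_ : x ∈ Q.carrier), Q.avg f

/-- The Fujii-Wilson constant `[v]_{A_∞} = sup_Q v(Q)⁻¹ ∫_Q M(v χ_Q) dx`. -/
def constAInfty {n : ℕ} (v : (Fin n → ℝ) → ℝ) : ℝ≥0∞ :=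
  ⨆ Q : Cube n,
    (∫⁻ x in Q.carrier, maximal (Q.carrier.indicator fun y => ENNReal.ofReal (v y)) x) /
      ∫⁻ x in Q.carrier, ENNReal.ofReal (v x)

/-- The reverse Hölder constant `[v]_{RH_s} = sup_Q ⟨v⟩_{s,Q} / ⟨v⟩_Q` for `1 < s < ∞`, with the
convention `[v]_{RH_1} = 1`. -/
def constRH {n : ℕ} (s : ℝ) (v : (Fin n → ℝ) → ℝ) : ℝ≥0∞ :=
  if s = 1 then 1
  else
    ⨆ Q : Cube n, (Q.avg fun x => ENNReal.ofReal (v x) ^ s) ^ (1 / s) /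
      (Q.avg fun x => ENNReal.ofReal (v x))

/-- The class `RH_s`, `1 ≤ s < ∞`, with the convention `RH_1 = A_∞`. -/
def MemRH {n : ℕ} (s : ℝ) (v : (Fin n → ℝ) → ℝ) : Prop :=
  if s = 1 then MemAInfty v else IsWeight v ∧ constRH s v < ⊤

/-- The quasinorm `‖f‖_{L^{q,∞}} = sup_{y > 0} y |{|f| > y}|^{1/q}` with respect to Lebesgue
measure. -/
def weakNorm {n : ℕ} {𝕜 : Type*} [RCLike 𝕜] (q : ℝ) (f : (Fin n → ℝ) → 𝕜) : ℝ≥0∞ :=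
  ⨆ y : ℝ≥0, (y : ℝ≥0∞) * volume {x | (y : ℝ≥0∞) < ‖f x‖ₑ} ^ (1 / q)

/-- `‖w T(w⁻¹ ·)‖_{L^p → L^{q,∞}} ≤ B`, for an operator `T` given on `C_c^∞`.

The first clause is the bound for `f = w h` with `h = w⁻¹ f ∈ C_c^∞`, where `T` is given. The second
one says that `w T(w⁻¹ ·)` extends to a (sub)linear operator `S` on all of `L^p` with the same
bound; `S` is linear if `T` is. -/
def MultiplierWeakBound {n : ℕ} {𝕜 : Type*} [RCLike 𝕜] (T : ((Fin n → ℝ) → 𝕜) → (Fin n → ℝ) → 𝕜)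
    (w : (Fin n → ℝ) → ℝ) (p q : ℝ) (B : ℝ≥0∞) : Prop :=
  (∀ h, IsTest h →
    weakNorm q (fun x => w x • T h x) ≤ B * eLpNorm (fun x => w x • h x) (ENNReal.ofReal p) volume) ∧
  ∃ S : ((Fin n → ℝ) → 𝕜) → (Fin n → ℝ) → 𝕜,
    (∀ h, IsTest h → ∀ᵐ x, S (fun y => w y • h y) x = w x • T h x) ∧
    SublinearOn (fun f => MemLp f (ENNReal.ofReal p) volume) S ∧
    (LinearOn IsTest T → LinearOn (fun f => MemLp f (ENNReal.ofReal p) volume) S) ∧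
    ∀ f, MemLp f (ENNReal.ofReal p) volume →
      AEStronglyMeasurable (S f) volume ∧
      weakNorm q (S f) ≤ B * eLpNorm f (ENNReal.ofReal p) volume

end SparseWeak

end

open SparseWeak

/-!
Write `V = w^q`, `r = q₀'`, `σ = (q₀/q)'`, so that `1/r = 1 - 1/q + 1/(qσ)`, and fix a test function
`h` with `f = w h`.

*Duality.* It suffices to bound `y |F|^{1/q}` for bounded pieces `F` of the level set
`{w |Th| > y}`. The maximal function `sup_{Q ∋ x} |Q|⁻¹ (∫_Q |f|^p)^{q/p}` (`powMaximal`) has weak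
type with norm `(∫ |f|^p)^{q/p}` up to a dimensional constant, so removing from `F` the points where
it exceeds a suitable multiple `t` of `‖f‖_p^q / |F|` leaves a `goodPart` `F'` with
`|F| ≤ 2 |F'|`. Pairing `Th` with `w` times its phase on `F'` bounds `y |F'|` by sparse forms of `h`
and `w 1_{F'}`. The latter is not a test function; `SparselyDominated.enorm_integral_le` passes to
it by mollification, using that sparse forms are stable uniformly over sparse families.

*One cube.* Hölder's inequality and the Muckenhoupt condition bound `⟨h⟩_{p₀,Q}` by
`[V]_A^{1/q} ⟨f⟩_{p,Q} ⟨V⟩_Q^{-1/q}` (`fracAvg_le_of_memA`). The power `V^σ` is an `A_∞` weight, and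
the sharp reverse Hölder inequality (`setLIntegral_inter_le_of_maximal`, a stopping-cube and
self-improvement argument) gives
`∫_{Q ∩ F} V^σ ≤ 2 (|Q ∩ F| / |Q|)^{1/s} ∫_Q V^σ`, with `s` comparable to its Fujii-Wilson constant.
That constant is `[V]_{A_∞}` for `q₀ = ∞` and at most `C [V]_{RH_σ}^σ` for `q₀ < ∞`. Hence
`⟨w 1_{F'}⟩_{r,Q} ≤ 2 [V]_{RH_σ}^{1/q} ⟨V⟩_Q^{1/q} (|Q ∩ F'| / |Q|)^θ` with
`θ = 1 - 1/q + 1/(qσs)` (`avg_rpow_le_of_absolutelyContinuous`). In the product the averages of `V`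
cancel.

*Summation.* Only cubes meeting `F'` contribute, and on these the first factor is at most `t^{1/q}`.
The sparse sum is therefore at most an integral of a product of powers of two *truncated* maximal
functions. Since `1/q + θ > 1`, Hölder's inequality applies with exponents for which both truncated
maximal functions are integrable by their weak-type bounds alone. The loss is proportional to the
inverse of the gap `1/q + θ - 1 = 1/(qσs)`, that is, linear in `s`
(`tsum_sparse_le`, `sparseForm_le_of_goodPart`).

*Extension.* The functions `w h` are dense in `L^p`, and along fast approximating sequences the
images converge almost everywhere by the Borel-Cantelli lemma (`exists_extension`). For an operator
that is merely sublinear only the absolute values of the images converge, and their limit serves as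
the extension.
-/

noncomputable section

namespace SparseWeak

open Filter Topology Metric

variable {n : ℕ}

/-! ### Cubes -/

lemma Cube.measurableSet_carrier (Q : Cube n) : MeasurableSet Q.carrier :=
  MeasurableSet.univ_pi fun _ => measurableSet_Ico

lemma Cube.volume_carrier (Q : Cube n) : volume Q.carrier = ENNReal.ofReal Q.side ^ n := by
  simp [Cube.carrier, Real.volume_pi_Ico]

lemma Cube.volume_pos (Q : Cube n) : 0 < volume Q.carrier := by
  rw [Q.volume_carrier]
  exact ENNReal.pow_pos (ENNReal.ofReal_pos.2 Q.side_pos) n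

lemma Cube.volume_ne_zero (Q : Cube n) : volume Q.carrier ≠ 0 := Q.volume_pos.ne'

lemma Cube.volume_ne_top (Q : Cube n) : volume Q.carrier ≠ ⊤ := by
  rw [Q.volume_carrier]
  exact ENNReal.pow_ne_top ENNReal.ofReal_ne_top

lemma Cube.mem_carrier {Q : Cube n} {x : Fin n → ℝ} :
    x ∈ Q.carrier ↔ ∀ i, Q.corner i ≤ x i ∧ x i < Q.corner i + Q.side := by
  simp [Cube.carrier, Set.mem_pi]

/-- The centre of a cube. -/
def Cube.center (Q : Cube n) : Fin n → ℝ := fun i => Q.corner i + Q.side / 2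

/-- In the supremum norm, the closure of a cube is a closed ball. -/
lemma Cube.closedBall_center (Q : Cube n) :
    closedBall Q.center (Q.side / 2) =
      Set.pi univ fun i => Icc (Q.corner i) (Q.corner i + Q.side) := by
  rw [closedBall_pi _ (by linarith [Q.side_pos])]
  congr 1
  ext i x
  simp only [Cube.center, Real.closedBall_eq_Icc, mem_Icc]
  constructor <;> rintro ⟨h1, h2⟩ <;> constructor <;> linarith

lemma Cube.carrier_subset_closedBall (Q : Cube n) :
    Q.carrier ⊆ closedBall Q.center (Q.side / 2) := by
  rw [Q.closedBall_center]
  exact Set.pi_mono fun i _ => Ico_subset_Icc_self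

lemma Cube.carrier_ae_eq_closedBall (Q : Cube n) :
    Q.carrier =ᵐ[volume] closedBall Q.center (Q.side / 2) := by
  rw [Q.closedBall_center, pi_univ_Icc]
  exact Measure.univ_pi_Ico_ae_eq_Icc (μ := fun _ : Fin n => (volume : Measure ℝ))
    (f := Q.corner) (g := fun i => Q.corner i + Q.side)

lemma Cube.volume_closedBall_center (Q : Cube n) {c : ℝ} (hc : 0 ≤ c) :
    volume (closedBall Q.center (c * (Q.side / 2))) = ENNReal.ofReal c ^ n * volume Q.carrier := by
  rw [Real.volume_pi_closedBall _ (by have := Q.side_pos; positivity), Q.volume_carrier,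
    ← mul_pow, ← ENNReal.ofReal_mul hc, ← ENNReal.ofReal_pow (by have := Q.side_pos; positivity)]
  simp only [Fintype.card_fin]
  congr 2
  ring

lemma Cube.nonempty (Q : Cube n) : Q.carrier.Nonempty :=
  nonempty_of_measure_ne_zero Q.volume_ne_zero

/-- A cube can be thickened slightly, staying below any prescribed larger volume, so that each of
its points becomes an interior point. -/
lemma Cube.exists_thickening (Q : Cube n) {V : ℝ≥0∞} (hV : volume Q.carrier < V) :
    ∃ R : Cube n, Q.carrier ⊆ R.carrier ∧ volume R.carrier < V ∧
      ∀ x ∈ Q.carrier, R.carrier ∈ 𝓝 x := by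
  have hlim : Tendsto (fun δ : ℝ => ENNReal.ofReal (Q.side + 2 * δ) ^ n) (𝓝[>] 0)
      (𝓝 (volume Q.carrier)) := by
    rw [Q.volume_carrier]
    have : Continuous fun δ : ℝ => ENNReal.ofReal (Q.side + 2 * δ) ^ n :=
      (ENNReal.continuous_pow n).comp (ENNReal.continuous_ofReal.comp (by fun_prop))
    have h := (this.tendsto 0).mono_left (nhdsWithin_le_nhds (s := Ioi 0))
    simpa using h
  obtain ⟨δ, hδ, hδ0⟩ := ((hlim.eventually (gt_mem_nhds hV)).and self_mem_nhdsWithin).exists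
  have hδ0 : 0 < δ := hδ0
  let R : Cube n := ⟨fun i => Q.corner i - δ, Q.side + 2 * δ, by linarith [Q.side_pos]⟩
  refine ⟨R, ?_, by rw [R.volume_carrier]; exact hδ, ?_⟩
  · intro x hx
    rw [Cube.mem_carrier] at hx ⊢
    intro i
    have := hx i
    constructor <;> simp only [R] <;> linarith [this.1, this.2]
  · intro x hx
    rw [Cube.mem_carrier] at hx
    refine set_pi_mem_nhds finite_univ fun i _ => Ico_mem_nhds ?_ ?_ <;> simp only [R] <;>
      linarith [(hx i).1, (hx i).2]

/-! ### The maximal function and its weak-type bound -/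

/-- The maximal function `sup_{Q ∋ x} |Q|⁻¹ (∫_Q g)^κ`. For `κ = 1` this is the Hardy-Littlewood
maximal function; for `g = |f|^p` and `κ = q / p` it is the `q`-th power of the fractional maximal
function `sup_{Q ∋ x} |Q|^{1/p - 1/q} ⟨f⟩_{p,Q}`. -/
def powMaximal (κ : ℝ) (g : (Fin n → ℝ) → ℝ≥0∞) (x : Fin n → ℝ) : ℝ≥0∞ :=
  ⨆ (Q : Cube n) (_ : x ∈ Q.carrier), (volume Q.carrier)⁻¹ * (∫⁻ y in Q.carrier, g y) ^ κ

lemma maximal_eq_powMaximal (g : (Fin n → ℝ) → ℝ≥0∞) : maximal g = powMaximal 1 g := by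
  ext x
  simp [maximal, powMaximal, Cube.avg]

lemma le_powMaximal (κ : ℝ) (g : (Fin n → ℝ) → ℝ≥0∞) {Q : Cube n} {x : Fin n → ℝ}
    (hx : x ∈ Q.carrier) :
    (volume Q.carrier)⁻¹ * (∫⁻ y in Q.carrier, g y) ^ κ ≤ powMaximal κ g x :=
  le_iSup₂ (f := fun (Q : Cube n) (_ : x ∈ Q.carrier) =>
    (volume Q.carrier)⁻¹ * (∫⁻ y in Q.carrier, g y) ^ κ) Q hx

lemma lt_powMaximal_iff {κ : ℝ} {g : (Fin n → ℝ) → ℝ≥0∞} {t : ℝ≥0∞} {x : Fin n → ℝ} :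
    t < powMaximal κ g x ↔
      ∃ Q : Cube n, x ∈ Q.carrier ∧ t * volume Q.carrier < (∫⁻ y in Q.carrier, g y) ^ κ := by
  simp only [powMaximal, lt_iSup_iff, exists_prop]
  refine exists_congr fun Q => and_congr_right fun _ => ?_
  rw [mul_comm, ← div_eq_mul_inv]
  exact ENNReal.lt_div_iff_mul_lt (Or.inl Q.volume_ne_zero) (Or.inl Q.volume_ne_top)

/-- The maximal function is lower semicontinuous, although the cubes are half-open. -/
lemma isOpen_lt_powMaximal {κ : ℝ} (hκ : 0 ≤ κ) (g : (Fin n → ℝ) → ℝ≥0∞) (t : ℝ≥0∞) :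
    IsOpen {x | t < powMaximal κ g x} := by
  rw [isOpen_iff_mem_nhds]
  intro x hx
  obtain ⟨Q, hxQ, hQ⟩ := lt_powMaximal_iff.1 hx
  have : ∃ R : Cube n, Q.carrier ⊆ R.carrier ∧
      t * volume R.carrier < (∫⁻ y in Q.carrier, g y) ^ κ ∧ R.carrier ∈ 𝓝 x := by
    rcases eq_or_ne t 0 with rfl | ht
    · obtain ⟨R, h1, -, h3⟩ := Q.exists_thickening (V := ⊤) Q.volume_ne_top.lt_top
      exact ⟨R, h1, by simpa using hQ, h3 x hxQ⟩
    · have htop : t ≠ ⊤ := by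
        rintro rfl
        rw [ENNReal.top_mul Q.volume_ne_zero] at hQ
        exact not_top_lt hQ
      have hQ' : volume Q.carrier < (∫⁻ y in Q.carrier, g y) ^ κ / t := by
        rw [ENNReal.lt_div_iff_mul_lt (Or.inl ht) (Or.inl htop), mul_comm]
        exact hQ
      obtain ⟨R, h1, h2, h3⟩ := Q.exists_thickening hQ'
      refine ⟨R, h1, ?_, h3 x hxQ⟩
      rw [ENNReal.lt_div_iff_mul_lt (Or.inl ht) (Or.inl htop), mul_comm] at h2
      exact h2
  obtain ⟨R, hQR, hR, hxR⟩ := this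
  filter_upwards [hxR] with y hy
  exact lt_powMaximal_iff.2 ⟨R, hy, hR.trans_le
    (ENNReal.rpow_le_rpow (lintegral_mono_set hQR) hκ)⟩

lemma measurable_powMaximal {κ : ℝ} (hκ : 0 ≤ κ) (g : (Fin n → ℝ) → ℝ≥0∞) :
    Measurable (powMaximal κ g) :=
  measurable_of_Ioi fun t => (isOpen_lt_powMaximal hκ g t).measurableSet

/-- Powers with exponent `κ ≥ 1` are superadditive along disjoint families of sets. -/
lemma tsum_setLIntegral_rpow_le {X ι : Type*} [MeasurableSpace X] {μ : Measure X} [Countable ι]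
    {κ : ℝ} (hκ : 1 ≤ κ) (g : X → ℝ≥0∞) {A : ι → Set X} (hA : ∀ i, MeasurableSet (A i))
    (hd : Pairwise (Function.onFun Disjoint A)) :
    ∑' i, (∫⁻ y in A i, g y ∂μ) ^ κ ≤ (∫⁻ y, g y ∂μ) ^ κ := by
  have split : ∀ z : ℝ≥0∞, z ^ κ = z ^ (κ - 1) * z := fun z => by
    conv_lhs => rw [show κ = (κ - 1) + 1 by ring,
      ENNReal.rpow_add_of_nonneg _ _ (by linarith) zero_le_one, ENNReal.rpow_one]
  calc ∑' i, (∫⁻ y in A i, g y ∂μ) ^ κ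
      = ∑' i, (∫⁻ y in A i, g y ∂μ) ^ (κ - 1) * ∫⁻ y in A i, g y ∂μ := by simp_rw [split]
    _ ≤ ∑' i, (∫⁻ y, g y ∂μ) ^ (κ - 1) * ∫⁻ y in A i, g y ∂μ := by
        gcongr with i
        exact Measure.restrict_le_self
    _ = (∫⁻ y, g y ∂μ) ^ (κ - 1) * ∫⁻ y in ⋃ i, A i, g y ∂μ := by
        rw [ENNReal.tsum_mul_left, lintegral_iUnion hA hd]
    _ ≤ (∫⁻ y, g y ∂μ) ^ (κ - 1) * ∫⁻ y, g y ∂μ := by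
        gcongr
        exact Measure.restrict_le_self
    _ = _ := (split _).symm

/-- The weak-type bound for the maximal function, by the Vitali covering lemma. -/
lemma mul_volume_lt_powMaximal_le (hn : 0 < n) {κ : ℝ} (hκ : 1 ≤ κ) (g : (Fin n → ℝ) → ℝ≥0∞)
    (t : ℝ≥0∞) :
    t * volume {x | t < powMaximal κ g x} ≤ 5 ^ n * (∫⁻ y, g y) ^ κ := by
  rcases eq_or_ne t 0 with rfl | ht
  · simp
  rcases eq_or_ne t ⊤ with rfl | htop
  · simp
  rcases eq_or_ne (∫⁻ y, g y) ⊤ with hg | hg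
  · rw [hg, ENNReal.top_rpow_of_pos (by linarith), ENNReal.mul_top (by positivity)]
    exact le_top
  set F : Set (Cube n) := {Q | t * volume Q.carrier < (∫⁻ y in Q.carrier, g y) ^ κ} with hF
  -- cubes in `F` have bounded side length
  have hbd : ∃ R : ℝ, ∀ Q ∈ F, Q.side / 2 ≤ R := by
    set B : ℝ≥0∞ := (∫⁻ y, g y) ^ κ / t
    have hB : B ≠ ⊤ := ENNReal.div_ne_top (ENNReal.rpow_ne_top_of_nonneg (by linarith) hg) ht
    refine ⟨max 1 B.toReal, fun Q hQ => ?_⟩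
    have h1 : volume Q.carrier ≤ B := by
      rw [ENNReal.le_div_iff_mul_le (Or.inl ht) (Or.inl htop), mul_comm]
      exact (le_of_lt hQ).trans (ENNReal.rpow_le_rpow (setLIntegral_le_lintegral _ _)
        (by linarith))
    have h2 : Q.side ^ n ≤ B.toReal := by
      rw [Q.volume_carrier, ← ENNReal.ofReal_pow Q.side_pos.le] at h1
      exact (ENNReal.ofReal_le_iff_le_toReal hB).1 h1
    rcases le_total Q.side 1 with h | h
    · exact le_max_of_le_left (by linarith)
    · refine le_max_of_le_right ?_
      have : Q.side ≤ Q.side ^ n := le_self_pow₀ h hn.ne'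
      linarith [Q.side_pos]
  obtain ⟨R, hR⟩ := hbd
  obtain ⟨u, huF, hud, hcov⟩ := Vitali.exists_disjoint_subfamily_covering_enlargement_closedBall F
    Cube.center (fun Q => Q.side / 2) R hR 5 (by norm_num)
  have hcount : u.Countable := by
    refine hud.countable_of_nonempty_interior fun Q _ => ?_
    refine Nonempty.mono ball_subset_interior_closedBall ?_
    exact nonempty_ball.2 (by linarith [Q.side_pos])
  have := hcount.to_subtype
  have hsub : {x | t < powMaximal κ g x} ⊆
      ⋃ Q : u, closedBall Q.1.center (5 * (Q.1.side / 2)) := by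
    intro x hx
    obtain ⟨Q, hxQ, hQ⟩ := lt_powMaximal_iff.1 hx
    obtain ⟨P, hPu, hP⟩ := hcov Q hQ
    exact mem_iUnion.2 ⟨⟨P, hPu⟩, hP (Q.carrier_subset_closedBall hxQ)⟩
  calc t * volume {x | t < powMaximal κ g x}
      ≤ t * ∑' Q : u, volume (closedBall Q.1.center (5 * (Q.1.side / 2))) := by
        gcongr
        exact (measure_mono hsub).trans (measure_iUnion_le _)
    _ = 5 ^ n * ∑' Q : u, t * volume Q.1.carrier := by
        rw [← ENNReal.tsum_mul_left, ← ENNReal.tsum_mul_left]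
        congr with Q
        rw [Cube.volume_closedBall_center _ (by norm_num), mul_left_comm]
        norm_num
    _ ≤ 5 ^ n * ∑' Q : u, (∫⁻ y in Q.1.carrier, g y) ^ κ := by
        gcongr with Q
        exact (huF Q.2).le
    _ ≤ 5 ^ n * (∫⁻ y, g y) ^ κ := by
        gcongr
        refine tsum_setLIntegral_rpow_le hκ g (fun Q => Q.1.measurableSet_carrier) ?_
        intro Q P hQP
        exact (hud Q.2 P.2 (Subtype.coe_injective.ne hQP)).mono
          Q.1.carrier_subset_closedBall P.1.carrier_subset_closedBall

/-! ### Layer-cake formulas and strong-type bounds -/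

lemma monotone_min_natCast (z : ℝ≥0∞) : Monotone fun k : ℕ => min z (k : ℝ≥0∞) := fun i j hij =>
  min_le_min_left _ (by exact_mod_cast hij)

lemma iSup_min_natCast (z : ℝ≥0∞) : ⨆ k : ℕ, min z (k : ℝ≥0∞) = z := by
  rw [← inf_iSup_eq (a := z) (f := fun k : ℕ => (k : ℝ≥0∞)), ENNReal.iSup_natCast]
  simp

lemma iSup_min_natCast_rpow (z : ℝ≥0∞) {c : ℝ} (hc : 0 < c) :
    ⨆ k : ℕ, min z (k : ℝ≥0∞) ^ c = z ^ c := by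
  have := (ENNReal.orderIsoRpow c hc).map_iSup fun k : ℕ => min z (k : ℝ≥0∞)
  simp only [ENNReal.orderIsoRpow_apply] at this
  rw [← this, iSup_min_natCast]

/-- The layer-cake formula for functions with values in `[0, ∞]`. -/
lemma lintegral_rpow_eq_lintegral_lt {X : Type*} [MeasurableSpace X] (μ : Measure X)
    {f : X → ℝ≥0∞} (hf : Measurable f) {c : ℝ} (hc : 0 < c) :
    ∫⁻ a, f a ^ c ∂μ = ENNReal.ofReal c *
      ∫⁻ y in Ioi (0 : ℝ), μ {a | ENNReal.ofReal y < f a} * ENNReal.ofReal (y ^ (c - 1)) := by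
  have hfin : ∀ k : ℕ, ∫⁻ a, min (f a) k ^ c ∂μ = ENNReal.ofReal c *
      ∫⁻ y in Ioi (0 : ℝ),
        μ {a | ENNReal.ofReal y < min (f a) k} * ENNReal.ofReal (y ^ (c - 1)) := by
    intro k
    have hne : ∀ a, min (f a) k ≠ ⊤ := fun a =>
      ((min_le_right _ _).trans_lt (ENNReal.natCast_lt_top k)).ne
    have h := lintegral_rpow_eq_lintegral_meas_lt_mul μ (f := fun a => (min (f a) k).toReal)
      (Eventually.of_forall fun a => ENNReal.toReal_nonneg)
      ((hf.min measurable_const).ennreal_toReal.aemeasurable) hc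
    have h1 : ∀ a, ENNReal.ofReal ((min (f a) k).toReal ^ c) = min (f a) k ^ c := fun a => by
      rw [← ENNReal.ofReal_rpow_of_nonneg ENNReal.toReal_nonneg hc.le, ENNReal.ofReal_toReal (hne a)]
    simp_rw [h1] at h
    rw [h]
    congr 1
    refine setLIntegral_congr_fun measurableSet_Ioi fun y hy => ?_
    have hy : 0 < y := hy
    simp only [ENNReal.ofReal_lt_iff_lt_toReal hy.le (hne _)]
  have hL : ∫⁻ a, f a ^ c ∂μ = ⨆ k : ℕ, ∫⁻ a, min (f a) k ^ c ∂μ := by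
    rw [← lintegral_iSup (fun k => (hf.min measurable_const).pow_const c)
      (fun i j hij a => ENNReal.rpow_le_rpow (monotone_min_natCast (f a) hij) hc.le)]
    exact lintegral_congr fun a => (iSup_min_natCast_rpow (f a) hc).symm
  have hmeas : ∀ F : X → ℝ≥0∞, Measurable fun y : ℝ => μ {a | ENNReal.ofReal y < F a} := fun F => by
    refine Antitone.measurable fun y z hyz => measure_mono fun a ha => ?_
    exact (ENNReal.ofReal_le_ofReal hyz).trans_lt ha
  have hR : ∫⁻ y in Ioi (0 : ℝ), μ {a | ENNReal.ofReal y < f a} * ENNReal.ofReal (y ^ (c - 1)) =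
      ⨆ k : ℕ, ∫⁻ y in Ioi (0 : ℝ),
        μ {a | ENNReal.ofReal y < min (f a) k} * ENNReal.ofReal (y ^ (c - 1)) := by
    have hset : ∀ y : ℝ, Monotone fun k : ℕ => {a | ENNReal.ofReal y < min (f a) (k : ℝ≥0∞)} :=
      fun y i j hij a ha => lt_of_lt_of_le ha (monotone_min_natCast (f a) hij)
    rw [← lintegral_iSup]
    · refine lintegral_congr fun y => ?_
      rw [← ENNReal.iSup_mul, ← (hset y).measure_iUnion]
      congr 2
      ext a
      conv_lhs => rw [mem_ofPred_eq, ← iSup_min_natCast (f a), lt_iSup_iff]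
      simp
    · exact fun k => (hmeas _).mul (by fun_prop)
    · intro i j hij y
      dsimp only
      gcongr
  rw [hL, hR, ENNReal.mul_iSup]
  exact iSup_congr hfin

/-- The layer-cake formula with a density. -/
lemma lintegral_mul_rpow_eq_lintegral_lt {X : Type*} [MeasurableSpace X] (μ : Measure X)
    {ρ f : X → ℝ≥0∞} (hρ : AEMeasurable ρ μ) (hf : Measurable f) {c : ℝ} (hc : 0 < c) :
    ∫⁻ a, ρ a * f a ^ c ∂μ = ENNReal.ofReal c *
      ∫⁻ y in Ioi (0 : ℝ),
        (∫⁻ a in {a | ENNReal.ofReal y < f a}, ρ a ∂μ) * ENNReal.ofReal (y ^ (c - 1)) := by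
  have h := lintegral_rpow_eq_lintegral_lt (μ.withDensity ρ) hf hc
  rw [lintegral_withDensity_eq_lintegral_mul₀ hρ (by fun_prop)] at h
  simp only [Pi.mul_apply] at h
  rw [h]
  congr 1
  refine lintegral_congr fun y => ?_
  rw [withDensity_apply _ (measurableSet_lt measurable_const hf)]

/-- `b t^{b-1}` integrates to `z^b` up to height `z ∈ [0, ∞]`. -/
lemma rpow_eq_lintegral_lt (z : ℝ≥0∞) {c : ℝ} (hc : 0 < c) :
    z ^ c = ENNReal.ofReal c *
      ∫⁻ y in Ioi (0 : ℝ), {y : ℝ | ENNReal.ofReal y < z}.indicator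
        (fun y => ENNReal.ofReal (y ^ (c - 1))) y := by
  have h := lintegral_rpow_eq_lintegral_lt (Measure.dirac ()) (f := fun _ => z)
    measurable_const hc
  simp only [lintegral_dirac] at h
  rw [h]
  congr 1
  refine lintegral_congr fun y => ?_
  by_cases hy : ENNReal.ofReal y < z <;> simp [hy]

lemma ofReal_rpow_split {y b : ℝ} (hy : 0 < y) :
    ENNReal.ofReal (y ^ (b - 1)) = ENNReal.ofReal y * ENNReal.ofReal (y ^ (b - 1 - 1)) := by
  rw [← ENNReal.ofReal_mul hy.le]
  congr 1
  conv_lhs => rw [show b - 1 = 1 + (b - 1 - 1) by ring, Real.rpow_add hy, Real.rpow_one]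

/-- A function in weak `L¹`, truncated at height `t`, is in `L^b` for `b > 1`. -/
lemma lintegral_min_rpow_le {X : Type*} [MeasurableSpace X] {μ : Measure X}
    {f : X → ℝ≥0∞} (hf : Measurable f) {D : ℝ≥0∞} (hD : ∀ y, y * μ {a | y < f a} ≤ D)
    {b : ℝ} (hb : 1 < b) (t : ℝ≥0∞) :
    ∫⁻ a, min (f a) t ^ b ∂μ ≤ ENNReal.ofReal (b / (b - 1)) * D * t ^ (b - 1) := by
  have hb1 : 0 < b - 1 := by linarith
  rw [lintegral_rpow_eq_lintegral_lt μ (hf.min measurable_const) (by linarith : 0 < b),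
    rpow_eq_lintegral_lt t hb1]
  calc ENNReal.ofReal b * ∫⁻ y in Ioi (0 : ℝ),
        μ {a | ENNReal.ofReal y < min (f a) t} * ENNReal.ofReal (y ^ (b - 1))
      ≤ ENNReal.ofReal b * ∫⁻ y in Ioi (0 : ℝ), D * {y : ℝ | ENNReal.ofReal y < t}.indicator
          (fun y => ENNReal.ofReal (y ^ (b - 1 - 1))) y := by
        gcongr ENNReal.ofReal b * ?_
        refine setLIntegral_mono' measurableSet_Ioi fun y hy => ?_
        by_cases hyt : ENNReal.ofReal y < t
        · simp only [lt_min_iff, hyt, and_true, indicator, mem_ofPred_eq, if_true]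
          rw [ofReal_rpow_split hy, ← mul_assoc, mul_comm (μ _)]
          gcongr
          exact hD _
        · simp [hyt]
    _ = _ := by
        rw [lintegral_const_mul D (Measurable.indicator (by fun_prop)
          (measurableSet_lt (by fun_prop) measurable_const))]
        rw [ENNReal.ofReal_div_of_pos hb1, div_eq_mul_inv]
        have : (ENNReal.ofReal (b - 1))⁻¹ * ENNReal.ofReal (b - 1) = 1 :=
          ENNReal.inv_mul_cancel (ENNReal.ofReal_pos.2 hb1).ne' ENNReal.ofReal_ne_top
        set I := ∫⁻ y in Ioi (0 : ℝ), {y : ℝ | ENNReal.ofReal y < t}.indicator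
          (fun y => ENNReal.ofReal (y ^ (b - 1 - 1))) y
        calc ENNReal.ofReal b * (D * I) = ENNReal.ofReal b *
            ((ENNReal.ofReal (b - 1))⁻¹ * ENNReal.ofReal (b - 1)) * D * I := by
              rw [this]; ring
          _ = _ := by ring

/-- The Hardy-Littlewood maximal theorem. -/
lemma lintegral_powMaximal_rpow_le (hn : 0 < n) {b : ℝ} (hb : 1 < b)
    {f : (Fin n → ℝ) → ℝ≥0∞} (hf : Measurable f) :
    ∫⁻ x, powMaximal 1 f x ^ b ≤
      2 ^ b * 5 ^ n * ENNReal.ofReal (b / (b - 1)) * ∫⁻ x, f x ^ b := by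
  have hb1 : 0 < b - 1 := by linarith
  have hb0 : 0 < b := by linarith
  have hM := measurable_powMaximal zero_le_one f
  -- only the part of `f` above height `y` contributes to the level set at height `2y`
  have hlevel : ∀ y : ℝ≥0∞, y ≠ ⊤ → y * volume {x | y < powMaximal 1 f x / 2} ≤
      5 ^ n * ∫⁻ x in {x | y < f x}, f x := by
    intro y hy
    have hms : MeasurableSet {x | y < f x} := measurableSet_lt measurable_const hf
    have h := mul_volume_lt_powMaximal_le hn le_rfl ({x | y < f x}.indicator f) y
    rw [ENNReal.rpow_one, lintegral_indicator hms] at h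
    refine le_trans ?_ h
    gcongr y * volume ?_
    intro x hx
    rw [mem_ofPred_eq, ENNReal.lt_div_iff_mul_lt (by simp) (by simp), lt_powMaximal_iff] at hx
    obtain ⟨Q, hxQ, hQ⟩ := hx
    refine lt_powMaximal_iff.2 ⟨Q, hxQ, ?_⟩
    rw [ENNReal.rpow_one] at hQ ⊢
    by_contra hcon
    rw [not_lt] at hcon
    refine absurd hQ (not_lt.2 ?_)
    calc ∫⁻ z in Q.carrier, f z
        ≤ ∫⁻ z in Q.carrier, ({x | y < f x}.indicator f z + y) := by
          refine lintegral_mono fun z => ?_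
          by_cases hz : y < f z
          · simp [hz]
          · simpa [hz] using not_lt.1 hz
      _ = (∫⁻ z in Q.carrier, {x | y < f x}.indicator f z) + y * volume Q.carrier := by
          rw [lintegral_add_right _ measurable_const, setLIntegral_const]
      _ ≤ y * 2 * volume Q.carrier := by
          rw [mul_two, add_mul]
          gcongr
  have h2 : ∫⁻ x, (powMaximal 1 f x / 2) ^ b ≤
      5 ^ n * ENNReal.ofReal (b / (b - 1)) * ∫⁻ x, f x ^ b := by
    rw [lintegral_rpow_eq_lintegral_lt volume (hM.div_const 2) hb0]
    have h3 : ∀ x, f x ^ b = f x * f x ^ (b - 1) := fun x => by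
      conv_lhs => rw [show b = 1 + (b - 1) by ring,
        ENNReal.rpow_add_of_nonneg _ _ zero_le_one hb1.le, ENNReal.rpow_one]
    simp_rw [h3]
    rw [lintegral_mul_rpow_eq_lintegral_lt volume hf.aemeasurable hf hb1]
    set I := ∫⁻ y in Ioi (0 : ℝ),
      (∫⁻ a in {a | ENNReal.ofReal y < f a}, f a) * ENNReal.ofReal (y ^ (b - 1 - 1)) with hI
    calc ENNReal.ofReal b * ∫⁻ y in Ioi (0 : ℝ),
          volume {x | ENNReal.ofReal y < powMaximal 1 f x / 2} * ENNReal.ofReal (y ^ (b - 1))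
        ≤ ENNReal.ofReal b * ∫⁻ y in Ioi (0 : ℝ), 5 ^ n *
          ((∫⁻ a in {a | ENNReal.ofReal y < f a}, f a) * ENNReal.ofReal (y ^ (b - 1 - 1))) := by
          gcongr ENNReal.ofReal b * ?_
          refine setLIntegral_mono' measurableSet_Ioi fun y hy => ?_
          rw [ofReal_rpow_split hy, ← mul_assoc, mul_comm (volume _), ← mul_assoc]
          exact mul_le_mul' (hlevel _ ENNReal.ofReal_ne_top) le_rfl
      _ = ENNReal.ofReal b * (5 ^ n * I) := by
          rw [lintegral_const_mul' _ _ (by finiteness)]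
      _ = ENNReal.ofReal b * ((ENNReal.ofReal (b - 1))⁻¹ * ENNReal.ofReal (b - 1)) *
            (5 ^ n * I) := by
          rw [ENNReal.inv_mul_cancel (ENNReal.ofReal_pos.2 hb1).ne' ENNReal.ofReal_ne_top, mul_one]
      _ = _ := by
          rw [ENNReal.ofReal_div_of_pos hb1, div_eq_mul_inv]
          ring
  calc ∫⁻ x, powMaximal 1 f x ^ b = ∫⁻ x, 2 ^ b * (powMaximal 1 f x / 2) ^ b := by
        refine lintegral_congr fun x => ?_
        rw [← ENNReal.mul_rpow_of_nonneg _ _ hb0.le, ENNReal.mul_div_cancel (by simp) (by simp)]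
    _ = 2 ^ b * ∫⁻ x, (powMaximal 1 f x / 2) ^ b := by
        rw [lintegral_const_mul' _ _ (ENNReal.rpow_ne_top_of_nonneg hb0.le (by simp))]
    _ ≤ 2 ^ b * (5 ^ n * ENNReal.ofReal (b / (b - 1)) * ∫⁻ x, f x ^ b) := by gcongr
    _ = _ := by ring

/-! ### Sums over sparse families -/

/-- Integrals over disjoint sets add up to at most the full integral; the family need not be
countable. -/
lemma tsum_setLIntegral_le {X ι : Type*} [MeasurableSpace X] {μ : Measure X} {S : Set ι}
    {A : ι → Set X} (hA : ∀ i ∈ S, MeasurableSet (A i)) (hd : S.PairwiseDisjoint A)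
    (f : X → ℝ≥0∞) : ∑' i : S, ∫⁻ x in A i, f x ∂μ ≤ ∫⁻ x, f x ∂μ := by
  rw [ENNReal.tsum_eq_iSup_sum]
  refine iSup_le fun s => ?_
  rw [← lintegral_biUnion_finset (t := fun i : S => A i)]
  · exact setLIntegral_le_lintegral _ _
  · intro i _ j _ hij
    exact hd i.2 j.2 (Subtype.coe_injective.ne hij)
  · exact fun i _ => hA i i.2

/-- A sparse sum of truncated averages is controlled by Hölder's inequality for the truncated
maximal functions. -/
lemma tsum_sparse_le (hn : 0 < n) {η : ℝ} (hη : 0 < η) {S : Set (Cube n)} (hS : IsSparse η S)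
    {κ : ℝ} (hκ : 1 ≤ κ) (g k : (Fin n → ℝ) → ℝ≥0∞) {β θ a a' : ℝ} (hβ : 0 < β) (hθ : 0 < θ)
    (ha : a.HolderConjugate a') (h1 : 1 < β * a) (h2 : 1 < θ * a') (t t' : ℝ≥0∞) :
    ∑' Q : S, min ((volume Q.1.carrier)⁻¹ * (∫⁻ y in Q.1.carrier, g y) ^ κ) t ^ β *
        min (Q.1.avg k) t' ^ θ * volume Q.1.carrier ≤
      (ENNReal.ofReal η)⁻¹ *
        ((ENNReal.ofReal (β * a / (β * a - 1)) * (5 ^ n * (∫⁻ y, g y) ^ κ) *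
            t ^ (β * a - 1)) ^ (1 / a) *
          (ENNReal.ofReal (θ * a' / (θ * a' - 1)) * (5 ^ n * ∫⁻ y, k y) *
            t' ^ (θ * a' - 1)) ^ (1 / a')) := by
  obtain ⟨-, E, hE, hd⟩ := hS
  set X := fun x => min (powMaximal κ g x) t
  set Y := fun x => min (powMaximal 1 k x) t'
  have hmX : Measurable X := (measurable_powMaximal (by linarith) g).min measurable_const
  have hmY : Measurable Y := (measurable_powMaximal zero_le_one k).min measurable_const
  have hη0 : ENNReal.ofReal η ≠ 0 := (ENNReal.ofReal_pos.2 hη).ne'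
  calc ∑' Q : S, min ((volume Q.1.carrier)⁻¹ * (∫⁻ y in Q.1.carrier, g y) ^ κ) t ^ β *
        min (Q.1.avg k) t' ^ θ * volume Q.1.carrier
      ≤ ∑' Q : S, (ENNReal.ofReal η)⁻¹ * ∫⁻ x in E Q, X x ^ β * Y x ^ θ := by
        refine ENNReal.tsum_le_tsum fun Q => ?_
        obtain ⟨hmE, hEQ, hηE⟩ := hE Q Q.2
        have hvol : volume Q.1.carrier ≤ (ENNReal.ofReal η)⁻¹ * volume (E Q) := by
          rw [mul_comm, ← div_eq_mul_inv, ENNReal.le_div_iff_mul_le (Or.inl hη0)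
            (Or.inl ENNReal.ofReal_ne_top), mul_comm]
          exact hηE
        calc _ ≤ min ((volume Q.1.carrier)⁻¹ * (∫⁻ y in Q.1.carrier, g y) ^ κ) t ^ β *
              min (Q.1.avg k) t' ^ θ * ((ENNReal.ofReal η)⁻¹ * volume (E Q)) := by gcongr
          _ = (ENNReal.ofReal η)⁻¹ * ∫⁻ x in E Q,
                min ((volume Q.1.carrier)⁻¹ * (∫⁻ y in Q.1.carrier, g y) ^ κ) t ^ β *
              min (Q.1.avg k) t' ^ θ := by rw [setLIntegral_const]; ring
          _ ≤ _ := by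
              gcongr (ENNReal.ofReal η)⁻¹ * ?_
              refine setLIntegral_mono' hmE fun x hx => ?_
              have hk : Q.1.avg k ≤ powMaximal 1 k x := by
                simpa [Cube.avg] using le_powMaximal 1 k (hEQ hx)
              have hg := le_powMaximal κ g (hEQ hx)
              simp only [X, Y]
              gcongr
    _ = (ENNReal.ofReal η)⁻¹ * ∑' Q : S, ∫⁻ x in E Q, X x ^ β * Y x ^ θ := ENNReal.tsum_mul_left
    _ ≤ (ENNReal.ofReal η)⁻¹ * ∫⁻ x, X x ^ β * Y x ^ θ := by
        gcongr
        exact tsum_setLIntegral_le (fun Q hQ => (hE Q hQ).1) hd _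
    _ ≤ _ := by
        gcongr (ENNReal.ofReal η)⁻¹ * ?_
        refine (ENNReal.lintegral_mul_le_Lp_mul_Lq volume ha (hmX.pow_const β).aemeasurable
          (hmY.pow_const θ).aemeasurable).trans ?_
        simp only [← ENNReal.rpow_mul]
        have hpa := ha.pos
        have hpa' := ha.symm.pos
        gcongr
        · exact lintegral_min_rpow_le (measurable_powMaximal (by linarith) g)
            (mul_volume_lt_powMaximal_le hn hκ g) h1 t
        · refine lintegral_min_rpow_le (measurable_powMaximal zero_le_one k) (fun y => ?_) h2 t'
          simpa using mul_volume_lt_powMaximal_le hn le_rfl k y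

/-! ### Self-improvement of integrability -/

/-- If the density `ρ` has mass at most `c λ |{G > λ}|` on the level sets of `G` above `λ₀`, then
its integral against `G^ε` is controlled by that of `G^{1+ε}`. -/
lemma lintegral_mul_min_rpow_le {X : Type*} [MeasurableSpace X] {μ : Measure X}
    {G ρ : X → ℝ≥0∞} (hG : Measurable G) (hρ : AEMeasurable ρ μ) {t₀ c : ℝ≥0∞} (hc : c ≠ ⊤) {ε : ℝ}
    (hε : 0 < ε) (h : ∀ t, t₀ ≤ t → t ≠ ⊤ → ∫⁻ x in {x | t < G x}, ρ x ∂μ ≤ c * t * μ {x | t < G x})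
    (L : ℝ≥0∞) :
    ∫⁻ x, ρ x * min (G x) L ^ ε ∂μ ≤
      t₀ ^ ε * ∫⁻ x, ρ x ∂μ + ENNReal.ofReal ε * c * ∫⁻ x, min (G x) L ^ (1 + ε) ∂μ := by
  have hGL : Measurable fun x => min (G x) L := hG.min measurable_const
  have hε1 : 0 < 1 + ε := by linarith
  rw [lintegral_mul_rpow_eq_lintegral_lt μ hρ hGL hε, rpow_eq_lintegral_lt t₀ hε]
  have hind : Measurable ({y : ℝ | ENNReal.ofReal y < t₀}.indicator
      (fun y => ENNReal.ofReal (y ^ (ε - 1)))) :=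
    Measurable.indicator (by fun_prop) (measurableSet_lt (by fun_prop) measurable_const)
  set I := ∫⁻ y in Ioi (0 : ℝ), {y : ℝ | ENNReal.ofReal y < t₀}.indicator
      (fun y => ENNReal.ofReal (y ^ (ε - 1))) y with hI
  set J := ∫⁻ y in Ioi (0 : ℝ),
    μ {x | ENNReal.ofReal y < min (G x) L} * ENNReal.ofReal (y ^ (1 + ε - 1)) with hJ
  have hJle : J ≤ ∫⁻ x, min (G x) L ^ (1 + ε) ∂μ := by
    rw [lintegral_rpow_eq_lintegral_lt μ hGL hε1, ← hJ]
    refine le_mul_of_one_le_left zero_le ?_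
    rw [← ENNReal.ofReal_one]
    exact ENNReal.ofReal_le_ofReal (by linarith)
  calc ENNReal.ofReal ε * ∫⁻ y in Ioi (0 : ℝ),
        (∫⁻ x in {x | ENNReal.ofReal y < min (G x) L}, ρ x ∂μ) * ENNReal.ofReal (y ^ (ε - 1))
      ≤ ENNReal.ofReal ε * ∫⁻ y in Ioi (0 : ℝ),
          ((∫⁻ x, ρ x ∂μ) * {y : ℝ | ENNReal.ofReal y < t₀}.indicator
            (fun y => ENNReal.ofReal (y ^ (ε - 1))) y +
          c * (μ {x | ENNReal.ofReal y < min (G x) L} * ENNReal.ofReal (y ^ (1 + ε - 1)))) := by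
        gcongr ENNReal.ofReal ε * ?_
        refine setLIntegral_mono' measurableSet_Ioi fun y hy => ?_
        by_cases hy0 : ENNReal.ofReal y < t₀
        · refine le_add_right ?_
          simp only [indicator, mem_ofPred_eq, hy0, if_true]
          gcongr
          exact Measure.restrict_le_self
        · refine le_add_left ?_
          by_cases hyL : ENNReal.ofReal y < L
          · simp only [lt_min_iff, hyL, and_true]
            rw [ofReal_rpow_split (b := 1 + ε) hy, show 1 + ε - 1 - 1 = ε - 1 by ring]
            refine (mul_le_mul' (h _ (not_lt.1 hy0) ENNReal.ofReal_ne_top) le_rfl).trans_eq ?_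
            ring
          · simp [hyL]
    _ = ENNReal.ofReal ε * ((∫⁻ x, ρ x ∂μ) * I + c * J) := by
        rw [lintegral_add_left (hind.const_mul _), lintegral_const_mul _ hind,
          lintegral_const_mul' _ _ hc]
    _ = ENNReal.ofReal ε * I * (∫⁻ x, ρ x ∂μ) + ENNReal.ofReal ε * c * J := by ring
    _ ≤ _ := by gcongr

/-- A Gehring-type self-improvement: the hypothesis `∫_{G > t} G ≤ c₁ t |{G > t}|` makes `G^{1+ε}`
integrable for `ε c₁ ≤ 1/2`, and any `u` with `∫_{G > t} u ≤ c₂ t |{G > t}|` inherits this. -/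
lemma lintegral_mul_rpow_le_of_level_sets {X : Type*} [MeasurableSpace X] {μ : Measure X}
    {G u : X → ℝ≥0∞} (hG : Measurable G) (hu : AEMeasurable u μ) {t₀ c₁ c₂ : ℝ≥0∞} (hc₁ : c₁ ≠ ⊤)
    (hc₂ : c₂ ≠ ⊤) {ε : ℝ} (hε : 0 < ε) (hεc : ENNReal.ofReal ε * c₁ ≤ 2⁻¹)
    (h₁ : ∀ t, t₀ ≤ t → t ≠ ⊤ → ∫⁻ x in {x | t < G x}, G x ∂μ ≤ c₁ * t * μ {x | t < G x})
    (h₂ : ∀ t, t₀ ≤ t → t ≠ ⊤ → ∫⁻ x in {x | t < G x}, u x ∂μ ≤ c₂ * t * μ {x | t < G x})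
    (hfin : ∫⁻ x, G x ∂μ ≠ ⊤) :
    ∫⁻ x, u x * G x ^ ε ∂μ ≤
      t₀ ^ ε * (∫⁻ x, u x ∂μ + ENNReal.ofReal ε * c₂ * (2 * ∫⁻ x, G x ∂μ)) := by
  have hsplit : ∀ z : ℝ≥0∞, z ^ (1 + ε) = z * z ^ ε := fun z => by
    rw [ENNReal.rpow_add_of_nonneg _ _ zero_le_one hε.le, ENNReal.rpow_one]
  have htrunc : ∀ k : ℕ, ∫⁻ x, min (G x) k ^ (1 + ε) ∂μ ≤ t₀ ^ ε * (2 * ∫⁻ x, G x ∂μ) := by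
    intro k
    have hle : ∫⁻ x, min (G x) k ^ (1 + ε) ∂μ ≤ ∫⁻ x, G x * min (G x) k ^ ε ∂μ := by
      refine lintegral_mono fun x => ?_
      rw [hsplit]
      gcongr
      exact min_le_left _ _
    refine hle.trans ?_
    set Z := ∫⁻ x, G x * min (G x) k ^ ε ∂μ with hZ
    -- the truncation makes the absorbed term finite
    have hZfin : Z ≠ ⊤ := by
      refine ne_top_of_le_ne_top ?_ (show Z ≤ (∫⁻ x, G x ∂μ) * (k : ℝ≥0∞) ^ ε from ?_)
      · exact ENNReal.mul_ne_top hfin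
          (ENNReal.rpow_ne_top_of_nonneg hε.le (ENNReal.natCast_ne_top k))
      · rw [← lintegral_mul_const _ hG]
        refine lintegral_mono fun x => ?_
        gcongr
        exact min_le_right _ _
    have h := lintegral_mul_min_rpow_le hG hG.aemeasurable hc₁ hε h₁ k
    have h' : Z / 2 + Z / 2 ≤ t₀ ^ ε * ∫⁻ x, G x ∂μ + Z / 2 := by
      rw [ENNReal.add_halves]
      refine h.trans ?_
      gcongr
      rw [div_eq_mul_inv, mul_comm Z]
      gcongr
    have h'' := ENNReal.le_of_add_le_add_right (ENNReal.div_ne_top hZfin (by simp)) h'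
    rw [ENNReal.div_le_iff (by simp) (by simp)] at h''
    calc Z ≤ _ := h''
      _ = _ := by ring
  have hsup : ∫⁻ x, u x * G x ^ ε ∂μ = ⨆ k : ℕ, ∫⁻ x, u x * min (G x) k ^ ε ∂μ := by
    rw [← lintegral_iSup' (f := fun (k : ℕ) x => u x * min (G x) k ^ ε)
      (fun k => hu.mul ((hG.min measurable_const).pow_const ε).aemeasurable)
      (Eventually.of_forall fun x i j hij => by
        dsimp only
        gcongr)]
    refine lintegral_congr fun x => ?_
    rw [← ENNReal.mul_iSup, iSup_min_natCast_rpow _ hε]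
  rw [hsup]
  refine iSup_le fun k => ?_
  refine (lintegral_mul_min_rpow_le hG hu hc₂ hε h₂ k).trans ?_
  calc _ ≤ t₀ ^ ε * ∫⁻ x, u x ∂μ +
        ENNReal.ofReal ε * c₂ * (t₀ ^ ε * (2 * ∫⁻ x, G x ∂μ)) :=
        add_le_add le_rfl (mul_le_mul' le_rfl (htrunc k))
    _ = _ := by ring

/-! ### Dyadic descendants and stopping cubes -/

/-- The cube of generation `m` and multi-index `k` in the dyadic decomposition based on `Q`. -/
def Cube.descendant (Q : Cube n) (m : ℕ) (k : Fin n → ℤ) : Cube n where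
  corner i := Q.corner i + Q.side / 2 ^ m * k i
  side := Q.side / 2 ^ m
  side_pos := by have := Q.side_pos; positivity

/-- The multi-index of the cube of generation `m` containing `x`, in the dyadic decomposition based
on `Q`. -/
def Cube.index (Q : Cube n) (m : ℕ) (x : Fin n → ℝ) (i : Fin n) : ℤ :=
  ⌊(x i - Q.corner i) / (Q.side / 2 ^ m)⌋

/-- The cube of generation `m` containing `x`, in the dyadic decomposition based on `Q`. -/
def Cube.cell (Q : Cube n) (m : ℕ) (x : Fin n → ℝ) : Cube n := Q.descendant m (Q.index m x)

lemma Cube.mem_descendant {Q : Cube n} {m : ℕ} {k : Fin n → ℤ} {x : Fin n → ℝ} :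
    x ∈ (Q.descendant m k).carrier ↔ Q.index m x = k := by
  rw [Cube.mem_carrier, funext_iff]
  refine forall_congr' fun i => ?_
  have hpos : 0 < Q.side / 2 ^ m := by have := Q.side_pos; positivity
  simp only [Cube.descendant, Cube.index]
  rw [Int.floor_eq_iff, le_div_iff₀ hpos, div_lt_iff₀ hpos]
  constructor <;> rintro ⟨h1, h2⟩ <;> constructor <;> nlinarith

lemma Cube.mem_cell {Q : Cube n} {m : ℕ} {x y : Fin n → ℝ} :
    y ∈ (Q.cell m x).carrier ↔ Q.index m y = Q.index m x := Cube.mem_descendant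

lemma Cube.mem_cell_self (Q : Cube n) (m : ℕ) (x : Fin n → ℝ) : x ∈ (Q.cell m x).carrier :=
  Cube.mem_cell.2 rfl

lemma Cube.index_eq_div (Q : Cube n) (m : ℕ) (x : Fin n → ℝ) (i : Fin n) :
    Q.index m x i = Q.index (m + 1) x i / 2 := by
  simp only [Cube.index]
  set z := (x i - Q.corner i) / (Q.side / 2 ^ m) with hz
  have : (x i - Q.corner i) / (Q.side / 2 ^ (m + 1)) = 2 * z := by
    have := Q.side_pos
    rw [hz, pow_succ]
    field_simp
  rw [this, Int.floor_eq_iff]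
  have h1 := Int.floor_le (2 * z)
  have h2 := Int.lt_floor_add_one (2 * z)
  have h3 : (2 * (⌊2 * z⌋ / 2 : ℤ) : ℝ) ≤ ⌊2 * z⌋ := by
    exact_mod_cast (by omega : 2 * (⌊2 * z⌋ / 2) ≤ ⌊2 * z⌋)
  have h4 : (⌊2 * z⌋ + 1 : ℝ) ≤ 2 * (⌊2 * z⌋ / 2 : ℤ) + 2 := by
    exact_mod_cast (by omega : ⌊2 * z⌋ + 1 ≤ 2 * (⌊2 * z⌋ / 2) + 2)
  constructor <;> linarith

lemma Cube.index_eq_of_le {Q : Cube n} {m m' : ℕ} (h : m ≤ m') {x y : Fin n → ℝ}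
    (hxy : Q.index m' x = Q.index m' y) : Q.index m x = Q.index m y := by
  induction m', h using Nat.le_induction with
  | base => exact hxy
  | succ j _ ih =>
    refine ih (funext fun i => ?_)
    rw [Q.index_eq_div j x, Q.index_eq_div j y, hxy]

lemma Cube.cell_eq_of_mem {Q : Cube n} {m m' : ℕ} (h : m ≤ m') {x y : Fin n → ℝ}
    (hy : y ∈ (Q.cell m' x).carrier) : Q.cell m y = Q.cell m x := by
  simp only [Cube.cell, Cube.index_eq_of_le h (Cube.mem_cell.1 hy)]

lemma Cube.cell_subset_cell (Q : Cube n) {m m' : ℕ} (h : m ≤ m') (x : Fin n → ℝ) :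
    (Q.cell m' x).carrier ⊆ (Q.cell m x).carrier := fun y hy => by
  rw [← Cube.cell_eq_of_mem h hy]
  exact Q.mem_cell_self m y

lemma Cube.cell_zero_carrier {Q : Cube n} {x : Fin n → ℝ} (hx : x ∈ Q.carrier) :
    (Q.cell 0 x).carrier = Q.carrier := by
  have h0 : (Q.descendant 0 0).carrier = Q.carrier := by
    simp [Cube.descendant, Cube.carrier]
  have : Q.index 0 x = 0 := Cube.mem_descendant.1 (h0 ▸ hx)
  rw [Cube.cell, this, h0]

lemma Cube.volume_cell (Q : Cube n) (m : ℕ) (x : Fin n → ℝ) :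
    volume (Q.cell m x).carrier = 2 ^ n * volume (Q.cell (m + 1) x).carrier := by
  rw [Cube.volume_carrier, Cube.volume_carrier, ← mul_pow]
  congr 1
  rw [show (2 : ℝ≥0∞) = ENNReal.ofReal 2 by simp, ← ENNReal.ofReal_mul (by norm_num)]
  congr 1
  simp only [Cube.cell, Cube.descendant, pow_succ]
  field_simp

lemma Cube.avg_cell_succ_le (Q : Cube n) (m : ℕ) (x : Fin n → ℝ) (u : (Fin n → ℝ) → ℝ≥0∞) :
    (Q.cell (m + 1) x).avg u ≤ 2 ^ n * (Q.cell m x).avg u := by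
  rw [Cube.avg, Cube.avg, Q.volume_cell m x, ENNReal.mul_inv (by simp) (by simp), ← mul_assoc,
    ← mul_assoc, ENNReal.mul_inv_cancel (by simp) (by finiteness), one_mul]
  gcongr
  exact Q.cell_subset_cell (Nat.le_succ m) x

/-- The dyadic maximal function of `u` with respect to the dyadic descendants of `Q`. -/
def Cube.dyadicMaximal (Q : Cube n) (u : (Fin n → ℝ) → ℝ≥0∞) (x : Fin n → ℝ) : ℝ≥0∞ :=
  ⨆ m, (Q.cell m x).avg u

lemma Cube.measurable_dyadicMaximal (Q : Cube n) (u : (Fin n → ℝ) → ℝ≥0∞) :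
    Measurable (Q.dyadicMaximal u) := by
  refine Measurable.iSup fun m => ?_
  have h1 : Measurable (Q.index m) := measurable_pi_lambda _ fun i =>
    Int.measurable_floor.comp (by fun_prop)
  have h2 : Measurable fun k : Fin n → ℤ => (Q.descendant m k).avg u := measurable_of_countable _
  exact h2.comp h1

lemma Cube.avg_eq_avg_indicator {R P : Cube n} (h : R.carrier ⊆ P.carrier)
    (u : (Fin n → ℝ) → ℝ≥0∞) : R.avg u = R.avg (P.carrier.indicator u) := by
  rw [Cube.avg, Cube.avg]
  congr 1
  refine setLIntegral_congr_fun R.measurableSet_carrier fun y hy => ?_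
  simp [indicator_of_mem (h hy)]

lemma avg_le_maximal {R : Cube n} {f : (Fin n → ℝ) → ℝ≥0∞} {x : Fin n → ℝ} (hx : x ∈ R.carrier) :
    R.avg f ≤ maximal f x :=
  le_iSup₂ (f := fun (Q : Cube n) (_ : x ∈ Q.carrier) => Q.avg f) R hx

lemma Cube.avg_cell_le_maximal {Q : Cube n} {m m' : ℕ} (h : m ≤ m') (u : (Fin n → ℝ) → ℝ≥0∞)
    (x : Fin n → ℝ) :
    (Q.cell m' x).avg u ≤ maximal ((Q.cell m x).carrier.indicator u) x := by
  rw [Cube.avg_eq_avg_indicator (Q.cell_subset_cell h x)]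
  exact avg_le_maximal (Q.mem_cell_self m' x)

lemma Cube.dyadicMaximal_le_maximal {Q : Cube n} (u : (Fin n → ℝ) → ℝ≥0∞) {x : Fin n → ℝ}
    (hx : x ∈ Q.carrier) : Q.dyadicMaximal u x ≤ maximal (Q.carrier.indicator u) x := by
  refine iSup_le fun m => ?_
  rw [← Cube.cell_zero_carrier hx]
  exact Cube.avg_cell_le_maximal (Nat.zero_le m) u x

/-- The Calderón-Zygmund stopping cubes: above the average of `u` over `Q`, the level sets of the
dyadic maximal function decompose into cubes on which the average is comparable to the level and
the maximal function is localized. -/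
lemma Cube.exists_stopping (Q : Cube n) (u : (Fin n → ℝ) → ℝ≥0∞) {t : ℝ≥0∞} (ht : Q.avg u ≤ t) :
    ∃ I : Set (ℕ × (Fin n → ℤ)),
      I.PairwiseDisjoint (fun i => (Q.descendant i.1 i.2).carrier) ∧
      ⋃ i ∈ I, (Q.descendant i.1 i.2).carrier = {x | t < Q.dyadicMaximal u x} ∩ Q.carrier ∧
      ∀ i ∈ I, (Q.descendant i.1 i.2).avg u ≤ 2 ^ n * t ∧
        ∀ x ∈ (Q.descendant i.1 i.2).carrier, Q.dyadicMaximal u x ≤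
          maximal ((Q.descendant i.1 i.2).carrier.indicator u) x := by
  set I : Set (ℕ × (Fin n → ℤ)) := {i | (Q.descendant i.1 i.2).carrier ⊆ Q.carrier ∧
    t < (Q.descendant i.1 i.2).avg u ∧
    ∀ j < i.1, ∀ x ∈ (Q.descendant i.1 i.2).carrier, (Q.cell j x).avg u ≤ t} with hI
  have hcell : ∀ {i : ℕ × (Fin n → ℤ)} {x}, x ∈ (Q.descendant i.1 i.2).carrier →
      Q.cell i.1 x = Q.descendant i.1 i.2 := fun {i x} hx => by
    rw [Cube.cell, Cube.mem_descendant.1 hx]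
  have huniq : ∀ i ∈ I, ∀ j ∈ I, ∀ x, x ∈ (Q.descendant i.1 i.2).carrier →
      x ∈ (Q.descendant j.1 j.2).carrier → ¬ i.1 < j.1 := by
    intro i hi j hj x hxi hxj hlt
    have := hj.2.2 i.1 hlt x hxj
    rw [hcell hxi] at this
    exact not_lt.2 this hi.2.1
  refine ⟨I, ?_, ?_, ?_⟩
  · intro i hi j hj hij
    refine Set.disjoint_left.2 fun x hxi hxj => hij ?_
    have h1 : i.1 = j.1 := le_antisymm (not_lt.1 (huniq j hj i hi x hxj hxi))
      (not_lt.1 (huniq i hi j hj x hxi hxj))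
    refine Prod.ext h1 ?_
    rw [← Cube.mem_descendant.1 hxi, ← Cube.mem_descendant.1 hxj, h1]
  · ext x
    simp only [mem_iUnion, exists_prop, mem_inter_iff, mem_ofPred_eq]
    constructor
    · rintro ⟨i, hi, hx⟩
      refine ⟨?_, hi.1 hx⟩
      refine hi.2.1.trans_le ?_
      rw [← hcell hx]
      exact le_iSup (fun m => (Q.cell m x).avg u) i.1
    · rintro ⟨hx, hxQ⟩
      have hex : ∃ m, t < (Q.cell m x).avg u := lt_iSup_iff.1 hx
      classical
      refine ⟨(Nat.find hex, Q.index (Nat.find hex) x), ⟨?_, Nat.find_spec hex, ?_⟩,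
        Q.mem_cell_self _ x⟩
      · rw [← Cube.cell_zero_carrier hxQ]
        exact Q.cell_subset_cell (Nat.zero_le _) x
      · intro j hj y hy
        rw [Cube.cell_eq_of_mem hj.le (x := x) hy]
        exact not_lt.1 (Nat.find_min hex hj)
  · intro i hi
    constructor
    · obtain ⟨x, hx⟩ := (Q.descendant i.1 i.2).nonempty
      rcases Nat.eq_zero_or_pos i.1 with h0 | h0
      · -- the largest cube is not selected, since its average is at most `t`
        exfalso
        have h := hi.2.1
        rw [← hcell hx, h0, Cube.avg, Cube.cell_zero_carrier (hi.1 hx)] at h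
        exact not_lt.2 ht h
      · have h := hi.2.2 (i.1 - 1) (by omega) x hx
        rw [← hcell hx]
        have h' := Q.avg_cell_succ_le (i.1 - 1) x u
        rw [Nat.sub_add_cancel h0] at h'
        exact h'.trans (by gcongr)
    · intro x hx
      refine iSup_le fun m => ?_
      rcases le_or_gt i.1 m with hm | hm
      · rw [← hcell hx]
        exact Cube.avg_cell_le_maximal hm u x
      · refine (hi.2.2 m hm x hx).trans (hi.2.1.le.trans ?_)
        rw [← hcell hx]
        exact Cube.avg_cell_le_maximal le_rfl u x

/-- Lebesgue differentiation along the dyadic descendants of a cube. -/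
lemma Cube.ae_le_dyadicMaximal (Q : Cube n) {u : (Fin n → ℝ) → ℝ≥0∞}
    (hu : AEMeasurable u) (hfin : ∫⁻ x in Q.carrier, u x ≠ ⊤) :
    ∀ᵐ x ∂volume.restrict Q.carrier, u x ≤ Q.dyadicMaximal u x := by
  rw [ae_restrict_iff' Q.measurableSet_carrier]
  have hfin' : ∫⁻ x, Q.carrier.indicator u x ≠ ⊤ := by
    rwa [lintegral_indicator Q.measurableSet_carrier]
  filter_upwards [(IsUnifLocDoublingMeasure.vitaliFamily volume 1).ae_tendsto_lintegral_div
    (hu.indicator Q.measurableSet_carrier) hfin'] with x hx hxQ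
  have hδ : Tendsto (fun m : ℕ => Q.side / 2 ^ m / 2) atTop (𝓝[>] 0) := by
    refine tendsto_nhdsWithin_iff.2 ⟨?_, Eventually.of_forall fun m => ?_⟩
    · have h := (tendsto_pow_atTop_nhds_zero_of_lt_one (r := (1 / 2 : ℝ)) (by norm_num)
        (by norm_num)).const_mul (Q.side / 2)
      rw [mul_zero] at h
      refine h.congr fun m => ?_
      rw [one_div, inv_pow]
      ring
    · have := Q.side_pos
      exact mem_Ioi.2 (by positivity)
  have h := hx.comp (IsUnifLocDoublingMeasure.tendsto_closedBall_filterAt volume (K := 1) (x := x)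
    (fun m => (Q.cell m x).center) _ hδ (Eventually.of_forall fun m => by
      rw [one_mul]
      exact (Q.cell m x).carrier_subset_closedBall (Q.mem_cell_self m x)))
  rw [indicator_of_mem hxQ] at h
  refine le_of_tendsto h (Eventually.of_forall fun m => ?_)
  refine le_trans ?_ (le_iSup (fun m => (Q.cell m x).avg u) m)
  have hae := (Q.cell m x).carrier_ae_eq_closedBall
  change (∫⁻ y in closedBall (Q.cell m x).center ((Q.cell m x).side / 2), Q.carrier.indicator u y) /
    volume (closedBall (Q.cell m x).center ((Q.cell m x).side / 2)) ≤ _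
  rw [← setLIntegral_congr hae, ← measure_congr hae, Cube.avg, mul_comm, ← div_eq_mul_inv]
  gcongr
  exact indicator_le_self _ _ _

/-! ### Quantitative absolute continuity -/

/-- The sharp reverse Hölder inequality, in the form of a quantitative absolute continuity: if
`∫_R M(u 1_R) ≤ A ∫_R u` for all cubes `R`, then `u(Q ∩ F) ≤ 2 u(Q) (|Q ∩ F| / |Q|)^{1/s}` with `s`
comparable to `A`. -/
theorem setLIntegral_inter_le_of_maximal {u : (Fin n → ℝ) → ℝ≥0∞} (hu : AEMeasurable u)
    {A : ℝ} (hA1 : 1 ≤ A)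
    (hA : ∀ R : Cube n, ∫⁻ x in R.carrier, maximal (R.carrier.indicator u) x ≤
      ENNReal.ofReal A * ∫⁻ x in R.carrier, u x)
    (Q : Cube n) (hfin : ∫⁻ x in Q.carrier, u x ≠ ⊤) {F : Set (Fin n → ℝ)} (hF : MeasurableSet F) :
    ∫⁻ x in Q.carrier ∩ F, u x ≤ 2 * (∫⁻ x in Q.carrier, u x) *
      (volume (Q.carrier ∩ F) / volume Q.carrier) ^ (1 / (1 + 2 ^ (n + 1) * A)) := by
  set μ := volume.restrict Q.carrier with hμ
  set G := Q.dyadicMaximal u with hGdef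
  have hG : Measurable G := Q.measurable_dyadicMaximal u
  set ε : ℝ := 1 / (2 ^ (n + 1) * A) with hε
  have hA0 : 0 < A := by linarith
  have hε0 : 0 < ε := by positivity
  have hεA : ENNReal.ofReal ε * (2 ^ n * ENNReal.ofReal A) = 2⁻¹ := by
    rw [show (2 : ℝ≥0∞) ^ n = ENNReal.ofReal (2 ^ n) by
      rw [ENNReal.ofReal_pow (by norm_num)]; simp, ← ENNReal.ofReal_mul (by positivity),
      ← ENNReal.ofReal_mul hε0.le, hε, pow_succ]
    rw [show 1 / (2 ^ n * 2 * A) * (2 ^ n * A) = (2 : ℝ)⁻¹ by field_simp,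
      ENNReal.ofReal_inv_of_pos (by norm_num)]
    simp
  have hGA : ∫⁻ x, G x ∂μ ≤ ENNReal.ofReal A * ∫⁻ x, u x ∂μ :=
    (setLIntegral_mono' Q.measurableSet_carrier fun x hx =>
      Cube.dyadicMaximal_le_maximal u hx).trans (hA Q)
  have hGfin : ∫⁻ x, G x ∂μ ≠ ⊤ :=
    ne_top_of_le_ne_top (ENNReal.mul_ne_top ENNReal.ofReal_ne_top hfin) hGA
  -- integrals over level sets of `G` are sums over stopping cubes
  have hlevel : ∀ (ρ : (Fin n → ℝ) → ℝ≥0∞) (c t : ℝ≥0∞), Q.avg u ≤ t →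
      (∀ R : Cube n, R.avg u ≤ 2 ^ n * t →
        (∀ x ∈ R.carrier, G x ≤ maximal (R.carrier.indicator u) x) →
        ∫⁻ x in R.carrier, ρ x ≤ c * volume R.carrier) →
      ∫⁻ x in {x | t < G x}, ρ x ∂μ ≤ c * μ {x | t < G x} := by
    intro ρ c t ht hR
    have hms : MeasurableSet {x | t < G x} := measurableSet_lt measurable_const hG
    obtain ⟨I, hd, hU, hI⟩ := Q.exists_stopping u ht
    rw [hμ, Measure.restrict_restrict hms, Measure.restrict_apply hms, ← hU,
      lintegral_biUnion (to_countable I) (fun i _ => Cube.measurableSet_carrier _) hd,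
      measure_biUnion (to_countable I) hd (fun i _ => Cube.measurableSet_carrier _),
      ← ENNReal.tsum_mul_left]
    exact ENNReal.tsum_le_tsum fun i => hR _ (hI i i.2).1 (hI i i.2).2
  have havg : ∀ R : Cube n, ∀ t : ℝ≥0∞, R.avg u ≤ t →
      ∫⁻ x in R.carrier, u x ≤ t * volume R.carrier := fun R t h => by
    rw [Cube.avg, mul_comm, ← div_eq_mul_inv, ENNReal.div_le_iff R.volume_ne_zero
      R.volume_ne_top] at h
    exact h
  have hmain := lintegral_mul_rpow_le_of_level_sets (μ := μ) hG hu.restrict (t₀ := Q.avg u)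
    (c₁ := 2 ^ n * ENNReal.ofReal A) (c₂ := 2 ^ n) (by finiteness) (by finiteness) hε0 hεA.le
    (fun t ht _ => by
      refine hlevel G _ t ht fun R h1 h2 => ?_
      refine (setLIntegral_mono' R.measurableSet_carrier h2).trans ((hA R).trans ?_)
      refine (mul_le_mul' le_rfl (havg R _ h1)).trans_eq ?_
      ring)
    (fun t ht _ => hlevel u _ t ht fun R h1 _ => havg R _ h1) hGfin
  have hpow : ∫⁻ x, u x ^ (1 + ε) ∂μ ≤ Q.avg u ^ ε * (2 * ∫⁻ x, u x ∂μ) := by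
    calc ∫⁻ x, u x ^ (1 + ε) ∂μ ≤ ∫⁻ x, u x * G x ^ ε ∂μ := by
          refine lintegral_mono_ae ?_
          filter_upwards [Q.ae_le_dyadicMaximal hu hfin] with x hx
          rw [ENNReal.rpow_add_of_nonneg _ _ zero_le_one hε0.le, ENNReal.rpow_one]
          gcongr
      _ ≤ _ := hmain
      _ ≤ _ := by
          refine mul_le_mul' le_rfl ?_
          rw [two_mul (∫⁻ x, u x ∂μ)]
          refine add_le_add le_rfl ?_
          calc ENNReal.ofReal ε * 2 ^ n * (2 * ∫⁻ x, G x ∂μ)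
              ≤ ENNReal.ofReal ε * 2 ^ n * (2 * (ENNReal.ofReal A * ∫⁻ x, u x ∂μ)) := by gcongr
            _ = (ENNReal.ofReal ε * (2 ^ n * ENNReal.ofReal A)) * 2 * ∫⁻ x, u x ∂μ := by ring
            _ = ∫⁻ x, u x ∂μ := by
                rw [hεA, ENNReal.inv_mul_cancel (by simp) (by simp), one_mul]
  have hε1 : 0 < 1 + ε := by linarith
  have hconj : (1 + ε).HolderConjugate ((1 + ε) / ε) := by
    rw [Real.holderConjugate_iff]
    refine ⟨by linarith, ?_⟩
    field_simp
  have hexp : 1 / ((1 + ε) / ε) = 1 / (1 + 2 ^ (n + 1) * A) := by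
    rw [hε]
    field_simp
    ring
  have hholder := ENNReal.lintegral_mul_le_Lp_mul_Lq μ hconj hu.restrict
    ((measurable_one (α := ℝ≥0∞)).indicator hF).aemeasurable
  have hprod : ∫⁻ x, (u * F.indicator (1 : (Fin n → ℝ) → ℝ≥0∞)) x ∂μ =
      ∫⁻ x in Q.carrier ∩ F, u x := by
    have h1 : u * F.indicator 1 = F.indicator u := by
      ext x
      by_cases hx : x ∈ F <;> simp [hx]
    rw [h1, lintegral_indicator hF, hμ, Measure.restrict_restrict hF, inter_comm]
  have hone : ∫⁻ x, F.indicator (1 : (Fin n → ℝ) → ℝ≥0∞) x ^ ((1 + ε) / ε) ∂μ =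
      volume (Q.carrier ∩ F) := by
    have h1 : ∀ x, F.indicator (1 : (Fin n → ℝ) → ℝ≥0∞) x ^ ((1 + ε) / ε) = F.indicator 1 x := by
      intro x
      have : 0 < (1 + ε) / ε := by positivity
      by_cases hx : x ∈ F <;> simp [hx, this]
    simp_rw [h1]
    rw [lintegral_indicator_one hF, hμ, Measure.restrict_apply hF, inter_comm]
  rw [hprod, hone, hexp] at hholder
  refine hholder.trans ?_
  have hbase : ∫⁻ x, u x ^ (1 + ε) ∂μ ≤
      (2 * ∫⁻ x, u x ∂μ) ^ (1 + ε) * (volume Q.carrier)⁻¹ ^ ε := by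
    refine hpow.trans ?_
    rw [Cube.avg, ENNReal.mul_rpow_of_nonneg _ _ hε0.le,
      ENNReal.rpow_add_of_nonneg _ _ zero_le_one hε0.le, ENNReal.rpow_one]
    calc _ = (2 * ∫⁻ x, u x ∂μ) * (∫⁻ x, u x ∂μ) ^ ε * (volume Q.carrier)⁻¹ ^ ε := by ring
      _ ≤ _ := by
          gcongr
          exact le_mul_of_one_le_left zero_le (by norm_num)
  calc _ ≤ ((2 * ∫⁻ x, u x ∂μ) ^ (1 + ε) * (volume Q.carrier)⁻¹ ^ ε) ^ (1 / (1 + ε)) *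
        volume (Q.carrier ∩ F) ^ (1 / (1 + 2 ^ (n + 1) * A)) := by gcongr
    _ = _ := by
        have hexp' : ε * (1 / (1 + ε)) = 1 / (1 + 2 ^ (n + 1) * A) := by
          rw [← hexp]
          field_simp
        rw [ENNReal.mul_rpow_of_nonneg _ _ (by positivity), ← ENNReal.rpow_mul,
          ← ENNReal.rpow_mul, hexp', mul_one_div_cancel hε1.ne', ENNReal.rpow_one,
          mul_assoc (2 * _), ← ENNReal.mul_rpow_of_nonneg _ _ (by positivity),
          mul_comm (volume Q.carrier)⁻¹, ← div_eq_mul_inv]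

/-! ### Averages and the Fujii-Wilson constant -/

/-- The normalized Lebesgue measure on a cube. -/
def Cube.unif (Q : Cube n) : Measure (Fin n → ℝ) :=
  (volume Q.carrier)⁻¹ • volume.restrict Q.carrier

instance (Q : Cube n) : IsProbabilityMeasure Q.unif := ⟨by
  simp [Cube.unif, ENNReal.inv_mul_cancel Q.volume_ne_zero Q.volume_ne_top]⟩

lemma Cube.avg_eq_lintegral (Q : Cube n) (f : (Fin n → ℝ) → ℝ≥0∞) :
    Q.avg f = ∫⁻ x, f x ∂Q.unif := by
  rw [Cube.unif, lintegral_smul_measure, Cube.avg, smul_eq_mul]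

lemma Cube.unif_absolutelyContinuous (Q : Cube n) : Q.unif ≪ volume :=
  (Measure.smul_absolutelyContinuous).trans Measure.restrict_le_self.absolutelyContinuous

lemma Cube.avg_congr_ae (Q : Cube n) {f g : (Fin n → ℝ) → ℝ≥0∞} (h : f =ᵐ[volume] g) :
    Q.avg f = Q.avg g := by
  rw [Q.avg_eq_lintegral, Q.avg_eq_lintegral]
  exact lintegral_congr_ae (Q.unif_absolutelyContinuous.ae_le h)

/-- Power means over a cube increase with the exponent. -/
lemma Cube.avg_rpow_le (Q : Cube n) {f : (Fin n → ℝ) → ℝ≥0∞} (hf : AEMeasurable f) {s t : ℝ}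
    (hs : 0 < s) (hst : s ≤ t) :
    (Q.avg fun x => f x ^ s) ^ (1 / s) ≤ (Q.avg fun x => f x ^ t) ^ (1 / t) := by
  have h := eLpNorm'_le_eLpNorm'_of_exponent_le (f := f) hs hst Q.unif
    (hf.mono_ac Q.unif_absolutelyContinuous).aestronglyMeasurable
  simpa [eLpNorm'_eq_lintegral_enorm, Cube.avg_eq_lintegral] using h

/-- A cube `R` meeting `Q` can be replaced by a subcube of `Q` without decreasing the average of
`u 1_Q`: if `R` is smaller than `Q` slide it into `Q`, otherwise take `Q` itself. -/
lemma Cube.exists_subcube_avg_le (Q R : Cube n) {x : Fin n → ℝ} (hxQ : x ∈ Q.carrier)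
    (hxR : x ∈ R.carrier) (u : (Fin n → ℝ) → ℝ≥0∞) :
    ∃ P : Cube n, x ∈ P.carrier ∧ P.carrier ⊆ Q.carrier ∧
      R.avg (Q.carrier.indicator u) ≤ P.avg u := by
  have hint : ∫⁻ y in R.carrier, Q.carrier.indicator u y = ∫⁻ y in Q.carrier ∩ R.carrier, u y := by
    rw [lintegral_indicator Q.measurableSet_carrier,
      Measure.restrict_restrict Q.measurableSet_carrier]
  rcases le_total Q.side R.side with h | h
  · refine ⟨Q, hxQ, Subset.rfl, ?_⟩
    rw [Cube.avg, Cube.avg, hint]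
    gcongr ?_⁻¹ * ?_
    · rw [Q.volume_carrier, R.volume_carrier]
      gcongr
    · exact lintegral_mono_set inter_subset_left
  · let P : Cube n := ⟨fun i => max (Q.corner i) (min (R.corner i) (Q.corner i + Q.side - R.side)),
      R.side, R.side_pos⟩
    have hsub : Q.carrier ∩ R.carrier ⊆ P.carrier := by
      rintro y ⟨hyQ, hyR⟩
      rw [Cube.mem_carrier] at hyQ hyR ⊢
      intro i
      obtain ⟨h1, h2⟩ := hyQ i
      obtain ⟨h3, h4⟩ := hyR i
      simp only [P]
      refine ⟨max_le h1 ((min_le_left _ _).trans h3), ?_⟩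
      rw [← sub_lt_iff_lt_add, lt_max_iff, lt_min_iff]
      exact Or.inr ⟨by linarith, by linarith⟩
    refine ⟨P, hsub ⟨hxQ, hxR⟩, ?_, ?_⟩
    · intro y hy
      rw [Cube.mem_carrier] at hy ⊢
      intro i
      obtain ⟨h1, h2⟩ := hy i
      simp only [P] at h1 h2
      refine ⟨(le_max_left _ _).trans h1, h2.trans_le ?_⟩
      rw [← le_sub_iff_add_le]
      exact max_le (by linarith) (min_le_right _ _)
    · rw [Cube.avg, Cube.avg, hint]
      gcongr ?_⁻¹ * ?_
      · rw [P.volume_carrier, R.volume_carrier]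
      · exact lintegral_mono_set hsub

/-- If averages of `u` are controlled by power means of a smaller exponent `δ < 1`, then the
maximal function of `u` is controlled by that of `u^δ`, which is bounded on `L^{1/δ}`. -/
lemma setLIntegral_maximal_le_of_avg_le (hn : 0 < n) {u : (Fin n → ℝ) → ℝ≥0∞} (hu : AEMeasurable u)
    {δ : ℝ} (hδ : 0 < δ) (hδ1 : δ < 1) {A : ℝ≥0∞} (hAtop : A ≠ ⊤)
    (hA : ∀ R : Cube n, R.avg u ≤ A * (R.avg fun x => u x ^ δ) ^ (1 / δ)) (Q : Cube n) :
    ∫⁻ x in Q.carrier, maximal (Q.carrier.indicator u) x ≤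
      2 ^ (1 / δ) * 5 ^ n * ENNReal.ofReal (1 / δ / (1 / δ - 1)) * A * ∫⁻ x in Q.carrier, u x := by
  have hb : 1 < 1 / δ := by rw [lt_div_iff₀ hδ]; linarith
  set f : (Fin n → ℝ) → ℝ≥0∞ := fun x => Q.carrier.indicator (hu.mk u) x ^ δ with hf
  have hfm : Measurable f := (hu.measurable_mk.indicator Q.measurableSet_carrier).pow_const δ
  have hpt : ∀ x ∈ Q.carrier, maximal (Q.carrier.indicator u) x ≤
      A * powMaximal 1 f x ^ (1 / δ) := by
    intro x hx
    refine iSup₂_le fun R hxR => ?_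
    obtain ⟨P, hxP, hPQ, hP⟩ := Q.exists_subcube_avg_le R hx hxR u
    refine hP.trans ((hA P).trans ?_)
    gcongr
    rw [← maximal_eq_powMaximal]
    refine le_trans (le_of_eq ?_) (avg_le_maximal hxP)
    rw [Cube.avg_congr_ae P (g := fun x => hu.mk u x ^ δ)
      (by filter_upwards [hu.ae_eq_mk] with y hy; rw [hy]), Cube.avg, Cube.avg]
    congr 1
    refine setLIntegral_congr_fun P.measurableSet_carrier fun y hy => ?_
    simp [hf, indicator_of_mem (hPQ hy)]
  calc ∫⁻ x in Q.carrier, maximal (Q.carrier.indicator u) x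
      ≤ ∫⁻ x in Q.carrier, A * powMaximal 1 f x ^ (1 / δ) :=
        setLIntegral_mono' Q.measurableSet_carrier hpt
    _ ≤ A * ∫⁻ x, powMaximal 1 f x ^ (1 / δ) := by
        rw [lintegral_const_mul' _ _ hAtop]
        gcongr
        exact Measure.restrict_le_self
    _ ≤ A * (2 ^ (1 / δ) * 5 ^ n * ENNReal.ofReal (1 / δ / (1 / δ - 1)) *
          ∫⁻ x, f x ^ (1 / δ)) := by
        gcongr
        exact lintegral_powMaximal_rpow_le hn hb hfm
    _ = A * (2 ^ (1 / δ) * 5 ^ n * ENNReal.ofReal (1 / δ / (1 / δ - 1)) *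
          ∫⁻ x in Q.carrier, u x) := by
        congr 2
        simp only [hf, ← ENNReal.rpow_mul, mul_one_div_cancel hδ.ne', ENNReal.rpow_one]
        rw [lintegral_indicator Q.measurableSet_carrier]
        exact lintegral_congr_ae (ae_restrict_of_ae hu.ae_eq_mk.symm)
    _ = _ := by ring

/-! ### Weights -/

section Weight

variable {v : (Fin n → ℝ) → ℝ}

lemma IsWeight.aemeasurable (hv : IsWeight v) : AEMeasurable fun x => ENNReal.ofReal (v x) :=
  hv.1.aestronglyMeasurable.aemeasurable.ennreal_ofReal

lemma IsWeight.ae_ne_zero (hv : IsWeight v) : ∀ᵐ x, ENNReal.ofReal (v x) ≠ 0 := by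
  filter_upwards [hv.2] with x hx
  exact (ENNReal.ofReal_pos.2 hx).ne'

lemma Cube.integrableOn_of_locallyIntegrable (Q : Cube n) {E : Type*} [NormedAddCommGroup E]
    {f : (Fin n → ℝ) → E} (hf : LocallyIntegrable f) : IntegrableOn f Q.carrier :=
  (hf.integrableOn_isCompact (isCompact_closedBall Q.center (Q.side / 2))).mono_set
    Q.carrier_subset_closedBall

lemma IsWeight.setLIntegral_ne_top (hv : IsWeight v) (Q : Cube n) :
    ∫⁻ x in Q.carrier, ENNReal.ofReal (v x) ≠ ⊤ := by
  refine ne_top_of_le_ne_top (Q.integrableOn_of_locallyIntegrable hv.1).2.ne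
    (lintegral_mono fun x => ?_)
  exact Real.ofReal_le_enorm _

lemma IsWeight.setLIntegral_rpow_ne_zero (hv : IsWeight v) (Q : Cube n) (s : ℝ) :
    ∫⁻ x in Q.carrier, ENNReal.ofReal (v x) ^ s ≠ 0 := by
  rw [Ne, lintegral_eq_zero_iff' (hv.aemeasurable.restrict.pow_const s)]
  intro h
  have h' : ∀ᵐ x ∂volume.restrict Q.carrier, False := by
    filter_upwards [h, ae_restrict_of_ae hv.ae_ne_zero] with x hx hx0
    simp only [Pi.zero_apply, ENNReal.rpow_eq_zero_iff, hx0, ENNReal.ofReal_ne_top] at hx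
    simp at hx
  rw [ae_restrict_iff' Q.measurableSet_carrier] at h'
  exact Q.volume_ne_zero (measure_mono_null
    (show Q.carrier ⊆ {x | ¬(x ∈ Q.carrier → False)} from fun x hx h => h hx) (ae_iff.1 h'))

lemma IsWeight.setLIntegral_ne_zero (hv : IsWeight v) (Q : Cube n) :
    ∫⁻ x in Q.carrier, ENNReal.ofReal (v x) ≠ 0 := by
  simpa using hv.setLIntegral_rpow_ne_zero Q 1

lemma IsWeight.avg_ne_zero (hv : IsWeight v) (Q : Cube n) :
    (Q.avg fun x => ENNReal.ofReal (v x)) ≠ 0 :=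
  mul_ne_zero (ENNReal.inv_ne_zero.2 Q.volume_ne_top) (hv.setLIntegral_ne_zero Q)

lemma IsWeight.avg_ne_top (hv : IsWeight v) (Q : Cube n) :
    (Q.avg fun x => ENNReal.ofReal (v x)) ≠ ⊤ :=
  ENNReal.mul_ne_top (ENNReal.inv_ne_top.2 Q.volume_ne_zero) (hv.setLIntegral_ne_top Q)

lemma IsWeight.setLIntegral_maximal_le_constAInfty (hv : IsWeight v) (Q : Cube n) :
    ∫⁻ x in Q.carrier, maximal (Q.carrier.indicator fun y => ENNReal.ofReal (v y)) x ≤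
      constAInfty v * ∫⁻ x in Q.carrier, ENNReal.ofReal (v x) := by
  rw [← ENNReal.div_le_iff (hv.setLIntegral_ne_zero Q) (hv.setLIntegral_ne_top Q)]
  exact le_iSup (fun Q : Cube n =>
    (∫⁻ x in Q.carrier, maximal (Q.carrier.indicator fun y => ENNReal.ofReal (v y)) x) /
      ∫⁻ x in Q.carrier, ENNReal.ofReal (v x)) Q

/-- A cube to test suprema over all cubes with. -/
def unitCube (n : ℕ) : Cube n := ⟨0, 1, one_pos⟩

lemma setLIntegral_le_setLIntegral_maximal (u : (Fin n → ℝ) → ℝ≥0∞) (Q : Cube n) :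
    ∫⁻ x in Q.carrier, u x ≤ ∫⁻ x in Q.carrier, maximal (Q.carrier.indicator u) x := by
  calc ∫⁻ x in Q.carrier, u x = ∫⁻ x in Q.carrier, Q.avg u := by
        rw [setLIntegral_const, Cube.avg, mul_comm, ← mul_assoc,
          ENNReal.mul_inv_cancel Q.volume_ne_zero Q.volume_ne_top, one_mul]
    _ ≤ _ := by
        refine setLIntegral_mono' Q.measurableSet_carrier fun x hx => ?_
        rw [Cube.avg_eq_avg_indicator Subset.rfl]
        exact avg_le_maximal hx

lemma IsWeight.one_le_constAInfty (hv : IsWeight v) : 1 ≤ constAInfty v := by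
  have h := (setLIntegral_le_setLIntegral_maximal _ (unitCube n)).trans
    (hv.setLIntegral_maximal_le_constAInfty (unitCube n))
  by_contra hlt
  refine absurd h (not_le.2 ?_)
  have := ENNReal.mul_lt_mul_left (hv.setLIntegral_ne_zero (unitCube n))
    (hv.setLIntegral_ne_top (unitCube n)) (not_le.1 hlt)
  rwa [one_mul] at this

lemma avg_mul_le_constA_one (v : (Fin n → ℝ) → ℝ) (Q : Cube n) :
    (Q.avg fun x => ENNReal.ofReal (v x)) *
      (essInf (fun x => ENNReal.ofReal (v x)) (volume.restrict Q.carrier))⁻¹ ≤ constA 1 v := by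
  rw [constA, if_pos rfl]
  exact le_iSup (fun Q : Cube n => (Q.avg fun x => ENNReal.ofReal (v x)) *
      (essInf (fun x => ENNReal.ofReal (v x)) (volume.restrict Q.carrier))⁻¹) Q

lemma avg_mul_le_constA {r : ℝ} (hr : r ≠ 1) (v : (Fin n → ℝ) → ℝ) (Q : Cube n) :
    (Q.avg fun x => ENNReal.ofReal (v x)) *
      (Q.avg fun x => ENNReal.ofReal (v x) ^ (-1 / (r - 1))) ^ (r - 1) ≤ constA r v := by
  rw [constA, if_neg hr]
  exact le_iSup (fun Q : Cube n => (Q.avg fun x => ENNReal.ofReal (v x)) *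
      (Q.avg fun x => ENNReal.ofReal (v x) ^ (-1 / (r - 1))) ^ (r - 1)) Q

/-- The `A₁` condition as a pointwise lower bound. -/
lemma MemA.ae_avg_le (hv : MemA 1 v) (Q : Cube n) :
    ∀ᵐ x ∂volume.restrict Q.carrier,
      (Q.avg fun x => ENNReal.ofReal (v x)) ≤ constA 1 v * ENNReal.ofReal (v x) := by
  have h := avg_mul_le_constA_one v Q
  filter_upwards [ae_essInf_le (f := fun x => ENNReal.ofReal (v x))
    (μ := volume.restrict Q.carrier)] with x hx
  set m := essInf (fun x => ENNReal.ofReal (v x)) (volume.restrict Q.carrier) with hm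
  have hmtop : m ≠ ⊤ := ne_top_of_le_ne_top ENNReal.ofReal_ne_top hx
  have hm0 : m ≠ 0 := by
    intro h0
    rw [h0, ENNReal.inv_zero, ENNReal.mul_top (hv.1.avg_ne_zero Q)] at h
    exact hv.2.ne (top_le_iff.1 h)
  rw [← div_eq_mul_inv, ENNReal.div_le_iff hm0 hmtop] at h
  exact h.trans (by gcongr)

/-- `A_r` weights satisfy an averaging condition with small exponents. -/
lemma MemA.avg_le {r : ℝ} (hr : 1 ≤ r) (hv : MemA r v) : ∃ δ : ℝ, 0 < δ ∧ δ < 1 ∧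
    ∀ Q : Cube n, (Q.avg fun x => ENNReal.ofReal (v x)) ≤
      constA r v * (Q.avg fun x => ENNReal.ofReal (v x) ^ δ) ^ (1 / δ) := by
  -- for `r > 1`, `1 ≤ ⟨v^{-δ}⟩ ⟨v^δ⟩` and `⟨v^{-δ}⟩^{1/δ}` is at most the dual average in `[v]_{A_r}`
  -- as soon as `δ ≤ 1 / (r - 1)`
  rcases hr.eq_or_lt with rfl | hr1
  · refine ⟨1 / 2, by norm_num, by norm_num, fun Q => ?_⟩
    set V := fun x => ENNReal.ofReal (v x) with hV
    have hA : constA 1 v ^ (1 / 2 : ℝ) ≠ ⊤ := ENNReal.rpow_ne_top_of_nonneg (by norm_num) hv.2.ne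
    have h : Q.avg V ^ (1 / 2 : ℝ) ≤
        constA 1 v ^ (1 / 2 : ℝ) * Q.avg fun x => V x ^ (1 / 2 : ℝ) := by
      calc Q.avg V ^ (1 / 2 : ℝ) = ∫⁻ x, Q.avg V ^ (1 / 2 : ℝ) ∂Q.unif := by simp
        _ ≤ ∫⁻ x, constA 1 v ^ (1 / 2 : ℝ) * V x ^ (1 / 2 : ℝ) ∂Q.unif := by
            refine lintegral_mono_ae ((Measure.smul_absolutelyContinuous).ae_le ?_)
            filter_upwards [hv.ae_avg_le Q] with x hx
            rw [← ENNReal.mul_rpow_of_nonneg _ _ (by norm_num)]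
            exact ENNReal.rpow_le_rpow hx (by norm_num)
        _ = _ := by rw [lintegral_const_mul' _ _ hA, Q.avg_eq_lintegral]
    have h2 := ENNReal.rpow_le_rpow h (z := 2) (by norm_num)
    rw [ENNReal.mul_rpow_of_nonneg _ _ (by norm_num), ← ENNReal.rpow_mul, ← ENNReal.rpow_mul] at h2
    norm_num at h2
    norm_num
    exact h2
  · have hr0 : 0 < r - 1 := by linarith
    set δ := min (1 / (r - 1)) (1 / 2) with hδ
    have hδ0 : 0 < δ := lt_min (by positivity) (by norm_num)
    refine ⟨δ, hδ0, (min_le_right _ _).trans_lt (by norm_num), fun Q => ?_⟩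
    set V := fun x => ENNReal.ofReal (v x) with hV
    have hVm : AEMeasurable V := hv.1.aemeasurable
    have hVm' : AEMeasurable V Q.unif := hVm.mono_ac Q.unif_absolutelyContinuous
    have hmean : (Q.avg fun x => V x ^ (-δ)) ^ (1 / δ) ≤
        (Q.avg fun x => V x ^ (-1 / (r - 1))) ^ (r - 1) := by
      have h := Q.avg_rpow_le hVm.inv hδ0 (min_le_left (1 / (r - 1)) (1 / 2))
      simp only [Pi.inv_apply, ENNReal.inv_rpow, ← ENNReal.rpow_neg, one_div_one_div] at h
      simpa only [neg_div] using h
    have hone : 1 ≤ (Q.avg fun x => V x ^ (-δ)) * (Q.avg fun x => V x ^ δ) := by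
      have h := ENNReal.lintegral_mul_le_Lp_mul_Lq Q.unif Real.HolderConjugate.two_two
        (f := fun x => V x ^ (-δ / 2)) (g := fun x => V x ^ (δ / 2))
        (hVm'.pow_const _) (hVm'.pow_const _)
      have h1 : ∫⁻ x, ((fun x => V x ^ (-δ / 2)) * fun x => V x ^ (δ / 2)) x ∂Q.unif = 1 := by
        rw [← measure_univ (μ := Q.unif), ← lintegral_one]
        refine lintegral_congr_ae ?_
        filter_upwards [Q.unif_absolutelyContinuous.ae_le hv.1.ae_ne_zero] with x hx
        simp only [Pi.mul_apply]
        rw [← ENNReal.rpow_add _ _ hx ENNReal.ofReal_ne_top, show -δ / 2 + δ / 2 = 0 by ring,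
          ENNReal.rpow_zero]
      rw [h1] at h
      simp only [← ENNReal.rpow_mul, div_mul_cancel₀ _ (two_ne_zero (α := ℝ)),
        ← Cube.avg_eq_lintegral] at h
      rw [← ENNReal.mul_rpow_of_nonneg _ _ (by norm_num)] at h
      have h2 := ENNReal.rpow_le_rpow h (z := 2) (by norm_num)
      rwa [ENNReal.one_rpow, ← ENNReal.rpow_mul, one_div, inv_mul_cancel₀ two_ne_zero,
        ENNReal.rpow_one] at h2
    calc Q.avg V ≤ Q.avg V * ((Q.avg fun x => V x ^ (-δ)) * (Q.avg fun x => V x ^ δ)) ^ (1 / δ) := by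
          refine le_mul_of_one_le_right zero_le ?_
          exact ENNReal.one_le_rpow hone (by positivity)
      _ = Q.avg V * (Q.avg fun x => V x ^ (-δ)) ^ (1 / δ) * (Q.avg fun x => V x ^ δ) ^ (1 / δ) := by
          rw [ENNReal.mul_rpow_of_nonneg _ _ (by positivity), mul_assoc]
      _ ≤ Q.avg V * (Q.avg fun x => V x ^ (-1 / (r - 1))) ^ (r - 1) *
            (Q.avg fun x => V x ^ δ) ^ (1 / δ) := by gcongr
      _ ≤ _ := by
          gcongr
          exact avg_mul_le_constA hr1.ne' v Q

/-- Muckenhoupt weights have finite Fujii-Wilson constant. -/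
lemma MemA.constAInfty_lt_top (hn : 0 < n) {r : ℝ} (hr : 1 ≤ r) (hv : MemA r v) :
    constAInfty v < ⊤ := by
  obtain ⟨δ, hδ, hδ1, hA⟩ := hv.avg_le hr
  refine lt_of_le_of_lt (b := 2 ^ (1 / δ) * 5 ^ n * ENNReal.ofReal (1 / δ / (1 / δ - 1)) *
    constA r v) (iSup_le fun Q => ?_) ?_
  · rw [ENNReal.div_le_iff (hv.1.setLIntegral_ne_zero Q) (hv.1.setLIntegral_ne_top Q)]
    exact setLIntegral_maximal_le_of_avg_le hn hv.1.aemeasurable hδ hδ1 hv.2.ne hA Q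
  · have h1 : (2 : ℝ≥0∞) ^ (1 / δ) ≠ ⊤ := ENNReal.rpow_ne_top_of_nonneg (by positivity) (by simp)
    have h2 := hv.2.ne
    exact Ne.lt_top (by finiteness)

lemma MemAInfty.constAInfty_lt_top (hn : 0 < n) (hv : MemAInfty v) : constAInfty v < ⊤ := by
  obtain ⟨r, hr, h⟩ := hv
  exact h.constAInfty_lt_top hn hr

/-- Quantitative absolute continuity of an `A_∞` weight. -/
lemma IsWeight.setLIntegral_inter_le (hv : IsWeight v) (h : constAInfty v < ⊤)
    (Q : Cube n) {F : Set (Fin n → ℝ)} (hF : MeasurableSet F) :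
    ∫⁻ x in Q.carrier ∩ F, ENNReal.ofReal (v x) ≤ 2 * (∫⁻ x in Q.carrier, ENNReal.ofReal (v x)) *
      (volume (Q.carrier ∩ F) / volume Q.carrier) ^
        (1 / (1 + 2 ^ (n + 1) * (constAInfty v).toReal)) := by
  refine setLIntegral_inter_le_of_maximal hv.aemeasurable ?_ (fun R => ?_) Q
    (hv.setLIntegral_ne_top Q) hF
  · rw [← ENNReal.toReal_one]
    exact ENNReal.toReal_mono h.ne hv.one_le_constAInfty
  · rw [ENNReal.ofReal_toReal h.ne]
    exact hv.setLIntegral_maximal_le_constAInfty R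

/-- The reverse Hölder condition, with the convention `[v]_{RH₁} = 1`. -/
lemma IsWeight.avg_rpow_le_constRH (hv : IsWeight v) (s : ℝ) (Q : Cube n) :
    (Q.avg fun x => ENNReal.ofReal (v x) ^ s) ^ (1 / s) ≤
      constRH s v * Q.avg fun x => ENNReal.ofReal (v x) := by
  by_cases hs : s = 1
  · subst hs
    simp [constRH]
  · rw [← ENNReal.div_le_iff (hv.avg_ne_zero Q) (hv.avg_ne_top Q), constRH, if_neg hs]
    exact le_iSup (fun Q : Cube n => (Q.avg fun x => ENNReal.ofReal (v x) ^ s) ^ (1 / s) /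
        (Q.avg fun x => ENNReal.ofReal (v x))) Q

lemma IsWeight.one_le_constRH (hv : IsWeight v) {s : ℝ} (hs : 1 ≤ s) : 1 ≤ constRH s v := by
  have h := ((unitCube n).avg_rpow_le hv.aemeasurable one_pos hs).trans
    (hv.avg_rpow_le_constRH s (unitCube n))
  simp only [ENNReal.rpow_one, div_one] at h
  by_contra hlt
  refine absurd h (not_le.2 ?_)
  have := ENNReal.mul_lt_mul_left (hv.avg_ne_zero (unitCube n))
    (hv.avg_ne_top (unitCube n)) (not_le.1 hlt)
  rwa [one_mul] at this

lemma IsWeight.setLIntegral_rpow_ne_top (hv : IsWeight v) {s : ℝ} (hs : 1 < s)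
    (h : constRH s v < ⊤) (Q : Cube n) : ∫⁻ x in Q.carrier, ENNReal.ofReal (v x) ^ s ≠ ⊤ := by
  have h1 := ne_top_of_le_ne_top (ENNReal.mul_ne_top h.ne (hv.avg_ne_top Q))
    (hv.avg_rpow_le_constRH s Q)
  intro htop
  refine h1 ?_
  rw [Cube.avg, htop, ENNReal.mul_top (ENNReal.inv_ne_zero.2 Q.volume_ne_top),
    ENNReal.top_rpow_of_pos (by positivity)]

/-- The power `v^s` of a weight `v ∈ RH_s` is an `A_∞` weight, with Fujii-Wilson constant at most
`C [v]_{RH_s}^s`; this is its quantitative absolute continuity. -/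
lemma IsWeight.setLIntegral_rpow_inter_le (hn : 0 < n) (hv : IsWeight v) {s : ℝ} (hs : 1 < s)
    (h : constRH s v < ⊤) {C : ℝ} (hC : C = 2 ^ s * 5 ^ n * (s / (s - 1)))
    (Q : Cube n) {F : Set (Fin n → ℝ)} (hF : MeasurableSet F) :
    ∫⁻ x in Q.carrier ∩ F, ENNReal.ofReal (v x) ^ s ≤
      2 * (∫⁻ x in Q.carrier, ENNReal.ofReal (v x) ^ s) *
      (volume (Q.carrier ∩ F) / volume Q.carrier) ^
        (1 / (1 + 2 ^ (n + 1) * (C * (constRH s v).toReal ^ s))) := by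
  have hs0 : 0 < s := by linarith
  have hs1 : 0 < s - 1 := by linarith
  have hum : AEMeasurable fun x => ENNReal.ofReal (v x) ^ s := hv.aemeasurable.pow_const s
  have hR1 : 1 ≤ (constRH s v).toReal := by
    rw [← ENNReal.toReal_one]
    exact ENNReal.toReal_mono h.ne (hv.one_le_constRH hs.le)
  have hC0 : 1 ≤ C := by
    rw [hC]
    have h1 : (1 : ℝ) ≤ 2 ^ s := Real.one_le_rpow (by norm_num) hs0.le
    have h2 : (1 : ℝ) ≤ 5 ^ n := one_le_pow₀ (by norm_num)
    have h3 : 1 ≤ s / (s - 1) := by rw [le_div_iff₀ hs1]; linarith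
    exact one_le_mul_of_one_le_of_one_le (one_le_mul_of_one_le_of_one_le h1 h2) h3
  have hRs : 1 ≤ (constRH s v).toReal ^ s := Real.one_le_rpow hR1 hs0.le
  refine setLIntegral_inter_le_of_maximal hum
    (one_le_mul_of_one_le_of_one_le hC0 hRs) (fun R => ?_) Q
    (hv.setLIntegral_rpow_ne_top hs h Q) hF
  have hA : ∀ R : Cube n, (R.avg fun x => ENNReal.ofReal (v x) ^ s) ≤ constRH s v ^ s *
      (R.avg fun x => (ENNReal.ofReal (v x) ^ s) ^ (1 / s)) ^ (1 / (1 / s)) := by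
    intro R
    have h1 := ENNReal.rpow_le_rpow (hv.avg_rpow_le_constRH s R) hs0.le
    rw [← ENNReal.rpow_mul, one_div_mul_cancel hs0.ne', ENNReal.rpow_one,
      ENNReal.mul_rpow_of_nonneg _ _ hs0.le] at h1
    simpa only [← ENNReal.rpow_mul, mul_one_div_cancel hs0.ne', ENNReal.rpow_one,
      one_div_one_div] using h1
  have hmain := setLIntegral_maximal_le_of_avg_le hn hum (δ := 1 / s) (by positivity)
    (by rw [div_lt_one hs0]; exact hs) (ENNReal.rpow_ne_top_of_nonneg hs0.le h.ne) hA R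
  refine hmain.trans (le_of_eq ?_)
  congr 1
  rw [one_div_one_div, ENNReal.ofReal_mul (by linarith), hC, ENNReal.ofReal_mul (by positivity),
    ENNReal.ofReal_mul (by positivity), ← ENNReal.ofReal_rpow_of_nonneg ENNReal.toReal_nonneg hs0.le,
    ENNReal.ofReal_toReal h.ne, ENNReal.ofReal_pow (by norm_num),
    ← ENNReal.ofReal_rpow_of_pos (by norm_num)]
  norm_num

end Weight

variable {𝕜 : Type*} [RCLike 𝕜]

/-! ### Weighted estimates on a single cube -/

lemma fracAvg_zero (p : ℝ) (f : (Fin n → ℝ) → 𝕜) (Q : Cube n) :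
    fracAvg 0 p f Q = (Q.avg fun x => ‖f x‖ₑ ^ p) ^ (1 / p) := by
  rw [fracAvg, zero_div, sub_zero, ENNReal.rpow_neg_one, Cube.avg]

lemma fracAvg_eq_volume_rpow_mul {α p : ℝ} (hp : 0 < p) (f : (Fin n → ℝ) → 𝕜) (Q : Cube n) :
    fracAvg α p f Q =
      volume Q.carrier ^ (α / (n * p)) * (Q.avg fun x => ‖f x‖ₑ ^ p) ^ (1 / p) := by
  rw [fracAvg, Cube.avg, show -(1 - α / n) = α / n + -1 by ring,
    ENNReal.rpow_add _ _ Q.volume_ne_zero Q.volume_ne_top, ENNReal.rpow_neg_one, mul_assoc,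
    ENNReal.mul_rpow_of_nonneg _ _ (by positivity), ← ENNReal.rpow_mul]
  congr 2
  field_simp

section Weight

variable {w : (Fin n → ℝ) → ℝ}

lemma IsWeight.ae_ofReal_rpow (hw : IsWeight w) (q : ℝ) :
    ∀ᵐ x, ENNReal.ofReal (w x ^ q) = ENNReal.ofReal (w x) ^ q := by
  filter_upwards [hw.2] with x hx
  rw [ENNReal.ofReal_rpow_of_pos hx]

lemma IsWeight.ae_enorm_eq (hw : IsWeight w) {q : ℝ} (hq : 0 < q) (h : (Fin n → ℝ) → 𝕜) :
    ∀ᵐ x, ‖h x‖ₑ = ‖w x • h x‖ₑ * ENNReal.ofReal (w x ^ q) ^ (-1 / q) := by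
  filter_upwards [hw.2] with x hx
  have h0 : ENNReal.ofReal (w x) ≠ 0 := (ENNReal.ofReal_pos.2 hx).ne'
  rw [enorm_smul, Real.enorm_of_nonneg hx.le, ← ENNReal.ofReal_rpow_of_pos hx, ← ENNReal.rpow_mul,
    mul_div_cancel₀ _ hq.ne', ENNReal.rpow_neg_one, mul_right_comm,
    ENNReal.mul_inv_cancel h0 ENNReal.ofReal_ne_top, one_mul]

/-- Hölder's inequality and the Muckenhoupt condition turn an average of `h` into a weighted
average. -/
lemma fracAvg_le_of_memA (hw : IsWeight w) {p₀ p q : ℝ} (hp₀ : 1 ≤ p₀) (hp₀p : p₀ ≤ p)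
    (hpq : p ≤ q) (hA : MemA ((1 / p₀ - 1 / p) * q + 1) (fun x => w x ^ q))
    {h : (Fin n → ℝ) → 𝕜} (hh : AEStronglyMeasurable h) (Q : Cube n) :
    fracAvg 0 p₀ h Q ≤ constA ((1 / p₀ - 1 / p) * q + 1) (fun x => w x ^ q) ^ (1 / q) *
      (Q.avg fun x => ‖w x • h x‖ₑ ^ p) ^ (1 / p) *
      (Q.avg fun x => ENNReal.ofReal (w x ^ q)) ^ (-1 / q) := by
  have hp : 0 < p := by linarith
  have hp0 : 0 < p₀ := by linarith
  have hq : 0 < q := by linarith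
  set V := fun x => ENNReal.ofReal (w x ^ q) with hV
  have hVm : AEMeasurable V := hA.1.aemeasurable
  set f := fun x => ‖w x • h x‖ₑ with hf
  have hfm : AEMeasurable f := (hw.1.aestronglyMeasurable.smul hh).enorm
  have hdiv : ∀ z : ℝ≥0∞, z ^ (-1 / q) = (z⁻¹) ^ (1 / q) := fun z => by
    rw [neg_div, ENNReal.rpow_neg, ENNReal.inv_rpow]
  rw [fracAvg_zero]
  rcases hp₀p.eq_or_lt with rfl | hlt
  · rw [show (1 / p₀ - 1 / p₀) * q + 1 = 1 by ring] at hA ⊢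
    have hpt : ∀ᵐ x ∂Q.unif, ‖h x‖ₑ ^ p₀ ≤
        (constA 1 (fun x => w x ^ q) * (Q.avg V)⁻¹) ^ (p₀ / q) * f x ^ p₀ := by
      filter_upwards [(Measure.smul_absolutelyContinuous).ae_le (hA.ae_avg_le Q),
        Q.unif_absolutelyContinuous.ae_le (hw.ae_enorm_eq hq h),
        Q.unif_absolutelyContinuous.ae_le hA.1.ae_ne_zero] with x hx1 hx2 hx3
      rw [hx2, ENNReal.mul_rpow_of_nonneg _ _ hp0.le, mul_comm, ← ENNReal.rpow_mul]
      gcongr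
      rw [show -1 / q * p₀ = -(p₀ / q) by ring, ENNReal.rpow_neg, ← ENNReal.inv_rpow]
      gcongr
      rw [← div_eq_mul_inv, ENNReal.le_div_iff_mul_le (Or.inl (hA.1.avg_ne_zero Q))
        (Or.inl (hA.1.avg_ne_top Q)), mul_comm, ← div_eq_mul_inv,
        ENNReal.div_le_iff hx3 ENNReal.ofReal_ne_top]
      exact hx1
    have hfin : (constA 1 (fun x => w x ^ q) * (Q.avg V)⁻¹) ^ (p₀ / q) ≠ ⊤ :=
      ENNReal.rpow_ne_top_of_nonneg (by positivity)
        (ENNReal.mul_ne_top hA.2.ne (ENNReal.inv_ne_top.2 (hA.1.avg_ne_zero Q)))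
    have h1 := ENNReal.rpow_le_rpow (lintegral_mono_ae hpt) (z := 1 / p₀) (by positivity)
    rw [lintegral_const_mul' _ _ hfin, ← Cube.avg_eq_lintegral, ← Cube.avg_eq_lintegral,
      ENNReal.mul_rpow_of_nonneg _ _ (by positivity), ← ENNReal.rpow_mul,
      show p₀ / q * (1 / p₀) = 1 / q by field_simp,
      ENNReal.mul_rpow_of_nonneg _ _ (by positivity)] at h1
    rw [hdiv]
    exact h1.trans_eq (by ring)
  · set d := 1 / p₀ - 1 / p with hd
    have hd0 : 0 < d := by
      rw [hd, sub_pos]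
      exact one_div_lt_one_div_of_lt hp0 hlt
    have hr : d * q + 1 ≠ 1 := by
      have : 0 < d * q := by positivity
      linarith
    have hhol := ENNReal.lintegral_Lp_mul_le_Lq_mul_Lr (p := p₀) (q := p) (r := 1 / d) hp0 hlt
      (by rw [one_div_one_div, hd]; ring) Q.unif (hfm.mono_ac Q.unif_absolutelyContinuous)
      ((hVm.pow_const (-1 / q)).mono_ac Q.unif_absolutelyContinuous)
    have hleft : ∫⁻ x, (f * fun x => V x ^ (-1 / q)) x ^ p₀ ∂Q.unif =
        Q.avg fun x => ‖h x‖ₑ ^ p₀ := by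
      rw [Cube.avg_eq_lintegral]
      refine lintegral_congr_ae ?_
      filter_upwards [Q.unif_absolutelyContinuous.ae_le (hw.ae_enorm_eq hq h)] with x hx
      rw [hx, Pi.mul_apply]
    rw [hleft, one_div_one_div] at hhol
    refine hhol.trans ?_
    rw [← Cube.avg_eq_lintegral, ← Cube.avg_eq_lintegral, mul_right_comm, mul_comm]
    gcongr
    have hc := avg_mul_le_constA hr (fun x => w x ^ q) Q
    rw [mul_comm, ← ENNReal.le_div_iff_mul_le (Or.inl (hA.1.avg_ne_zero Q))
        (Or.inl (hA.1.avg_ne_top Q)), ENNReal.div_eq_inv_mul] at hc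
    have hc' := ENNReal.rpow_le_rpow hc (z := 1 / q) (by positivity)
    rw [← ENNReal.rpow_mul, ENNReal.mul_rpow_of_nonneg _ _ (by positivity), ← hdiv] at hc'
    simp only [← ENNReal.rpow_mul]
    have e1 : -1 / (d * q + 1 - 1) = -1 / q * (1 / d) := by
      rw [add_sub_cancel_right]
      field_simp
    have e2 : (d * q + 1 - 1) * (1 / q) = d := by field_simp; ring
    rw [e1, e2] at hc'
    exact hc'.trans_eq (mul_comm _ _)

/-- Hölder's inequality, the reverse Hölder condition and the quantitative absolute continuity of
`V^σ` bound an average of the weight over a small set. The last exponent exceeds `1 - 1 / q`. -/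
lemma avg_rpow_le_of_absolutelyContinuous {V : (Fin n → ℝ) → ℝ≥0∞} (hV : AEMeasurable V)
    {q σ s r : ℝ} (hq : 1 ≤ q) (hσ : 1 ≤ σ) (hr : 0 < r) (hrq : 1 / r = 1 - 1 / q + 1 / (q * σ))
    {R : ℝ≥0∞} (hs : 0 < s) {F : Set (Fin n → ℝ)} (hF : MeasurableSet F) (Q : Cube n)
    (hR : (Q.avg fun x => V x ^ σ) ^ (1 / σ) ≤ R * Q.avg V)
    (hd : ∫⁻ x in Q.carrier ∩ F, V x ^ σ ≤ 2 * (∫⁻ x in Q.carrier, V x ^ σ) *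
      (volume (Q.carrier ∩ F) / volume Q.carrier) ^ (1 / s))
    {g : (Fin n → ℝ) → 𝕜} (hg : ∀ᵐ x, ‖g x‖ₑ ≤ F.indicator (fun x => V x ^ (1 / q)) x) :
    (Q.avg fun x => ‖g x‖ₑ ^ r) ^ (1 / r) ≤ 2 * R ^ (1 / q) * (Q.avg V) ^ (1 / q) *
      (Q.avg (F.indicator 1)) ^ (1 - 1 / q + 1 / (q * σ * s)) := by
  have hq0 : 0 < q := by linarith
  have hσ0 : 0 < σ := by linarith
  have hq1 : 0 ≤ 1 - 1 / q := by
    rw [sub_nonneg, div_le_one hq0]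
    exact hq
  set Y := Q.avg (F.indicator 1) with hY
  have hYvol : Y = volume (Q.carrier ∩ F) / volume Q.carrier := by
    rw [hY, Cube.avg, lintegral_indicator_one hF, Measure.restrict_apply hF, inter_comm, mul_comm,
      div_eq_mul_inv]
  set f := F.indicator (fun x => V x ^ (1 / q)) with hf
  have hfm : AEMeasurable f Q.unif :=
    ((hV.pow_const _).indicator hF).mono_ac Q.unif_absolutelyContinuous
  have h1 : (Q.avg fun x => ‖g x‖ₑ ^ r) ^ (1 / r) ≤ (Q.avg fun x => f x ^ r) ^ (1 / r) := by
    rw [Cube.avg_eq_lintegral, Cube.avg_eq_lintegral]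
    gcongr ?_ ^ (1 / r)
    refine lintegral_mono_ae ?_
    filter_upwards [Q.unif_absolutelyContinuous.ae_le hg] with x hx
    gcongr
  have h2 : (Q.avg fun x => f x ^ r) ^ (1 / r) ≤
      (Q.avg fun x => f x ^ (q * σ)) ^ (1 / (q * σ)) * Y ^ (1 - 1 / q) := by
    rcases hq.eq_or_lt with rfl | hq'
    · have : r = 1 * σ := by
        rw [div_one, sub_self, zero_add] at hrq
        field_simp at hrq
        linarith
      rw [this]
      simp
    · have hq1' : 0 < 1 - 1 / q := by
        rw [sub_pos, div_lt_one hq0]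
        exact hq'
      have hlt : r < q * σ := by
        refine lt_of_one_div_lt_one_div (by positivity) ?_
        rw [hrq]
        linarith
      have h := ENNReal.lintegral_Lp_mul_le_Lq_mul_Lr (p := r) (q := q * σ)
        (r := 1 / (1 - 1 / q)) hr hlt (by rw [one_div_one_div, hrq]; ring) Q.unif hfm
        (g := F.indicator 1) ((measurable_one.indicator hF).aemeasurable)
      have e1 : f * F.indicator 1 = f := by
        ext x
        by_cases hx : x ∈ F <;> simp [hf, hx]
      have e2 : ∀ x, (F.indicator (1 : (Fin n → ℝ) → ℝ≥0∞) x) ^ (1 / (1 - 1 / q)) =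
          F.indicator 1 x := by
        intro x
        have : 0 < (1 - 1 / q)⁻¹ := by positivity
        by_cases hx : x ∈ F <;> simp [hx, -inv_pos, -one_div, one_div (1 - 1 / q), this]
      simp_rw [e1, e2] at h
      rw [one_div_one_div] at h
      simpa only [← Cube.avg_eq_lintegral] using h
  have h3 : (Q.avg fun x => f x ^ (q * σ)) ≤ 2 * (Q.avg fun x => V x ^ σ) * Y ^ (1 / s) := by
    have e : (fun x => f x ^ (q * σ)) = F.indicator fun x => V x ^ σ := by
      ext x
      have h0 : 0 < q * σ := by positivity
      by_cases hx : x ∈ F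
      · simp only [hf, hx, indicator_of_mem, ← ENNReal.rpow_mul]
        congr 1
        field_simp
      · simp [hf, hx, h0]
    rw [e, Cube.avg, lintegral_indicator hF, Measure.restrict_restrict hF, inter_comm, Cube.avg,
      hYvol]
    calc _ ≤ (volume Q.carrier)⁻¹ * (2 * (∫⁻ x in Q.carrier, V x ^ σ) *
          (volume (Q.carrier ∩ F) / volume Q.carrier) ^ (1 / s)) := by gcongr
      _ = _ := by ring
  have hqσ : 1 ≤ q * σ := one_le_mul_of_one_le_of_one_le hq hσ
  calc _ ≤ (2 * (Q.avg fun x => V x ^ σ) * Y ^ (1 / s)) ^ (1 / (q * σ)) * Y ^ (1 - 1 / q) := by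
        refine h1.trans (h2.trans ?_)
        gcongr
    _ = 2 ^ (1 / (q * σ)) * ((Q.avg fun x => V x ^ σ) ^ (1 / σ)) ^ (1 / q) *
          (Y ^ (1 - 1 / q) * Y ^ (1 / (q * σ * s))) := by
        rw [ENNReal.mul_rpow_of_nonneg _ _ (by positivity),
          ENNReal.mul_rpow_of_nonneg _ _ (by positivity), ← ENNReal.rpow_mul, ← ENNReal.rpow_mul,
          show 1 / s * (1 / (q * σ)) = 1 / (q * σ * s) by field_simp,
          show 1 / σ * (1 / q) = 1 / (q * σ) by field_simp]
        ring
    _ ≤ 2 ^ (1 : ℝ) * (R * Q.avg V) ^ (1 / q) * (Y ^ (1 - 1 / q) * Y ^ (1 / (q * σ * s))) := by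
        gcongr
        · norm_num
        · rw [div_le_one (by positivity)]
          exact hqσ
    _ = _ := by
        rw [ENNReal.rpow_one, ENNReal.mul_rpow_of_nonneg _ _ (by positivity),
          ← ENNReal.rpow_add_of_nonneg _ _ hq1 (by positivity)]
        ring

/-! ### The sparse form against an almost characteristic function -/

/-- The set `F` without the points where the maximal function of `g` exceeds the threshold for which
the weak-type bound guarantees that at most half of `F` is lost. -/
def goodPart (κ : ℝ) (g : (Fin n → ℝ) → ℝ≥0∞) (F : Set (Fin n → ℝ)) : Set (Fin n → ℝ) :=
  F \ {x | 2 * (5 ^ n * (∫⁻ y, g y) ^ κ) / volume F < powMaximal κ g x}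

lemma measurableSet_goodPart {κ : ℝ} (hκ : 0 ≤ κ) (g : (Fin n → ℝ) → ℝ≥0∞) {F : Set (Fin n → ℝ)}
    (hF : MeasurableSet F) : MeasurableSet (goodPart κ g F) :=
  hF.diff (measurableSet_lt measurable_const (measurable_powMaximal hκ g))

lemma volume_le_two_mul_goodPart (hn : 0 < n) {κ : ℝ} (hκ : 1 ≤ κ) {g : (Fin n → ℝ) → ℝ≥0∞}
    (hg : ∫⁻ y, g y ≠ ⊤) {F : Set (Fin n → ℝ)} (hF0 : volume F ≠ 0)
    (hFtop : volume F ≠ ⊤) : volume F ≤ 2 * volume (goodPart κ g F) := by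
  set D := 5 ^ n * (∫⁻ y, g y) ^ κ with hD
  set t := 2 * D / volume F with ht
  set B := {x | t < powMaximal κ g x} with hB
  have hκ0 : 0 ≤ κ := by linarith
  have hDtop : D ≠ ⊤ :=
    ENNReal.mul_ne_top (by finiteness) (ENNReal.rpow_ne_top_of_nonneg hκ0 hg)
  have hbad : 2 * volume B ≤ volume F := by
    rcases eq_or_ne D 0 with h0 | h0
    · have hg0 : ∫⁻ y, g y = 0 := by
        rw [hD, mul_eq_zero] at h0
        rcases h0 with h0 | h0
        · simp at h0
        · rcases ENNReal.rpow_eq_zero_iff.1 h0 with h | h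
          · exact h.1
          · linarith [h.2]
      have : B = ∅ := by
        refine eq_empty_of_forall_notMem fun x hx => ?_
        obtain ⟨Q, -, hQ⟩ := lt_powMaximal_iff.1 hx
        have : ∫⁻ y in Q.carrier, g y = 0 :=
          le_antisymm ((setLIntegral_le_lintegral _ _).trans hg0.le) zero_le
        rw [this, ENNReal.zero_rpow_of_pos (by linarith)] at hQ
        exact not_lt_zero hQ
      simp [this]
    · have h : 2 * (D / volume F * volume B) ≤ D := by
        have h : t * volume B ≤ D := mul_volume_lt_powMaximal_le hn hκ g t
        rwa [show t * volume B = 2 * (D / volume F * volume B) by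
          rw [ht, mul_div_assoc, mul_assoc]] at h
      have h' : D * (2 * volume B) ≤ D * volume F := by
        calc D * (2 * volume B) = (2 * (D / volume F * volume B)) * volume F := by
              rw [div_eq_mul_inv]
              calc _ = D * (2 * volume B) * ((volume F)⁻¹ * volume F) := by
                    rw [ENNReal.inv_mul_cancel hF0 hFtop, mul_one]
                _ = _ := by ring
          _ ≤ D * volume F := by gcongr
      exact (ENNReal.mul_le_mul_iff_right h0 hDtop).1 h'
  have hsub : volume F ≤ volume (goodPart κ g F) + volume B := by
    refine (measure_mono (t := goodPart κ g F ∪ B) fun x hx => ?_).trans (measure_union_le _ _)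
    by_cases hxB : x ∈ B
    · exact Or.inr hxB
    · exact Or.inl ⟨hx, hxB⟩
  have h2 : volume F + volume F ≤ 2 * volume (goodPart κ g F) + volume F := by
    calc volume F + volume F = 2 * volume F := (two_mul _).symm
      _ ≤ 2 * (volume (goodPart κ g F) + volume B) := by gcongr
      _ = 2 * volume (goodPart κ g F) + 2 * volume B := mul_add _ _ _
      _ ≤ _ := by gcongr
  exact ENNReal.le_of_add_le_add_right hFtop h2

/-- Numerical form of the bound: the exponents of `J` and `K` in the product of the two factors of
Hölder's inequality add up to `1 / q` and `1 - 1 / q`. -/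
lemma holder_product_le {q a a' c : ℝ} (hq : 1 ≤ q) (ha : a.HolderConjugate a')
    (haq : 1 < 1 / q * a) {J K D : ℝ≥0∞} (hD : 1 ≤ D) (hK0 : K ≠ 0) (hK : K ≠ ⊤)
    {c₁ c₂ : ℝ} (h₁ : c₁ ≤ c) (h₂ : c₂ ≤ c) {K' : ℝ≥0∞} (hK' : K' ≤ K) {θ : ℝ} :
    (ENNReal.ofReal c₁ * (D * J) * (2 * (D * J) / K) ^ (1 / q * a - 1)) ^ (1 / a) *
      (ENNReal.ofReal c₂ * (D * K') * 1 ^ θ) ^ (1 / a') ≤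
    ENNReal.ofReal c * (2 * D ^ 2) * (J ^ (1 / q) * K ^ (1 - 1 / q)) := by
  have hapos := ha.pos
  have hapos' := ha.symm.pos
  have hq0 : 0 < q := by linarith
  have hsum : 1 / a + 1 / a' = 1 := by
    have := ha.inv_add_inv_eq_one
    rwa [one_div, one_div]
  set e := 1 / q * a - 1 with he
  have he0 : 0 < e := by linarith
  have hq1 : 0 ≤ 1 - 1 / q := by
    rw [sub_nonneg, div_le_one hq0]
    exact hq
  have hpow : ∀ z : ℝ≥0∞, z * z ^ e = z ^ (1 / q * a) := fun z => by
    rw [show 1 / q * a = 1 + e by rw [he]; ring,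
      ENNReal.rpow_add_of_nonneg _ _ zero_le_one he0.le, ENNReal.rpow_one]
  have hDJ : (D * J) * (2 * (D * J) / K) ^ e ≤ (2 * (D * J)) ^ (1 / q * a) * K ^ (-e) := by
    rw [ENNReal.div_rpow_of_nonneg _ _ he0.le, div_eq_mul_inv, ← ENNReal.rpow_neg, ← mul_assoc,
      ← hpow]
    refine mul_le_mul' (mul_le_mul' ?_ le_rfl) le_rfl
    exact le_mul_of_one_le_left zero_le (by norm_num)
  have hA : (ENNReal.ofReal c₁ * (D * J) * (2 * (D * J) / K) ^ e) ^ (1 / a) ≤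
      ENNReal.ofReal c ^ (1 / a) * ((2 * D) * J ^ (1 / q) * K ^ (1 / a - 1 / q)) := by
    calc _ ≤ (ENNReal.ofReal c * ((2 * (D * J)) ^ (1 / q * a) * K ^ (-e))) ^ (1 / a) := by
          rw [mul_assoc]
          gcongr
      _ = ENNReal.ofReal c ^ (1 / a) * ((2 * D) ^ (1 / q) * J ^ (1 / q) * K ^ (1 / a - 1 / q)) := by
          rw [ENNReal.mul_rpow_of_nonneg _ _ (by positivity),
            ENNReal.mul_rpow_of_nonneg _ _ (by positivity), ← ENNReal.rpow_mul, ← ENNReal.rpow_mul,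
            show 1 / q * a * (1 / a) = 1 / q by field_simp,
            show -e * (1 / a) = 1 / a - 1 / q by rw [he]; field_simp; ring, ← mul_assoc 2 D J,
            ENNReal.mul_rpow_of_nonneg _ _ (by positivity)]
      _ ≤ _ := by
          gcongr
          refine (ENNReal.rpow_le_rpow_of_exponent_le (z := 1) ?_ ?_).trans_eq (ENNReal.rpow_one _)
          · exact one_le_mul_of_one_le_of_one_le (by norm_num) hD
          · rw [div_le_one hq0]
            exact hq
  have hB : (ENNReal.ofReal c₂ * (D * K') * 1 ^ θ) ^ (1 / a') ≤
      ENNReal.ofReal c ^ (1 / a') * (D * K ^ (1 / a')) := by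
    calc _ ≤ (ENNReal.ofReal c * (D * K)) ^ (1 / a') := by
          rw [ENNReal.one_rpow, mul_one]
          gcongr
      _ = ENNReal.ofReal c ^ (1 / a') * (D ^ (1 / a') * K ^ (1 / a')) := by
          rw [ENNReal.mul_rpow_of_nonneg _ _ (by positivity),
            ENNReal.mul_rpow_of_nonneg _ _ (by positivity)]
      _ ≤ _ := by
          gcongr
          refine (ENNReal.rpow_le_rpow_of_exponent_le (z := 1) hD ?_).trans_eq
            (ENNReal.rpow_one _)
          have : 0 < 1 / a := by positivity
          linarith
  calc _ ≤ (ENNReal.ofReal c ^ (1 / a) * ((2 * D) * J ^ (1 / q) * K ^ (1 / a - 1 / q))) *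
        (ENNReal.ofReal c ^ (1 / a') * (D * K ^ (1 / a'))) := mul_le_mul' hA hB
    _ = (ENNReal.ofReal c ^ (1 / a) * ENNReal.ofReal c ^ (1 / a')) * (2 * D ^ 2) *
          (J ^ (1 / q) * (K ^ (1 / a - 1 / q) * K ^ (1 / a'))) := by ring
    _ = _ := by
        rw [← ENNReal.rpow_add_of_nonneg _ _ (by positivity) (by positivity), hsum,
          ENNReal.rpow_one, ← ENNReal.rpow_add _ _ hK0 hK,
          show 1 / a - 1 / q + 1 / a' = 1 - 1 / q by linarith]

/-- The restricted estimate behind the weak-type bound: on the good part of `F`, a sparse form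
against a function of size at most `w` has the size predicted by duality. -/
lemma sparseForm_le_of_goodPart (hn : 0 < n) (hw : IsWeight w) {α p₀ p q σ s η : ℝ} {q₀ : ℝ≥0∞}
    (hp₀ : 1 ≤ p₀) (hp₀p : p₀ ≤ p) (hpq : p ≤ q) (hσ : 1 ≤ σ) (hs : 1 ≤ s) (hη : 0 < η)
    (hr : 0 < (ENNReal.conjExponent q₀).toReal)
    (hrel : 1 / p - 1 / q = α / (n * (ENNReal.conjExponent q₀).toReal))
    (hrq : 1 / (ENNReal.conjExponent q₀).toReal = 1 - 1 / q + 1 / (q * σ))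
    (hA : MemA ((1 / p₀ - 1 / p) * q + 1) (fun x => w x ^ q))
    (hd : ∀ (Q : Cube n) (F : Set (Fin n → ℝ)), MeasurableSet F →
      ∫⁻ x in Q.carrier ∩ F, ENNReal.ofReal (w x ^ q) ^ σ ≤
        2 * (∫⁻ x in Q.carrier, ENNReal.ofReal (w x ^ q) ^ σ) *
          (volume (Q.carrier ∩ F) / volume Q.carrier) ^ (1 / s))
    {h g : (Fin n → ℝ) → 𝕜} (hh : AEStronglyMeasurable h)
    {F : Set (Fin n → ℝ)} (hF : MeasurableSet F) (hF0 : volume F ≠ 0) (hFtop : volume F ≠ ⊤)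
    (hg : ∀ᵐ x, ‖g x‖ₑ ≤ (goodPart (q / p) (fun x => ‖w x • h x‖ₑ ^ p) F).indicator
      (fun x => ENNReal.ofReal (w x)) x)
    {S : Set (Cube n)} (hS : IsSparse η S) :
    sparseForm α p₀ q₀ S h g ≤
      (constA ((1 / p₀ - 1 / p) * q + 1) (fun x => w x ^ q) ^ (1 / q) *
        (2 * constRH σ (fun x => w x ^ q) ^ (1 / q))) *
      ((ENNReal.ofReal η)⁻¹ * (ENNReal.ofReal (2 * q * σ * s) * (2 * (5 ^ n) ^ 2) *
        (((∫⁻ x, ‖w x • h x‖ₑ ^ p) ^ (q / p)) ^ (1 / q) * volume F ^ (1 - 1 / q)))) := by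
  have hp : 0 < p := by linarith
  have hq1 : 1 ≤ q := by linarith
  have hq : 0 < q := by linarith
  have hσ0 : 0 < σ := by linarith
  have hs0 : 0 < s := by linarith
  set r := (ENNReal.conjExponent q₀).toReal with hrdef
  set V := fun x => ENNReal.ofReal (w x ^ q) with hV
  have hVm : AEMeasurable V := hA.1.aemeasurable
  set f := fun x => ‖w x • h x‖ₑ ^ p with hf
  set κ := q / p with hκ
  have hκ1 : 1 ≤ κ := by rwa [hκ, le_div_iff₀ hp, one_mul]
  set F' := goodPart κ f F with hF'
  have hF'm : MeasurableSet F' := measurableSet_goodPart (by linarith) f hF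
  set J := (∫⁻ x, f x) ^ κ with hJ
  set t := 2 * (5 ^ n * J) / volume F with ht
  set k : (Fin n → ℝ) → ℝ≥0∞ := F'.indicator 1 with hk
  set R := constRH σ (fun x => w x ^ q) with hR
  set A := constA ((1 / p₀ - 1 / p) * q + 1) (fun x => w x ^ q) with hAdef
  set τ := 1 / (2 * σ * s) with hτ
  have hσs : 1 ≤ σ * s := one_le_mul_of_one_le_of_one_le hσ hs
  have hτ0 : 0 < τ := by positivity
  have hτ1 : τ ≤ 1 / 2 := by
    rw [hτ]
    refine one_div_le_one_div_of_le (by norm_num) (by linarith)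
  set θ := 1 - 1 / q + 1 / (q * σ * s) with hθ
  have hθτ : θ = 1 - 1 / q + 2 * τ / q := by
    rw [hθ, hτ]
    field_simp
  have hq1' : 1 / q ≤ 1 := by
    rw [div_le_one hq]
    exact hq1
  have hθ0 : 0 < θ := by
    rw [hθ]
    have : 0 < 1 / (q * σ * s) := by positivity
    linarith
  have hθ1 : θ ≤ 1 := by
    rw [hθτ]
    have : 2 * τ / q ≤ 1 / q := by gcongr; linarith
    linarith
  have hg' : ∀ᵐ x, ‖g x‖ₑ ≤ F'.indicator (fun x => V x ^ (1 / q)) x := by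
    filter_upwards [hg, hw.ae_ofReal_rpow q] with x hx hx'
    refine hx.trans (le_of_eq ?_)
    by_cases hxF : x ∈ F'
    · simp only [indicator_of_mem hxF, hV, hx', ← ENNReal.rpow_mul, mul_one_div_cancel hq.ne',
        ENNReal.rpow_one]
    · simp only [indicator_of_notMem hxF]
  -- the estimate for one cube
  have hcube : ∀ Q : Cube n, fracAvg 0 p₀ h Q * fracAvg α r g Q * volume Q.carrier ≤
      (A ^ (1 / q) * (2 * R ^ (1 / q))) *
        (min ((volume Q.carrier)⁻¹ * (∫⁻ y in Q.carrier, f y) ^ κ) t ^ (1 / q) *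
          min (Q.avg k) 1 ^ θ * volume Q.carrier) := by
    intro Q
    rcases (Q.carrier ∩ F').eq_empty_or_nonempty with hempty | ⟨x, hxQ, hxF⟩
    · have h0 : ∫⁻ x in Q.carrier, ‖g x‖ₑ ^ r = 0 := by
        refine (lintegral_congr_ae (g := fun _ => 0) ?_).trans lintegral_zero
        filter_upwards [ae_restrict_of_ae hg', self_mem_ae_restrict Q.measurableSet_carrier]
          with x hx hxQ
        have hxF : x ∉ F' := fun hxF => (hempty ▸ (⟨hxQ, hxF⟩ : x ∈ Q.carrier ∩ F') : x ∈ (∅ : Set _))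
        rw [indicator_of_notMem hxF] at hx
        rw [le_antisymm hx zero_le, ENNReal.zero_rpow_of_pos hr]
      have : fracAvg α r g Q = 0 := by
        rw [fracAvg, h0, mul_zero, ENNReal.zero_rpow_of_pos (by positivity)]
      rw [this]
      simp
    · have hxt : (volume Q.carrier)⁻¹ * (∫⁻ y in Q.carrier, f y) ^ κ ≤ t :=
        (le_powMaximal κ f hxQ).trans (not_lt.1 hxF.2)
      have hk1 : Q.avg k ≤ 1 := by
        rw [Q.avg_eq_lintegral, hk, lintegral_indicator_one hF'm]
        exact prob_le_one
      rw [min_eq_left hxt, min_eq_left hk1]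
      have h1 := fracAvg_le_of_memA hw hp₀ hp₀p hpq hA hh Q
      have h2 := avg_rpow_le_of_absolutelyContinuous hVm hq1 hσ hr hrq hs0 hF'm Q
        (hA.1.avg_rpow_le_constRH σ Q) (hd Q F' hF'm) hg'
      have hVV : Q.avg V ^ (-1 / q) * Q.avg V ^ (1 / q) = 1 := by
        rw [← ENNReal.rpow_add _ _ (hA.1.avg_ne_zero Q) (hA.1.avg_ne_top Q), neg_div,
          neg_add_cancel, ENNReal.rpow_zero]
      have hx : (Q.avg f) ^ (1 / p) * volume Q.carrier ^ (α / (n * r)) =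
          ((volume Q.carrier)⁻¹ * (∫⁻ y in Q.carrier, f y) ^ κ) ^ (1 / q) := by
        rw [← hrel, Cube.avg, ENNReal.mul_rpow_of_nonneg _ _ (by positivity),
          ENNReal.mul_rpow_of_nonneg _ _ (by positivity), ← ENNReal.rpow_mul,
          show κ * (1 / q) = 1 / p by rw [hκ]; field_simp, mul_right_comm]
        congr 1
        rw [ENNReal.inv_rpow, ENNReal.inv_rpow, ← ENNReal.rpow_neg, ← ENNReal.rpow_neg,
          ← ENNReal.rpow_add _ _ Q.volume_ne_zero Q.volume_ne_top]
        congr 1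
        ring
      rw [fracAvg_eq_volume_rpow_mul hr]
      calc _ ≤ (A ^ (1 / q) * (Q.avg f) ^ (1 / p) * (Q.avg V) ^ (-1 / q)) *
            (volume Q.carrier ^ (α / (n * r)) *
              (2 * R ^ (1 / q) * (Q.avg V) ^ (1 / q) * Q.avg k ^ θ)) * volume Q.carrier := by
            gcongr
        _ = (A ^ (1 / q) * (2 * R ^ (1 / q))) *
            (((Q.avg f) ^ (1 / p) * volume Q.carrier ^ (α / (n * r))) * Q.avg k ^ θ *
              volume Q.carrier) * (Q.avg V ^ (-1 / q) * Q.avg V ^ (1 / q)) := by ring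
        _ = _ := by rw [hVV, hx, mul_one]
  -- Hölder's inequality needs `1 - θ < 1 / a < 1 / q`; the choice `1 / a = (1 - τ) / q` is the
  -- midpoint, as `1 - θ = (1 - 2 τ) / q`
  set a := q / (1 - τ) with ha
  have h1τ : 0 < 1 - τ := by linarith
  have ha1 : 1 < a := by
    rw [ha, lt_div_iff₀ h1τ]
    linarith
  have hconj : a.HolderConjugate a.conjExponent := Real.HolderConjugate.conjExponent ha1
  have hinv : 1 / a.conjExponent = 1 - (1 - τ) / q := by
    have := hconj.inv_add_inv_eq_one
    rw [one_div, ← one_div_div q (1 - τ), ← ha, one_div]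
    linarith
  have ha'0 : 0 < a.conjExponent := hconj.symm.pos
  have hb : 1 / q * a = 1 / (1 - τ) := by rw [ha]; field_simp
  have hb1 : 1 < 1 / q * a := by
    rw [hb, lt_div_iff₀ h1τ]
    linarith
  have hθa : θ - 1 / a.conjExponent = τ / q := by
    rw [hθτ, hinv]
    ring
  have hθa1 : θ * a.conjExponent - 1 = τ / q * a.conjExponent := by
    rw [← hθa]
    field_simp
  have hb2 : 1 < θ * a.conjExponent := by
    have : 0 < τ / q * a.conjExponent := by positivity
    linarith
  have hc1 : 1 / q * a / (1 / q * a - 1) ≤ 2 * q * σ * s := by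
    have : 1 / q * a / (1 / q * a - 1) = 2 * σ * s := by
      rw [hb, show 1 / (1 - τ) - 1 = τ / (1 - τ) by field_simp; ring]
      rw [show 1 / (1 - τ) / (τ / (1 - τ)) = 1 / τ by field_simp, hτ, one_div_one_div]
    rw [this]
    nlinarith
  have hc2 : θ * a.conjExponent / (θ * a.conjExponent - 1) ≤ 2 * q * σ * s := by
    rw [hθa1]
    calc θ * a.conjExponent / (τ / q * a.conjExponent) = θ * (q / τ) := by field_simp
      _ ≤ 1 * (q / τ) := by gcongr
      _ = _ := by rw [hτ]; field_simp
  calc sparseForm α p₀ q₀ S h g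
      ≤ ∑' Q : S, (A ^ (1 / q) * (2 * R ^ (1 / q))) *
        (min ((volume Q.1.carrier)⁻¹ * (∫⁻ y in Q.1.carrier, f y) ^ κ) t ^ (1 / q) *
          min (Q.1.avg k) 1 ^ θ * volume Q.1.carrier) :=
        ENNReal.tsum_le_tsum fun Q => hcube Q.1
    _ = (A ^ (1 / q) * (2 * R ^ (1 / q))) * ∑' Q : S,
        (min ((volume Q.1.carrier)⁻¹ * (∫⁻ y in Q.1.carrier, f y) ^ κ) t ^ (1 / q) *
          min (Q.1.avg k) 1 ^ θ * volume Q.1.carrier) := ENNReal.tsum_mul_left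
    _ ≤ _ := by
        refine mul_le_mul' le_rfl ((tsum_sparse_le hn hη hS hκ1 f k (by positivity) hθ0 hconj hb1
          hb2 t 1).trans (mul_le_mul' le_rfl ?_))
        refine holder_product_le hq1 hconj hb1 (one_le_pow₀ (by norm_num)) hF0 hFtop hc1 hc2 ?_
        rw [hk, lintegral_indicator_one hF'm]
        exact measure_mono sdiff_subset

end Weight

/-! ### Stability of the sparse form and pairing with bounded functions -/

lemma lintegral_enorm_rpow_ne_top {h : (Fin n → ℝ) → 𝕜} (hh : Continuous h)
    (hhc : HasCompactSupport h) {p : ℝ} (hp : 0 < p) : ∫⁻ x, ‖h x‖ₑ ^ p ≠ ⊤ := by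
  have h1 : MemLp h (ENNReal.ofReal p) volume := hh.memLp_of_hasCompactSupport hhc
  have h2 := lintegral_rpow_enorm_lt_top_of_eLpNorm_lt_top (ENNReal.ofReal_pos.2 hp).ne'
    ENNReal.ofReal_ne_top h1.2
  rw [ENNReal.toReal_ofReal hp.le] at h2
  exact h2.ne

/-- A sparse form of a bounded function and a function of size at most `L` is controlled, uniformly
over sparse families, by the integral of a power of the latter. -/
lemma exists_sparseForm_le (hn : 0 < n) {α p₀ p q η : ℝ} {q₀ : ℝ≥0∞}
    (hp₀ : 1 ≤ p₀) (hp₀p : p₀ ≤ p) (hpq : p ≤ q) (hη : 0 < η)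
    (hr1 : 1 ≤ (ENNReal.conjExponent q₀).toReal)
    (hrel : 1 / p - 1 / q = α / (n * (ENNReal.conjExponent q₀).toReal))
    (hrq : 1 - 1 / q < 1 / (ENNReal.conjExponent q₀).toReal)
    {h : (Fin n → ℝ) → 𝕜} (hh : Continuous h) (hhc : HasCompactSupport h) (L : ℝ≥0) :
    ∃ (M : ℝ≥0∞) (ε : ℝ), M ≠ ⊤ ∧ 0 < ε ∧ ∀ (S : Set (Cube n)) (e : (Fin n → ℝ) → 𝕜),
      IsSparse η S → (∀ x, ‖e x‖ₑ ≤ L) →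
      sparseForm α p₀ q₀ S h e ≤ M * (∫⁻ x, ‖e x‖ₑ ^ (ENNReal.conjExponent q₀).toReal) ^ ε := by
  set r := (ENNReal.conjExponent q₀).toReal with hrdef
  have hr : 0 < r := by linarith
  have hp0 : 0 < p₀ := by linarith
  have hp : 0 < p := by linarith
  have hq : 0 < q := by linarith
  set f := fun x => ‖h x‖ₑ ^ p with hf
  set κ := q / p with hκ
  have hκ1 : 1 ≤ κ := by rwa [hκ, le_div_iff₀ hp, one_mul]
  set J := (∫⁻ x, f x) ^ κ with hJ
  have hJtop : J ≠ ⊤ := ENNReal.rpow_ne_top_of_nonneg (by linarith)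
    (lintegral_enorm_rpow_ne_top hh hhc hp)
  obtain ⟨B, hB⟩ := hh.bounded_above_of_compact_support hhc
  set H : ℝ≥0∞ := ENNReal.ofReal B with hH
  have hfH : ∀ x, f x ≤ H ^ p := fun x => by
    change ‖h x‖ₑ ^ p ≤ _
    rw [hH, ← ofReal_norm]
    exact ENNReal.rpow_le_rpow (ENNReal.ofReal_le_ofReal (hB x)) hp.le
  set t := (H ^ p) ^ κ + J with ht
  have htop : t ≠ ⊤ := ENNReal.add_ne_top.2 ⟨ENNReal.rpow_ne_top_of_nonneg (by linarith)
    (ENNReal.rpow_ne_top_of_nonneg hp.le ENNReal.ofReal_ne_top), hJtop⟩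
  -- small cubes see the boundedness of `h`, large cubes its integrability
  have hxt : ∀ Q : Cube n, (volume Q.carrier)⁻¹ * (∫⁻ y in Q.carrier, f y) ^ κ ≤ t := by
    intro Q
    rcases le_total (volume Q.carrier) 1 with h1 | h1
    · refine le_add_right ?_
      calc (volume Q.carrier)⁻¹ * (∫⁻ y in Q.carrier, f y) ^ κ
          ≤ (volume Q.carrier)⁻¹ * (H ^ p * volume Q.carrier) ^ κ := by
            gcongr
            rw [← setLIntegral_const]
            exact lintegral_mono fun x => hfH x
        _ = (H ^ p) ^ κ * volume Q.carrier ^ (κ - 1) := by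
            rw [ENNReal.mul_rpow_of_nonneg _ _ (by linarith), ENNReal.rpow_sub _ _ Q.volume_ne_zero
              Q.volume_ne_top, ENNReal.rpow_one, div_eq_mul_inv]
            ring
        _ ≤ (H ^ p) ^ κ * 1 := by
            gcongr
            exact ENNReal.rpow_le_one h1 (by linarith)
        _ = _ := mul_one _
    · refine le_add_left ?_
      calc (volume Q.carrier)⁻¹ * (∫⁻ y in Q.carrier, f y) ^ κ
          ≤ 1 * (∫⁻ y, f y) ^ κ := by
            gcongr
            · exact ENNReal.inv_le_one.2 h1
            · exact Measure.restrict_le_self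
        _ = J := one_mul _
  -- `b` lies strictly between `1 - 1 / r` and `1 / q`, so both truncated maximal functions have
  -- integrable powers
  set b := (1 / q + (1 - 1 / r)) / 2 with hb
  have hr1' : 1 / r ≤ 1 := by
    rw [div_le_one hr]
    exact hr1
  have hq1' : 1 / q ≤ 1 := by
    rw [div_le_one hq]
    linarith
  have hq0' : 0 < 1 / q := by positivity
  have hb0 : 0 < b := by rw [hb]; linarith
  have hbq : b < 1 / q := by rw [hb]; linarith
  have hbr : 1 - b < 1 / r := by rw [hb]; linarith
  have ha1 : 1 < 1 / b := by
    rw [lt_div_iff₀ hb0]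
    linarith
  have hconj : (1 / b).HolderConjugate (1 / b).conjExponent :=
    Real.HolderConjugate.conjExponent ha1
  set a' := (1 / b).conjExponent with ha'
  have ha'0 : 0 < a' := hconj.symm.pos
  have hinv : 1 / a' = 1 - b := by
    have := hconj.inv_add_inv_eq_one
    rw [one_div, inv_inv] at this
    rw [one_div]
    linarith
  have h1 : 1 < 1 / q * (1 / b) := by
    rw [mul_one_div, lt_div_iff₀ hb0]
    linarith
  have h2 : 1 < 1 / r * a' := by
    rw [← hinv, div_lt_iff₀ ha'0] at hbr
    exact hbr
  refine ⟨(ENNReal.ofReal η)⁻¹ *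
    ((ENNReal.ofReal (1 / q * (1 / b) / (1 / q * (1 / b) - 1)) * (5 ^ n * J) *
      t ^ (1 / q * (1 / b) - 1)) ^ (1 / (1 / b)) *
    (ENNReal.ofReal (1 / r * a' / (1 / r * a' - 1)) * 5 ^ n *
      ((L : ℝ≥0∞) ^ r) ^ (1 / r * a' - 1)) ^ (1 / a')), 1 / a', ?_, by positivity, ?_⟩
  · have e1 : (ENNReal.ofReal η)⁻¹ ≠ ⊤ := ENNReal.inv_ne_top.2 (ENNReal.ofReal_pos.2 hη).ne'
    refine ENNReal.mul_ne_top e1 (ENNReal.mul_ne_top ?_ ?_)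
    · refine ENNReal.rpow_ne_top_of_nonneg (by positivity) (ENNReal.mul_ne_top
        (ENNReal.mul_ne_top ENNReal.ofReal_ne_top (ENNReal.mul_ne_top (by finiteness) hJtop)) ?_)
      exact ENNReal.rpow_ne_top_of_nonneg (by linarith) htop
    · refine ENNReal.rpow_ne_top_of_nonneg (by positivity) (ENNReal.mul_ne_top
        (ENNReal.mul_ne_top ENNReal.ofReal_ne_top (by finiteness)) ?_)
      exact ENNReal.rpow_ne_top_of_nonneg (by linarith)
        (ENNReal.rpow_ne_top_of_nonneg hr.le ENNReal.coe_ne_top)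
  intro S e hS he
  set k := fun x => ‖e x‖ₑ ^ r with hk
  have hyt : ∀ Q : Cube n, Q.avg k ≤ (L : ℝ≥0∞) ^ r := fun Q => by
    rw [Q.avg_eq_lintegral]
    calc ∫⁻ x, k x ∂Q.unif ≤ ∫⁻ _, (L : ℝ≥0∞) ^ r ∂Q.unif :=
          lintegral_mono fun x => ENNReal.rpow_le_rpow (he x) hr.le
      _ = _ := by simp
  have hcube : ∀ Q : Cube n, fracAvg 0 p₀ h Q * fracAvg α r e Q * volume Q.carrier ≤
      min ((volume Q.carrier)⁻¹ * (∫⁻ y in Q.carrier, f y) ^ κ) t ^ (1 / q) *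
        min (Q.avg k) ((L : ℝ≥0∞) ^ r) ^ (1 / r) * volume Q.carrier := by
    intro Q
    rw [min_eq_left (hxt Q), min_eq_left (hyt Q), fracAvg_zero, fracAvg_eq_volume_rpow_mul hr,
      ← hrel]
    gcongr ?_ * volume Q.carrier
    have hm := Q.avg_rpow_le hh.enorm.measurable.aemeasurable hp0 hp₀p
    have hx : (Q.avg f) ^ (1 / p) * volume Q.carrier ^ (1 / p - 1 / q) =
        ((volume Q.carrier)⁻¹ * (∫⁻ y in Q.carrier, f y) ^ κ) ^ (1 / q) := by
      rw [Cube.avg, ENNReal.mul_rpow_of_nonneg _ _ (by positivity),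
        ENNReal.mul_rpow_of_nonneg _ _ (by positivity), ← ENNReal.rpow_mul,
        show κ * (1 / q) = 1 / p by rw [hκ]; field_simp, mul_right_comm]
      congr 1
      rw [ENNReal.inv_rpow, ENNReal.inv_rpow, ← ENNReal.rpow_neg, ← ENNReal.rpow_neg,
        ← ENNReal.rpow_add _ _ Q.volume_ne_zero Q.volume_ne_top]
      congr 1
      ring
    rw [← hx, ← mul_assoc]
    gcongr
  refine (ENNReal.tsum_le_tsum fun Q : S => hcube Q.1).trans ((tsum_sparse_le hn hη hS hκ1 f k hq0'
    (by positivity) hconj h1 h2 t _).trans (le_of_eq ?_))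
  have hcomm : ∀ x y z v : ℝ≥0∞, x * (y * z) * v = x * y * v * z := fun x y z v => by ring
  rw [hcomm _ (5 ^ n) (∫⁻ y, k y), ENNReal.mul_rpow_of_nonneg _ (∫⁻ y, k y) (by positivity)]
  ring

lemma fracAvg_add_le {α r : ℝ} (hr : 1 ≤ r) {f g : (Fin n → ℝ) → 𝕜} (hf : AEStronglyMeasurable f)
    (hg : AEStronglyMeasurable g) (Q : Cube n) :
    fracAvg α r (f + g) Q ≤ fracAvg α r f Q + fracAvg α r g Q := by
  have hr0 : 0 < r := by linarith
  rw [fracAvg_eq_volume_rpow_mul hr0, fracAvg_eq_volume_rpow_mul hr0,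
    fracAvg_eq_volume_rpow_mul hr0, ← mul_add]
  refine mul_le_mul' le_rfl ?_
  simp only [Cube.avg_eq_lintegral]
  refine le_trans ?_ (ENNReal.lintegral_Lp_add_le
    (hf.enorm.mono_ac Q.unif_absolutelyContinuous)
    (hg.enorm.mono_ac Q.unif_absolutelyContinuous) hr)
  gcongr with x
  exact enorm_add_le _ _

lemma sparseForm_add_le {α p₀ : ℝ} {q₀ : ℝ≥0∞} (hr1 : 1 ≤ (ENNReal.conjExponent q₀).toReal)
    (S : Set (Cube n)) (h : (Fin n → ℝ) → 𝕜) {f g : (Fin n → ℝ) → 𝕜}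
    (hf : AEStronglyMeasurable f) (hg : AEStronglyMeasurable g) :
    sparseForm α p₀ q₀ S h (f + g) ≤ sparseForm α p₀ q₀ S h f + sparseForm α p₀ q₀ S h g := by
  rw [sparseForm, sparseForm, sparseForm, ← ENNReal.tsum_add]
  refine ENNReal.tsum_le_tsum fun Q => ?_
  rw [← add_mul, ← mul_add]
  gcongr
  exact fracAvg_add_le hr1 hf hg Q.1

open scoped Convolution in
/-- Bounded functions with bounded support are almost everywhere limits of test functions with
the same bound and supports in a fixed ball. -/
lemma exists_isTest_tendsto {g : (Fin n → ℝ) → 𝕜} (hg : AEStronglyMeasurable g) {L ρ : ℝ}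
    (hL : ∀ x, ‖g x‖ ≤ L) (hρ : ∀ x, x ∉ closedBall (0 : Fin n → ℝ) ρ → g x = 0) :
    ∃ γ : ℕ → (Fin n → ℝ) → 𝕜, (∀ k, IsTest (γ k)) ∧ (∀ k x, ‖γ k x‖ ≤ L) ∧
      (∀ k x, x ∉ closedBall (0 : Fin n → ℝ) (ρ + 1) → γ k x = 0) ∧
      ∀ᵐ x, Tendsto (fun k => γ k x) atTop (𝓝 (g x)) := by
  let φ : ℕ → ContDiffBump (0 : Fin n → ℝ) := fun k =>
    ⟨1 / (2 * (k + 1)), 1 / (k + 1), by positivity, by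
      rw [div_lt_div_iff_of_pos_left one_pos (by positivity) (by positivity)]
      linarith [(Nat.cast_nonneg k : (0 : ℝ) ≤ k)]⟩
  have hgint : Integrable g := by
    have hL0 : 0 ≤ L := (norm_nonneg _).trans (hL 0)
    have hind : (closedBall (0 : Fin n → ℝ) ρ).indicator g = g := by
      refine indicator_eq_self.2 fun x hx => ?_
      by_contra hxB
      exact hx (hρ x hxB)
    rw [← hind, integrable_indicator_iff measurableSet_closedBall]
    exact Measure.integrableOn_of_bounded measure_closedBall_lt_top.ne hg
      (Eventually.of_forall hL)
  refine ⟨fun k => ((φ k).normed volume) ⋆[ContinuousLinearMap.lsmul ℝ ℝ, volume] g,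
    fun k => ⟨?_, ?_⟩, ?_, ?_, ?_⟩
  · exact (φ k).hasCompactSupport_normed.contDiff_convolution_left _ (φ k).contDiff_normed
      hgint.locallyIntegrable
  · refine HasCompactSupport.convolution _ (φ k).hasCompactSupport_normed ?_
    exact HasCompactSupport.intro (isCompact_closedBall (0 : Fin n → ℝ) ρ) hρ
  · intro k x
    dsimp only
    rw [convolution_def]
    calc ‖∫ t, ContinuousLinearMap.lsmul ℝ ℝ ((φ k).normed volume t) (g (x - t))‖
        ≤ ∫ t, (φ k).normed volume t * L := by
          refine norm_integral_le_of_norm_le ((φ k).integrable_normed.mul_const L)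
            (Eventually.of_forall fun t => ?_)
          rw [ContinuousLinearMap.lsmul_apply, norm_smul, Real.norm_of_nonneg ((φ k).nonneg_normed t)]
          exact mul_le_mul_of_nonneg_left (hL _) ((φ k).nonneg_normed t)
      _ = L := by rw [integral_mul_const, (φ k).integral_normed, one_mul]
  · intro k x hx
    by_contra hne
    obtain ⟨y, hy, z, hz, rfl⟩ := support_convolution_subset _ (Function.mem_support.2 hne)
    rw [(φ k).support_normed_eq, mem_ball_zero_iff] at hy
    have hz' : z ∈ closedBall (0 : Fin n → ℝ) ρ := by
      by_contra hzB
      exact hz (hρ z hzB)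
    rw [mem_closedBall_zero_iff] at hz' hx
    have h1 : (φ k).rOut ≤ 1 := by
      change 1 / ((k : ℝ) + 1) ≤ 1
      rw [div_le_one (by positivity)]
      linarith [(Nat.cast_nonneg k : (0 : ℝ) ≤ k)]
    exact hx ((norm_add_le y z).trans (by linarith))
  · refine ContDiffBump.ae_convolution_tendsto_right_of_locallyIntegrable (K := 2) ?_
      (Eventually.of_forall fun k => ?_) hgint.locallyIntegrable
    · exact tendsto_one_div_add_atTop_nhds_zero_nat
    · change 1 / ((k : ℝ) + 1) ≤ 2 * (1 / (2 * (k + 1)))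
      apply le_of_eq
      field_simp

/-- Sparse domination extends from test functions to bounded functions `g` with bounded support, with
the supremum of the sparse forms of `g` on the right-hand side. -/
lemma SparselyDominated.enorm_integral_le (hn : 0 < n) {α p₀ p q η : ℝ} {q₀ : ℝ≥0∞} {N : ℕ}
    {K : ℝ≥0} {T : ((Fin n → ℝ) → 𝕜) → (Fin n → ℝ) → 𝕜} (hT : SparselyDominated α p₀ q₀ η N K T)
    (hp₀ : 1 ≤ p₀) (hp₀p : p₀ ≤ p) (hpq : p ≤ q) (hη : 0 < η)
    (hr1 : 1 ≤ (ENNReal.conjExponent q₀).toReal)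
    (hrel : 1 / p - 1 / q = α / (n * (ENNReal.conjExponent q₀).toReal))
    (hrq : 1 - 1 / q < 1 / (ENNReal.conjExponent q₀).toReal)
    {h g : (Fin n → ℝ) → 𝕜} (hh : IsTest h) (hg : AEStronglyMeasurable g) {L ρ : ℝ}
    (hL : ∀ x, ‖g x‖ ≤ L) (hρ : ∀ x, x ∉ closedBall (0 : Fin n → ℝ) ρ → g x = 0)
    {B : ℝ≥0∞} (hB : ∀ S : Set (Cube n), IsSparse η S → sparseForm α p₀ q₀ S h g ≤ B) :
    ‖∫ x, T h x * g x‖ₑ ≤ K * (N * B) := by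
  set r := (ENNReal.conjExponent q₀).toReal with hrdef
  have hr : 0 < r := by linarith
  have hL0 : 0 ≤ L := (norm_nonneg _).trans (hL 0)
  obtain ⟨γ, hγt, hγL, hγρ, hγ⟩ := exists_isTest_tendsto hg hL hρ
  obtain ⟨M, ε, hM, hε, hMε⟩ := exists_sparseForm_le hn hp₀ hp₀p hpq hη hr1 hrel hrq hh.1.continuous
    hh.2 (2 * L).toNNReal
  set I : ℕ → ℝ≥0∞ := fun k => ∫⁻ x, ‖(γ k - g) x‖ₑ ^ r with hI
  have hbound : ∀ k, ‖∫ x, T h x * γ k x‖ₑ ≤ K * (N * (B + M * I k ^ ε)) := by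
    intro k
    obtain ⟨S, hS, hle⟩ := hT.dominated h (γ k) hh (hγt k)
    refine hle.trans ?_
    gcongr
    calc ∑ j, sparseForm α p₀ q₀ (S j) h (γ k) ≤ ∑ _j : Fin N, (B + M * I k ^ ε) := by
          refine Finset.sum_le_sum fun j _ => ?_
          have hmk : AEStronglyMeasurable (γ k) := (hγt k).1.continuous.aestronglyMeasurable
          calc sparseForm α p₀ q₀ (S j) h (γ k) = sparseForm α p₀ q₀ (S j) h (g + (γ k - g)) := by
                rw [add_sub_cancel]
            _ ≤ _ := sparseForm_add_le hr1 (S j) h hg (hmk.sub hg)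
            _ ≤ _ := by
                gcongr
                · exact hB _ (hS j)
                · refine hMε _ _ (hS j) fun x => ?_
                  rw [← ofReal_norm]
                  refine ENNReal.ofReal_le_ofReal ((norm_sub_le _ _).trans ?_)
                  linarith [hγL k x, hL x]
      _ = N * (B + M * I k ^ ε) := by
          rw [Finset.sum_const, Finset.card_univ, Fintype.card_fin, nsmul_eq_mul]
  have hIlim : Tendsto I atTop (𝓝 0) := by
    have h0 : (0 : ℝ≥0∞) = ∫⁻ _ : Fin n → ℝ, 0 := by simp
    rw [h0]
    refine tendsto_lintegral_of_dominated_convergence'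
      ((closedBall (0 : Fin n → ℝ) (ρ + 1)).indicator fun _ => ENNReal.ofReal (2 * L) ^ r)
      (fun k => ?_) (fun k => Eventually.of_forall fun x => ?_) ?_ ?_
    · exact ((hγt k).1.continuous.aestronglyMeasurable.sub hg).enorm.pow_const r
    · by_cases hx : x ∈ closedBall (0 : Fin n → ℝ) (ρ + 1)
      · rw [indicator_of_mem hx]
        change ‖(γ k - g) x‖ₑ ^ r ≤ _
        rw [← ofReal_norm]
        refine ENNReal.rpow_le_rpow (ENNReal.ofReal_le_ofReal ((norm_sub_le _ _).trans ?_)) hr.le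
        linarith [hγL k x, hL x]
      · have h1 : g x = 0 := hρ x fun hx' => hx (closedBall_subset_closedBall (by linarith) hx')
        simp [hγρ k x hx, h1, hr]
    · rw [lintegral_indicator measurableSet_closedBall, setLIntegral_const]
      exact ENNReal.mul_ne_top (ENNReal.rpow_ne_top_of_nonneg hr.le ENNReal.ofReal_ne_top)
        measure_closedBall_lt_top.ne
    · filter_upwards [hγ] with x hx
      have h1 : Tendsto (fun k => ‖(γ k - g) x‖ₑ) atTop (𝓝 0) := by
        have := (hx.sub_const (g x)).enorm
        simpa using this
      have h2 := (ENNReal.continuous_rpow_const (y := r)).continuousAt.tendsto.comp h1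
      rw [ENNReal.zero_rpow_of_pos hr] at h2
      exact h2
  have hLHS : Tendsto (fun k => ‖∫ x, T h x * γ k x‖ₑ) atTop (𝓝 ‖∫ x, T h x * g x‖ₑ) := by
    refine Tendsto.enorm ?_
    have hloc := hT.locallyIntegrable h hh
    refine tendsto_integral_of_dominated_convergence
      ((closedBall (0 : Fin n → ℝ) (ρ + 1)).indicator fun x => ‖T h x‖ * L)
      (fun k => hloc.aestronglyMeasurable.mul (hγt k).1.continuous.aestronglyMeasurable) ?_
      (fun k => Eventually.of_forall fun x => ?_) ?_
    · rw [integrable_indicator_iff measurableSet_closedBall]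
      exact ((hloc.integrableOn_isCompact (isCompact_closedBall _ _)).norm).mul_const L
    · by_cases hx : x ∈ closedBall (0 : Fin n → ℝ) (ρ + 1)
      · rw [indicator_of_mem hx, norm_mul]
        exact mul_le_mul_of_nonneg_left (hγL k x) (norm_nonneg _)
      · simp [indicator_of_notMem hx, hγρ k x hx]
    · filter_upwards [hγ] with x hx
      exact hx.const_mul _
  have hRHS : Tendsto (fun k => (K : ℝ≥0∞) * (N * (B + M * I k ^ ε))) atTop
      (𝓝 (K * (N * (B + M * 0)))) := by
    have h1 : Tendsto (fun k => I k ^ ε) atTop (𝓝 0) := by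
      have := (ENNReal.continuous_rpow_const (y := ε)).continuousAt.tendsto.comp hIlim
      rwa [ENNReal.zero_rpow_of_pos hε] at this
    refine ENNReal.Tendsto.const_mul (ENNReal.Tendsto.const_mul (tendsto_const_nhds.add
      (ENNReal.Tendsto.const_mul h1 (Or.inr hM))) (Or.inr (ENNReal.natCast_ne_top N)))
      (Or.inr ENNReal.coe_ne_top)
  rw [mul_zero, add_zero] at hRHS
  exact le_of_tendsto_of_tendsto' hLHS hRHS hbound

/-! ### The weak-type bound on test functions -/

/-- `w^p` is locally integrable when `w^q` is and `p ≤ q`. -/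
lemma IsWeight.setLIntegral_ofReal_rpow_ne_top {w : (Fin n → ℝ) → ℝ} (hw : IsWeight w) {p q : ℝ}
    (hp : 0 < p) (hpq : p ≤ q) (hwq : IsWeight fun x => w x ^ q) {s : Set (Fin n → ℝ)}
    (hs : IsCompact s) : ∫⁻ x in s, ENNReal.ofReal (w x) ^ p ≠ ⊤ := by
  have hle : ∫⁻ x in s, ENNReal.ofReal (w x) ^ p ≤ ∫⁻ x in s, (1 + ENNReal.ofReal (w x ^ q)) := by
    refine lintegral_mono_ae (ae_restrict_of_ae ?_)
    filter_upwards [hw.ae_ofReal_rpow q] with x hx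
    rw [hx]
    rcases le_total (ENNReal.ofReal (w x)) 1 with h1 | h1
    · exact le_add_right (ENNReal.rpow_le_one h1 hp.le)
    · exact le_add_left (ENNReal.rpow_le_rpow_of_exponent_le h1 hpq)
  refine ne_top_of_le_ne_top ?_ hle
  rw [lintegral_add_left measurable_const, setLIntegral_const, one_mul]
  exact ENNReal.add_ne_top.2 ⟨hs.measure_lt_top.ne, ne_top_of_le_ne_top
    (hwq.1.integrableOn_isCompact hs).2.ne (lintegral_mono fun x => Real.ofReal_le_enorm _)⟩

/-- Test functions are in the weighted space `L^p(w^p)` when `w^q` is locally integrable and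
`p ≤ q`. -/
lemma lintegral_enorm_smul_rpow_ne_top {w : (Fin n → ℝ) → ℝ} (hw : IsWeight w) {p q : ℝ}
    (hp : 0 < p) (hpq : p ≤ q) (hwq : IsWeight fun x => w x ^ q) {h : (Fin n → ℝ) → 𝕜}
    (hh : IsTest h) : ∫⁻ x, ‖w x • h x‖ₑ ^ p ≠ ⊤ := by
  obtain ⟨B, hB⟩ := hh.1.continuous.bounded_above_of_compact_support hh.2
  have hle : ∀ᵐ x, ‖w x • h x‖ₑ ^ p ≤
      (tsupport h).indicator (fun x => ENNReal.ofReal B ^ p * ENNReal.ofReal (w x) ^ p) x := by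
    filter_upwards [hw.2] with x hx0
    by_cases hxs : x ∈ tsupport h
    · rw [indicator_of_mem hxs, enorm_smul, Real.enorm_of_nonneg hx0.le, mul_comm,
        ENNReal.mul_rpow_of_nonneg _ _ hp.le, ← ofReal_norm]
      gcongr
      exact hB x
    · rw [indicator_of_notMem hxs, image_eq_zero_of_notMem_tsupport hxs]
      simp [hp]
  refine ne_top_of_le_ne_top ?_ (lintegral_mono_ae hle)
  have hB' : ENNReal.ofReal B ^ p ≠ ⊤ := ENNReal.rpow_ne_top_of_nonneg hp.le ENNReal.ofReal_ne_top
  rw [lintegral_indicator (isClosed_tsupport h).measurableSet, lintegral_const_mul' _ _ hB']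
  exact ENNReal.mul_ne_top hB' (hw.setLIntegral_ofReal_rpow_ne_top hp hpq hwq hh.2)

lemma eLpNorm_ofReal_eq {X E : Type*} [MeasurableSpace X] {μ : Measure X} [NormedAddCommGroup E]
    {p : ℝ} (hp : 0 < p) (f : X → E) :
    eLpNorm f (ENNReal.ofReal p) μ = (∫⁻ x, ‖f x‖ₑ ^ p ∂μ) ^ (1 / p) := by
  rw [eLpNorm_eq_lintegral_rpow_enorm_toReal (ENNReal.ofReal_pos.2 hp).ne' ENNReal.ofReal_ne_top,
    ENNReal.toReal_ofReal hp.le]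

/-- Conjugation divided by the absolute value, so that `z * phase z = ‖z‖`. -/
def phase (z : 𝕜) : 𝕜 := starRingEnd 𝕜 z * ((‖z‖⁻¹ : ℝ) : 𝕜)

lemma mul_phase (z : 𝕜) : z * phase z = ((‖z‖ : ℝ) : 𝕜) := by
  rcases eq_or_ne z 0 with rfl | hz
  · simp [phase]
  · have h0 : (‖z‖ : ℝ) ≠ 0 := norm_ne_zero_iff.2 hz
    rw [phase, ← mul_assoc, RCLike.mul_conj]
    norm_cast
    field_simp

lemma norm_phase_le (z : 𝕜) : ‖phase z‖ ≤ 1 := by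
  rw [phase, norm_mul, RCLike.norm_conj, RCLike.norm_ofReal, abs_inv, abs_norm]
  exact mul_inv_le_one

lemma measurable_phase : Measurable (phase : 𝕜 → 𝕜) :=
  RCLike.continuous_conj.measurable.mul
    (RCLike.measurable_ofReal.comp measurable_norm.inv)

/-- The weak-type bound on a bounded piece `F` of a level set of `w |Th|`, by testing the sparse
domination against `w` times the phase of `Th` on the good part of `F`. -/
lemma mul_volume_rpow_le (hn : 0 < n) {w : (Fin n → ℝ) → ℝ} (hw : IsWeight w)
    {α p₀ p q η : ℝ} {q₀ : ℝ≥0∞} {N : ℕ}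
    {K : ℝ≥0} {T : ((Fin n → ℝ) → 𝕜) → (Fin n → ℝ) → 𝕜} (hT : SparselyDominated α p₀ q₀ η N K T)
    (hp₀ : 1 ≤ p₀) (hp₀p : p₀ ≤ p) (hpq : p ≤ q) (hη : 0 < η)
    (hr1 : 1 ≤ (ENNReal.conjExponent q₀).toReal)
    (hrel : 1 / p - 1 / q = α / (n * (ENNReal.conjExponent q₀).toReal))
    (hrq : 1 - 1 / q < 1 / (ENNReal.conjExponent q₀).toReal)
    (hwq : IsWeight fun x => w x ^ q)
    {h : (Fin n → ℝ) → 𝕜} (hh : IsTest h) {H : (Fin n → ℝ) → 𝕜} (hH : Measurable H)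
    (hTH : T h =ᵐ[volume] H) {v : (Fin n → ℝ) → ℝ} (hv : Measurable v) (hwv : w =ᵐ[volume] v)
    {C : ℝ≥0∞} {F : Set (Fin n → ℝ)} (hF : MeasurableSet F) {L : ℝ} (hL : 0 ≤ L)
    (hFL : ∀ x ∈ F, ‖x‖ ≤ L ∧ ‖H x‖ ≤ L ∧ 0 < v x ∧ v x ≤ L) {y : ℝ≥0}
    (hFy : ∀ x ∈ F, (y : ℝ≥0∞) ≤ ENNReal.ofReal (v x * ‖H x‖))
    (hC : ∀ (g : (Fin n → ℝ) → 𝕜) (S : Set (Cube n)), IsSparse η S → volume F ≠ 0 → volume F ≠ ⊤ →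
      (∀ᵐ x, ‖g x‖ₑ ≤ (goodPart (q / p) (fun x => ‖w x • h x‖ₑ ^ p) F).indicator
        (fun x => ENNReal.ofReal (w x)) x) →
      sparseForm α p₀ q₀ S h g ≤ C * volume F ^ (1 - 1 / q)) :
    (y : ℝ≥0∞) * volume F ^ (1 / q) ≤ 2 * (K * (N * C)) := by
  have hp : 0 < p := by linarith
  have hq : 0 < q := by linarith
  rcases eq_or_ne (volume F) 0 with hF0 | hF0
  · rw [hF0, ENNReal.zero_rpow_of_pos (by positivity), mul_zero]
    exact zero_le
  have hFsub : F ⊆ closedBall 0 L := fun x hx => mem_closedBall_zero_iff.2 (hFL x hx).1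
  have hFtop : volume F ≠ ⊤ :=
    ne_top_of_le_ne_top measure_closedBall_lt_top.ne (measure_mono hFsub)
  set f := fun x => ‖w x • h x‖ₑ ^ p with hf
  have hκ : 1 ≤ q / p := by rwa [le_div_iff₀ hp, one_mul]
  set F' := goodPart (q / p) f F with hF'
  have hF'm : MeasurableSet F' := measurableSet_goodPart (by linarith) f hF
  have hF'F : F' ⊆ F := sdiff_subset
  have hhalf : volume F ≤ 2 * volume F' := volume_le_two_mul_goodPart hn hκ
    (lintegral_enorm_smul_rpow_ne_top hw hp hpq hwq hh) hF0 hFtop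
  set g : (Fin n → ℝ) → 𝕜 := F'.indicator fun x => v x • phase (H x) with hg
  have hgm : Measurable g := (hv.smul (measurable_phase.comp hH)).indicator hF'm
  have hgv : ∀ x, ‖g x‖ ≤ F'.indicator v x := by
    intro x
    by_cases hx : x ∈ F'
    · rw [hg, indicator_of_mem hx, indicator_of_mem hx, norm_smul,
        Real.norm_of_nonneg (hFL x (hF'F hx)).2.2.1.le]
      exact mul_le_of_le_one_right (hFL x (hF'F hx)).2.2.1.le (norm_phase_le _)
    · simp [hg, hx]
  have hgL : ∀ x, ‖g x‖ ≤ L := by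
    intro x
    refine (hgv x).trans ?_
    by_cases hx : x ∈ F'
    · rw [indicator_of_mem hx]
      exact (hFL x (hF'F hx)).2.2.2
    · rwa [indicator_of_notMem hx]
  have hgρ : ∀ x, x ∉ closedBall (0 : Fin n → ℝ) L → g x = 0 := fun x hx =>
    indicator_of_notMem (fun hx' => hx (hFsub (hF'F hx'))) _
  have hgw : ∀ᵐ x, ‖g x‖ₑ ≤ F'.indicator (fun x => ENNReal.ofReal (w x)) x := by
    filter_upwards [hwv] with x hx
    rw [← ofReal_norm]
    refine (ENNReal.ofReal_le_ofReal (hgv x)).trans (le_of_eq ?_)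
    by_cases hx' : x ∈ F' <;> simp [hx', hx]
  have hpair := hT.enorm_integral_le hn hp₀ hp₀p hpq hη hr1 hrel hrq hh hgm.aestronglyMeasurable
    hgL hgρ (fun S hS => hC g S hS hF0 hFtop hgw)
  set ψ : (Fin n → ℝ) → ℝ := F'.indicator fun x => v x * ‖H x‖ with hψ
  have hψm : Measurable ψ := (hv.mul hH.norm).indicator hF'm
  have hψ0 : ∀ x, 0 ≤ ψ x := indicator_nonneg fun x hx =>
    mul_nonneg (hFL x (hF'F hx)).2.2.1.le (norm_nonneg _)
  have hψint : Integrable ψ := by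
    rw [hψ, integrable_indicator_iff hF'm]
    refine Measure.integrableOn_of_bounded (M := L * L)
      (ne_top_of_le_ne_top hFtop (measure_mono hF'F))
      (hv.mul hH.norm).aestronglyMeasurable ?_
    filter_upwards [self_mem_ae_restrict hF'm] with x hx
    obtain ⟨-, h2, h3, h4⟩ := hFL x (hF'F hx)
    rw [norm_mul, norm_norm, Real.norm_of_nonneg h3.le]
    gcongr
  have hint : ∫ x, T h x * g x = ((∫ x, ψ x : ℝ) : 𝕜) := by
    rw [← integral_ofReal]
    refine integral_congr_ae ?_
    filter_upwards [hTH] with x hx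
    by_cases hx' : x ∈ F'
    · rw [hg, hψ, indicator_of_mem hx', indicator_of_mem hx', hx, mul_smul_comm, mul_phase,
        RCLike.ofReal_mul, RCLike.real_smul_eq_coe_mul]
    · simp [hg, hψ, hx']
  have hlower : (y : ℝ≥0∞) * volume F' ≤ ‖∫ x, T h x * g x‖ₑ := by
    rw [hint, ← ofReal_norm, RCLike.norm_ofReal, abs_of_nonneg (integral_nonneg hψ0),
      ofReal_integral_eq_lintegral_ofReal hψint (Eventually.of_forall hψ0), ← setLIntegral_const]
    refine (setLIntegral_mono' (g := fun x => ENNReal.ofReal (ψ x)) hF'm fun x hx => ?_).trans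
      (setLIntegral_le_lintegral _ _)
    rw [hψ, indicator_of_mem hx]
    exact hFy x (hF'F hx)
  have htotal : (y : ℝ≥0∞) * volume F ^ (1 / q) * volume F ^ (1 - 1 / q) ≤
      2 * (K * (N * C)) * volume F ^ (1 - 1 / q) := by
    rw [mul_assoc, ← ENNReal.rpow_add _ _ hF0 hFtop, add_sub_cancel, ENNReal.rpow_one]
    calc (y : ℝ≥0∞) * volume F ≤ y * (2 * volume F') := by gcongr
      _ = 2 * (y * volume F') := by ring
      _ ≤ 2 * (K * (N * (C * volume F ^ (1 - 1 / q)))) := by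
          exact mul_le_mul' le_rfl (hlower.trans hpair)
      _ = _ := by ring
  refine (ENNReal.mul_le_mul_iff_left ?_ ?_).1 htotal
  · intro h0
    rcases ENNReal.rpow_eq_zero_iff.1 h0 with h | h
    · exact hF0 h.1
    · exact hFtop h.1
  · exact ENNReal.rpow_ne_top_of_ne_zero hF0 hFtop

/-- The weak-type bound on test functions, given bounds for the sparse forms. -/
lemma weakNorm_le_of_sparseForm_le (hn : 0 < n) {w : (Fin n → ℝ) → ℝ} (hw : IsWeight w)
    {α p₀ p q η : ℝ} {q₀ : ℝ≥0∞} {N : ℕ}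
    {K : ℝ≥0} {T : ((Fin n → ℝ) → 𝕜) → (Fin n → ℝ) → 𝕜} (hT : SparselyDominated α p₀ q₀ η N K T)
    (hp₀ : 1 ≤ p₀) (hp₀p : p₀ ≤ p) (hpq : p ≤ q) (hη : 0 < η)
    (hr1 : 1 ≤ (ENNReal.conjExponent q₀).toReal)
    (hrel : 1 / p - 1 / q = α / (n * (ENNReal.conjExponent q₀).toReal))
    (hrq : 1 - 1 / q < 1 / (ENNReal.conjExponent q₀).toReal)
    (hwq : IsWeight fun x => w x ^ q)
    {h : (Fin n → ℝ) → 𝕜} (hh : IsTest h) {C : ℝ≥0∞}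
    (hC : ∀ (F : Set (Fin n → ℝ)) (g : (Fin n → ℝ) → 𝕜) (S : Set (Cube n)), IsSparse η S →
      MeasurableSet F → volume F ≠ 0 → volume F ≠ ⊤ →
      (∀ᵐ x, ‖g x‖ₑ ≤ (goodPart (q / p) (fun x => ‖w x • h x‖ₑ ^ p) F).indicator
        (fun x => ENNReal.ofReal (w x)) x) →
      sparseForm α p₀ q₀ S h g ≤ C * volume F ^ (1 - 1 / q)) :
    weakNorm q (fun x => w x • T h x) ≤ 2 * (K * (N * C)) := by
  have hq : 0 < q := by linarith
  have hTm := (hT.locallyIntegrable h hh).aestronglyMeasurable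
  have hwm := hw.1.aestronglyMeasurable
  set H := hTm.mk (T h) with hHdef
  set v := hwm.mk w with hvdef
  have hH : Measurable H := hTm.stronglyMeasurable_mk.measurable
  have hv : Measurable v := hwm.stronglyMeasurable_mk.measurable
  refine iSup_le fun y => ?_
  set F : ℕ → Set (Fin n → ℝ) := fun L => {x | ‖x‖ ≤ L ∧ ‖H x‖ ≤ L ∧ 0 < v x ∧ v x ≤ L} ∩
    {x | (y : ℝ≥0∞) < ENNReal.ofReal (v x * ‖H x‖)} with hFdef
  have hFm : ∀ L, MeasurableSet (F L) := fun L => by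
    refine MeasurableSet.inter ?_ (measurableSet_lt measurable_const
      (hv.mul hH.norm).ennreal_ofReal)
    exact ((measurableSet_le measurable_norm measurable_const).inter
      ((measurableSet_le hH.norm measurable_const).inter
        ((measurableSet_lt measurable_const hv).inter (measurableSet_le hv measurable_const))))
  have hmono : Monotone F := by
    rintro L M hLM x ⟨⟨h1, h2, h3, h4⟩, h5⟩
    have hLM' : (L : ℝ) ≤ M := by exact_mod_cast hLM
    exact ⟨⟨h1.trans hLM', h2.trans hLM', h3, h4.trans hLM'⟩, h5⟩
  have hle : volume {x | (y : ℝ≥0∞) < ‖w x • T h x‖ₑ} ≤ volume (⋃ L, F L) := by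
    refine measure_mono_ae ?_
    filter_upwards [hTm.ae_eq_mk, hwm.ae_eq_mk, hw.2] with x hx1 hx2 hx3 hx4
    have hx4 : (y : ℝ≥0∞) < ‖w x • T h x‖ₑ := hx4
    rw [hx1, hx2, ← ofReal_norm, norm_smul] at hx4
    rw [hx2] at hx3
    rw [Real.norm_of_nonneg hx3.le] at hx4
    obtain ⟨L, hL⟩ := exists_nat_ge (max ‖x‖ (max ‖H x‖ (v x)))
    obtain ⟨h1, h2⟩ := max_le_iff.1 hL
    obtain ⟨h2, h3⟩ := max_le_iff.1 h2
    exact mem_iUnion.2 ⟨L, ⟨h1, h2, hx3, h3⟩, hx4⟩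
  have hlim : Tendsto (fun L => (y : ℝ≥0∞) * volume (F L) ^ (1 / q)) atTop
      (𝓝 ((y : ℝ≥0∞) * volume (⋃ L, F L) ^ (1 / q))) :=
    ENNReal.Tendsto.const_mul ((ENNReal.continuous_rpow_const (y := 1 / q)).continuousAt.tendsto.comp
      (tendsto_measure_iUnion_atTop hmono)) (Or.inr ENNReal.coe_ne_top)
  calc (y : ℝ≥0∞) * volume {x | (y : ℝ≥0∞) < ‖w x • T h x‖ₑ} ^ (1 / q)
      ≤ y * volume (⋃ L, F L) ^ (1 / q) := by gcongr
    _ ≤ _ := le_of_tendsto' hlim fun L => mul_volume_rpow_le hn hw hT hp₀ hp₀p hpq hη hr1 hrel hrq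
        hwq hh hH hTm.ae_eq_mk hv hwm.ae_eq_mk (hFm L) (Nat.cast_nonneg L) (fun x hx => hx.1)
        (fun x hx => le_of_lt hx.2) (fun g S hS h0 htop hg => hC (F L) g S hS (hFm L) h0 htop hg)

/-! ### Extension of weak-type operators from dense subspaces -/

lemma mul_volume_rpow_le_weakNorm (q : ℝ) (u : (Fin n → ℝ) → 𝕜) (y : ℝ≥0) :
    (y : ℝ≥0∞) * volume {x | (y : ℝ≥0∞) < ‖u x‖ₑ} ^ (1 / q) ≤ weakNorm q u :=
  le_iSup (fun y : ℝ≥0 => (y : ℝ≥0∞) * volume {x | (y : ℝ≥0∞) < ‖u x‖ₑ} ^ (1 / q)) y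

lemma volume_lt_enorm_le_of_weakNorm {q : ℝ} (hq : 0 < q) {u : (Fin n → ℝ) → 𝕜} {B : ℝ≥0∞}
    (hu : weakNorm q u ≤ B) {y : ℝ≥0} (hy : y ≠ 0) :
    volume {x | (y : ℝ≥0∞) < ‖u x‖ₑ} ≤ (B / y) ^ q := by
  have h1 : (y : ℝ≥0∞) * volume {x | (y : ℝ≥0∞) < ‖u x‖ₑ} ^ (1 / q) ≤ B :=
    (mul_volume_rpow_le_weakNorm q u y).trans hu
  have h2 : volume {x | (y : ℝ≥0∞) < ‖u x‖ₑ} ^ (1 / q) ≤ B / y := by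
    rw [ENNReal.le_div_iff_mul_le (Or.inl (by exact_mod_cast hy)) (Or.inl ENNReal.coe_ne_top),
      mul_comm]
    exact h1
  calc volume {x | (y : ℝ≥0∞) < ‖u x‖ₑ}
      = (volume {x | (y : ℝ≥0∞) < ‖u x‖ₑ} ^ (1 / q)) ^ q := by
        rw [← ENNReal.rpow_mul, one_div_mul_cancel hq.ne', ENNReal.rpow_one]
    _ ≤ _ := ENNReal.rpow_le_rpow h2 hq.le

/-- Fatou's lemma for the weak norm. -/
lemma weakNorm_le_of_tendsto {q : ℝ} {u : ℕ → (Fin n → ℝ) → 𝕜} {v : (Fin n → ℝ) → 𝕜}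
    (huv : ∀ᵐ x, Tendsto (fun j => ‖u j x‖) atTop (𝓝 ‖v x‖)) {c : ℕ → ℝ≥0∞} {c₀ : ℝ≥0∞}
    (hu : ∀ j, weakNorm q (u j) ≤ c j) (hc : Tendsto c atTop (𝓝 c₀)) (hq : 0 < q) :
    weakNorm q v ≤ c₀ := by
  refine iSup_le fun y => ?_
  set A : ℕ → Set (Fin n → ℝ) := fun m => {x | ∀ j, m ≤ j → (y : ℝ≥0∞) < ‖u j x‖ₑ} with hA
  have hmono : Monotone A := fun m k hmk x hx j hj => hx j (hmk.trans hj)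
  have hle : volume {x | (y : ℝ≥0∞) < ‖v x‖ₑ} ≤ volume (⋃ m, A m) := by
    refine measure_mono_ae ?_
    filter_upwards [huv] with x hx hxy
    have h2 := ENNReal.tendsto_ofReal hx
    simp only [ofReal_norm] at h2
    obtain ⟨m, hm⟩ := eventually_atTop.1 (h2.eventually_const_lt hxy)
    exact mem_iUnion.2 ⟨m, hm⟩
  have hlimA : Tendsto (fun m => (y : ℝ≥0∞) * volume (A m) ^ (1 / q)) atTop
      (𝓝 ((y : ℝ≥0∞) * volume (⋃ m, A m) ^ (1 / q))) :=
    ENNReal.Tendsto.const_mul ((ENNReal.continuous_rpow_const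
      (y := 1 / q)).continuousAt.tendsto.comp (tendsto_measure_iUnion_atTop hmono))
      (Or.inr ENNReal.coe_ne_top)
  have hlast : (y : ℝ≥0∞) * volume (⋃ m, A m) ^ (1 / q) ≤ c₀ := by
    refine le_of_tendsto_of_tendsto' hlimA hc fun m => ?_
    have h0 : A m ⊆ {x | (y : ℝ≥0∞) < ‖u m x‖ₑ} := fun x hx => hx m le_rfl
    refine le_trans ?_ ((mul_volume_rpow_le_weakNorm q (u m) y).trans (hu m))
    gcongr
  refine le_trans ?_ hlast
  gcongr

/-- A sequence tending to zero geometrically in weak `L^q` tends to zero geometrically almost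
everywhere, by the Borel-Cantelli lemma. -/
lemma ae_eventually_norm_le_of_weakNorm {q : ℝ} (hq : 0 < q) {u : ℕ → (Fin n → ℝ) → 𝕜} {B : ℝ≥0∞}
    (hB : B ≠ ⊤) (hu : ∀ j, weakNorm q (u j) ≤ B * 4⁻¹ ^ j) :
    ∀ᵐ x, ∀ᶠ j in atTop, ‖u j x‖ ≤ (1 / 2) ^ j := by
  have hs : ∑' j, volume {x | (((1 / 2 : ℝ≥0) ^ j : ℝ≥0) : ℝ≥0∞) < ‖u j x‖ₑ} ≠ ⊤ := by
    have hle : ∀ j, volume {x | (((1 / 2 : ℝ≥0) ^ j : ℝ≥0) : ℝ≥0∞) < ‖u j x‖ₑ} ≤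
        B ^ q * (2⁻¹ ^ q) ^ j := by
      intro j
      refine (volume_lt_enorm_le_of_weakNorm hq (hu j) (by positivity)).trans (le_of_eq ?_)
      have h4 : (4⁻¹ : ℝ≥0∞) = 2⁻¹ * 2⁻¹ := by
        rw [← ENNReal.mul_inv (by simp) (by simp)]
        norm_num
      have h2 : (((1 / 2 : ℝ≥0) ^ j : ℝ≥0) : ℝ≥0∞) = 2⁻¹ ^ j := by
        rw [ENNReal.coe_pow, one_div, ENNReal.coe_inv two_ne_zero]
        rfl
      rw [h4, h2, mul_pow, ← mul_assoc, ENNReal.mul_div_cancel_right (by simp)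
        (ENNReal.pow_ne_top (by simp)), ENNReal.mul_rpow_of_nonneg _ _ hq.le,
        ← ENNReal.rpow_natCast, ← ENNReal.rpow_natCast, ← ENNReal.rpow_mul, ← ENNReal.rpow_mul,
        mul_comm q]
    refine ne_top_of_le_ne_top ?_ (ENNReal.tsum_le_tsum hle)
    rw [ENNReal.tsum_mul_left, ENNReal.tsum_geometric]
    refine ENNReal.mul_ne_top (ENNReal.rpow_ne_top_of_nonneg hq.le hB) (ENNReal.inv_ne_top.2 ?_)
    refine (tsub_pos_of_lt ?_).ne'
    exact ENNReal.rpow_lt_one (by simp) hq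
  filter_upwards [ae_eventually_notMem hs] with x hx
  filter_upwards [hx] with j hj
  have hj := not_lt.1 hj
  rw [enorm_le_coe] at hj
  exact_mod_cast hj

/-- The reverse triangle inequality for sublinear operators. -/
lemma SublinearOn.norm_sub_le {P : ((Fin n → ℝ) → 𝕜) → Prop}
    {U : ((Fin n → ℝ) → 𝕜) → (Fin n → ℝ) → 𝕜} (hU : SublinearOn P U)
    (hadd : ∀ f g, P f → P g → P (f + g)) (hsmul : ∀ (c : 𝕜) f, P f → P (c • f))
    {f g : (Fin n → ℝ) → 𝕜} (hf : P f) (hg : P g) :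
    ∀ᵐ x, |‖U f x‖ - ‖U g x‖| ≤ ‖U (f - g) x‖ := by
  have hneg : ∀ u : (Fin n → ℝ) → 𝕜, -u = (-1 : 𝕜) • u := fun u => by simp
  have hd : P (f - g) := by
    rw [sub_eq_add_neg, hneg]
    exact hadd _ _ hf (hsmul _ _ hg)
  filter_upwards [hU.1 _ _ hd hg, hU.1 _ _ (hsmul (-1) _ hd) hf, hU.2 (-1) _ hd] with x h1 h2 h3
  rw [sub_add_cancel] at h1
  rw [← hneg, neg_sub, sub_add_cancel, ← neg_sub, hneg, h3, norm_neg, norm_one, one_mul] at h2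
  rw [abs_le]
  constructor <;> linarith

/-- An operator of weak type `(p, q)` on a dense subspace `P` of `L^p` extends to all of `L^p`.
The map `Ψ` is the identity for linear operators and the norm for sublinear ones; `Ψ ∘ U` is
Lipschitz by `hΨU`, so that it converges almost everywhere along fast approximations of
`f ∈ L^p`. -/
lemma exists_extension_aux {P : ((Fin n → ℝ) → 𝕜) → Prop}
    (hadd : ∀ f g, P f → P g → P (f + g)) (hsmul : ∀ (c : 𝕜) f, P f → P (c • f))
    {p : ℝ≥0∞} (hp : 1 ≤ p) {q : ℝ} (hq : 0 < q) (hmem : ∀ f, P f → MemLp f p)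
    (hdense : ∀ f : (Fin n → ℝ) → 𝕜, MemLp f p → ∀ ε : ℝ, 0 < ε →
      ∃ g, P g ∧ eLpNorm (f - g) p ≤ ENNReal.ofReal ε)
    {U : ((Fin n → ℝ) → 𝕜) → (Fin n → ℝ) → 𝕜}
    (hmeas : ∀ f, P f → AEStronglyMeasurable (U f)) {B : ℝ≥0∞} (hB : B ≠ ⊤)
    (hUB : ∀ f, P f → weakNorm q (U f) ≤ B * eLpNorm f p)
    {Ψ : 𝕜 → 𝕜} (hΨ : Continuous Ψ) (hΨn : ∀ z, ‖Ψ z‖ = ‖z‖) (hΨΨ : ∀ z, Ψ (Ψ z) = Ψ z)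
    (hΨU : ∀ f g, P f → P g → ∀ᵐ x, ‖Ψ (U f x) - Ψ (U g x)‖ ≤ ‖U (f - g) x‖) :
    ∃ S : ((Fin n → ℝ) → 𝕜) → (Fin n → ℝ) → 𝕜, (∀ f, P f → S f = U f) ∧
      (∀ f, MemLp f p → AEStronglyMeasurable (S f) ∧ weakNorm q (S f) ≤ B * eLpNorm f p) ∧
      (∀ f, MemLp f p → ∃ a : ℕ → (Fin n → ℝ) → 𝕜, ∀ j, P (a j) ∧ eLpNorm (f - a j) p ≤ 4⁻¹ ^ j) ∧
      ∀ f (b : ℕ → (Fin n → ℝ) → 𝕜) (C : ℝ≥0∞), MemLp f p → C ≠ ⊤ →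
        (∀ j, P (b j) ∧ eLpNorm (f - b j) p ≤ C * 4⁻¹ ^ j) →
        ∀ᵐ x, Tendsto (fun j => Ψ (U (b j) x)) atTop (𝓝 (Ψ (S f x))) := by
  classical
  have hsub : ∀ f g, P f → P g → P (f - g) := fun f g hf hg => by
    rw [sub_eq_add_neg, show -g = (-1 : 𝕜) • g by simp]
    exact hadd _ _ hf (hsmul _ _ hg)
  have hseq : ∀ f, MemLp f p → ∃ a : ℕ → (Fin n → ℝ) → 𝕜,
      ∀ j, P (a j) ∧ eLpNorm (f - a j) p ≤ 4⁻¹ ^ j := by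
    intro f hf
    have h1 : ∀ j : ℕ, ∃ g, P g ∧ eLpNorm (f - g) p ≤ 4⁻¹ ^ j := by
      intro j
      obtain ⟨g, hg, hle⟩ := hdense f hf ((4⁻¹ : ℝ) ^ j) (by positivity)
      refine ⟨g, hg, hle.trans (le_of_eq ?_)⟩
      rw [ENNReal.ofReal_pow (by positivity), ENNReal.ofReal_inv_of_pos (by norm_num)]
      norm_num
    choose a ha using h1
    exact ⟨a, ha⟩
  -- two fast approximations of the same function have asymptotically the same image
  have hdiff : ∀ (f : (Fin n → ℝ) → 𝕜) (a b : ℕ → (Fin n → ℝ) → 𝕜) (C C' : ℝ≥0∞), C ≠ ⊤ → C' ≠ ⊤ →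
      MemLp f p →
      (∀ j, P (a j) ∧ eLpNorm (f - a j) p ≤ C * 4⁻¹ ^ j) →
      (∀ j, P (b j) ∧ eLpNorm (f - b j) p ≤ C' * 4⁻¹ ^ j) →
      ∀ᵐ x, ∀ᶠ j in atTop, ‖Ψ (U (a j) x) - Ψ (U (b j) x)‖ ≤ (1 / 2) ^ j := by
    intro f a b C C' hC hC' hf ha hb
    have h1 : ∀ j, weakNorm q (U (a j - b j)) ≤ B * (C + C') * 4⁻¹ ^ j := by
      intro j
      refine (hUB _ (hsub _ _ (ha j).1 (hb j).1)).trans ?_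
      rw [mul_assoc]
      refine mul_le_mul' le_rfl ?_
      have hf1 := (hf.sub (hmem _ (ha j).1)).aestronglyMeasurable
      have hf2 := (hf.sub (hmem _ (hb j).1)).aestronglyMeasurable
      rw [show a j - b j = (f - b j) - (f - a j) by abel, add_mul, add_comm]
      exact (eLpNorm_sub_le hf2 hf1 hp).trans (add_le_add (hb j).2 (ha j).2)
    filter_upwards [ae_eventually_norm_le_of_weakNorm hq
      (ENNReal.mul_ne_top hB (ENNReal.add_ne_top.2 ⟨hC, hC'⟩)) h1,
      ae_all_iff.2 fun j => hΨU (a j) (b j) (ha j).1 (hb j).1] with x hx1 hx2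
    filter_upwards [hx1] with j hj
    exact (hx2 j).trans hj
  have hhalf : Tendsto (fun j : ℕ => (1 / 2 : ℝ) ^ j) atTop (𝓝 0) :=
    tendsto_pow_atTop_nhds_zero_of_lt_one (by norm_num) (by norm_num)
  choose! a ha using hseq
  -- on `P` the extension must agree with `U` itself, not only with `Ψ ∘ U`
  set S : ((Fin n → ℝ) → 𝕜) → (Fin n → ℝ) → 𝕜 := fun f =>
    if P f then U f else fun x => limUnder atTop fun j => Ψ (U (a f j) x) with hS
  have hSP : ∀ f, P f → S f = U f := fun f hf => if_pos hf
  have ha1 : ∀ f, MemLp f p → ∀ j, P (a f j) ∧ eLpNorm (f - a f j) p ≤ 1 * 4⁻¹ ^ j :=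
    fun f hf j => by
      rw [one_mul]
      exact ha f hf j
  have hlimN : ∀ f, MemLp f p → ¬ P f →
      ∀ᵐ x, Tendsto (fun j => Ψ (U (a f j) x)) atTop (𝓝 (S f x)) := by
    intro f hf hPf
    have hshift : ∀ j, P (a f (j + 1)) ∧ eLpNorm (f - a f (j + 1)) p ≤ 1 * 4⁻¹ ^ j := fun j => by
      refine ⟨(ha f hf _).1, (ha f hf _).2.trans ?_⟩
      rw [one_mul, pow_succ]
      exact mul_le_of_le_one_right' (by simp)
    filter_upwards [hdiff f (a f) (fun j => a f (j + 1)) 1 1 (by simp) (by simp) hf (ha1 f hf)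
      hshift] with x hx
    have hc : CauchySeq fun j => Ψ (U (a f j) x) := by
      refine cauchySeq_of_summable_dist ?_
      refine Summable.of_norm_bounded_eventually_nat
        (summable_geometric_of_lt_one (by norm_num : (0 : ℝ) ≤ 1 / 2) (by norm_num)) ?_
      filter_upwards [hx] with j hj
      rw [Real.norm_of_nonneg dist_nonneg, dist_eq_norm]
      exact hj
    simp only [hS, if_neg hPf]
    exact hc.tendsto_limUnder
  have hlim : ∀ f, MemLp f p → ∀ᵐ x, Tendsto (fun j => Ψ (U (a f j) x)) atTop (𝓝 (Ψ (S f x))) := by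
    intro f hf
    by_cases hPf : P f
    · rw [hSP f hPf]
      filter_upwards [hdiff f (a f) (fun _ => f) 1 0 (by simp) (by simp) hf (ha1 f hf)
        fun j => ⟨hPf, by simp⟩] with x hx
      rw [tendsto_iff_norm_sub_tendsto_zero]
      exact squeeze_zero' (Eventually.of_forall fun _ => norm_nonneg _) hx hhalf
    · filter_upwards [hlimN f hf hPf] with x hx
      simpa only [Function.comp_def, hΨΨ] using (hΨ.tendsto _).comp hx
  have hlim' : ∀ f (b : ℕ → (Fin n → ℝ) → 𝕜) (C : ℝ≥0∞), MemLp f p → C ≠ ⊤ →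
      (∀ j, P (b j) ∧ eLpNorm (f - b j) p ≤ C * 4⁻¹ ^ j) →
      ∀ᵐ x, Tendsto (fun j => Ψ (U (b j) x)) atTop (𝓝 (Ψ (S f x))) := by
    intro f b C hf hC hb
    filter_upwards [hlim f hf, hdiff f b (a f) C 1 hC (by simp) hf hb (ha1 f hf)] with x hx1 hx2
    have h0 : Tendsto (fun j => Ψ (U (b j) x) - Ψ (U (a f j) x)) atTop (𝓝 0) :=
      squeeze_zero_norm' hx2 hhalf
    simpa using h0.add hx1
  refine ⟨S, hSP, fun f hf => ⟨?_, ?_⟩, fun f hf => ⟨a f, ha f hf⟩, hlim'⟩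
  · by_cases hPf : P f
    · rw [hSP f hPf]
      exact hmeas f hPf
    · exact aestronglyMeasurable_of_tendsto_ae atTop
        (fun j => hΨ.comp_aestronglyMeasurable (hmeas _ (ha f hf j).1)) (hlimN f hf hPf)
  · have hlimR : Tendsto (fun m : ℕ => B * (eLpNorm f p + 4⁻¹ ^ m)) atTop
        (𝓝 (B * (eLpNorm f p + 0))) :=
      ENNReal.Tendsto.const_mul (tendsto_const_nhds.add
        (ENNReal.tendsto_pow_atTop_nhds_zero_of_lt_one (by
          rw [ENNReal.inv_lt_one]
          norm_num))) (Or.inr hB)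
    rw [add_zero] at hlimR
    refine weakNorm_le_of_tendsto (u := fun m => U (a f m)) ?_ (fun m => ?_) hlimR hq
    · filter_upwards [hlim f hf] with x hx
      have h1 := hx.norm
      simp only [hΨn] at h1
      exact h1
    · have h1 := eLpNorm_sub_le hf.aestronglyMeasurable
        (hf.sub (hmem _ (ha f hf m).1)).aestronglyMeasurable hp
      rw [sub_sub_cancel] at h1
      exact (hUB _ (ha f hf m).1).trans
        (mul_le_mul' le_rfl (h1.trans (add_le_add le_rfl (ha f hf m).2)))

/-- A (sub)linear operator of weak type `(p, q)` on a dense subspace `P` of `L^p` extends to a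
(sub)linear operator of weak type `(p, q)` on all of `L^p`. -/
lemma exists_extension {P : ((Fin n → ℝ) → 𝕜) → Prop}
    (hadd : ∀ f g, P f → P g → P (f + g)) (hsmul : ∀ (c : 𝕜) f, P f → P (c • f))
    {p : ℝ≥0∞} (hp : 1 ≤ p) {q : ℝ} (hq : 0 < q) (hmem : ∀ f, P f → MemLp f p)
    (hdense : ∀ f : (Fin n → ℝ) → 𝕜, MemLp f p → ∀ ε : ℝ, 0 < ε →
      ∃ g, P g ∧ eLpNorm (f - g) p ≤ ENNReal.ofReal ε)
    {U : ((Fin n → ℝ) → 𝕜) → (Fin n → ℝ) → 𝕜} (hU : SublinearOn P U)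
    (hmeas : ∀ f, P f → AEStronglyMeasurable (U f)) {B : ℝ≥0∞} (hB : B ≠ ⊤)
    (hUB : ∀ f, P f → weakNorm q (U f) ≤ B * eLpNorm f p) :
    ∃ S : ((Fin n → ℝ) → 𝕜) → (Fin n → ℝ) → 𝕜, (∀ f, P f → S f = U f) ∧
      SublinearOn (fun f => MemLp f p) S ∧
      (LinearOn P U → LinearOn (fun f => MemLp f p) S) ∧
      ∀ f, MemLp f p → AEStronglyMeasurable (S f) ∧ weakNorm q (S f) ≤ B * eLpNorm f p := by
  classical
  have hsub : ∀ f g, P f → P g → P (f - g) := fun f g hf hg => by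
    rw [sub_eq_add_neg, show -g = (-1 : 𝕜) • g by simp]
    exact hadd _ _ hf (hsmul _ _ hg)
  obtain ⟨Ψ, hΨlin, hΨ, hΨn, hΨΨ, hΨU⟩ : ∃ Ψ : 𝕜 → 𝕜, (LinearOn P U → Ψ = id) ∧ Continuous Ψ ∧
      (∀ z, ‖Ψ z‖ = ‖z‖) ∧ (∀ z, Ψ (Ψ z) = Ψ z) ∧
      ∀ f g, P f → P g → ∀ᵐ x, ‖Ψ (U f x) - Ψ (U g x)‖ ≤ ‖U (f - g) x‖ := by
    by_cases hlin : LinearOn P U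
    -- the images themselves converge for linear `U`, but only their norms for sublinear `U`
    · refine ⟨id, fun _ => rfl, continuous_id, fun _ => rfl, fun _ => rfl, fun f g hf hg => ?_⟩
      filter_upwards [hlin.1 _ _ (hsub _ _ hf hg) hg] with x hx
      rw [sub_add_cancel] at hx
      simp [hx]
    · refine ⟨fun z => ((‖z‖ : ℝ) : 𝕜), fun h => absurd h hlin,
        RCLike.continuous_ofReal.comp continuous_norm, fun z => by simp, fun z => by simp,
        fun f g hf hg => ?_⟩
      filter_upwards [hU.norm_sub_le hadd hsmul hf hg] with x hx
      rw [← RCLike.ofReal_sub, RCLike.norm_ofReal]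
      exact hx
  obtain ⟨S, hSP, hSB, hseq, hlim⟩ := exists_extension_aux hadd hsmul hp hq hmem hdense hmeas hB hUB
    hΨ hΨn hΨΨ hΨU
  choose! a ha using hseq
  have ha1 : ∀ f, MemLp f p → ∀ j, P (a f j) ∧ eLpNorm (f - a f j) p ≤ 1 * 4⁻¹ ^ j :=
    fun f hf j => by
      rw [one_mul]
      exact ha f hf j
  have hlima := fun f hf => hlim f (a f) 1 hf (by simp) (ha1 f hf)
  have hlimadd : ∀ f g, MemLp f p → MemLp g p → ∀ᵐ x,
      Tendsto (fun j => Ψ (U (a f j + a g j) x)) atTop (𝓝 (Ψ (S (f + g) x))) := fun f g hf hg => by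
    refine hlim (f + g) _ (1 + 1) (hf.add hg) (by simp) fun j =>
      ⟨hadd _ _ (ha f hf j).1 (ha g hg j).1, ?_⟩
    rw [add_sub_add_comm, add_mul]
    exact (eLpNorm_add_le (hf.sub (hmem _ (ha f hf j).1)).aestronglyMeasurable
      (hg.sub (hmem _ (ha g hg j).1)).aestronglyMeasurable hp).trans
      (add_le_add (ha1 f hf j).2 (ha1 g hg j).2)
  have hlimsmul : ∀ (c : 𝕜) f, MemLp f p → ∀ᵐ x,
      Tendsto (fun j => Ψ (U (c • a f j) x)) atTop (𝓝 (Ψ (S (c • f) x))) := fun c f hf => by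
    refine hlim (c • f) _ ‖c‖ₑ (hf.const_smul c) (by simp) fun j => ⟨hsmul _ _ (ha f hf j).1, ?_⟩
    rw [← smul_sub, eLpNorm_const_smul]
    exact mul_le_mul' le_rfl (ha f hf j).2
  refine ⟨S, hSP, ⟨fun f g hf hg => ?_, fun c f hf => ?_⟩, fun hlin => ⟨fun f g hf hg => ?_,
    fun c f hf => ?_⟩, hSB⟩
  · filter_upwards [hlima f hf, hlima g hg, hlimadd f g hf hg,
      ae_all_iff.2 fun j => hU.1 _ _ (ha f hf j).1 (ha g hg j).1] with x h1 h2 h3 h4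
    have h1 := h1.norm
    have h2 := h2.norm
    have h3 := h3.norm
    simp only [hΨn] at h1 h2 h3
    exact le_of_tendsto_of_tendsto' h3 (h1.add h2) h4
  · filter_upwards [hlima f hf, hlimsmul c f hf,
      ae_all_iff.2 fun j => hU.2 c _ (ha f hf j).1] with x h1 h2 h3
    have h1 := h1.norm
    have h2 := h2.norm
    simp only [hΨn, h3] at h1 h2
    exact tendsto_nhds_unique h2 (h1.const_mul _)
  · obtain rfl := hΨlin hlin
    filter_upwards [hlima f hf, hlima g hg, hlimadd f g hf hg,
      ae_all_iff.2 fun j => hlin.1 _ _ (ha f hf j).1 (ha g hg j).1] with x h1 h2 h3 h4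
    simp only [id, h4] at h1 h2 h3
    exact tendsto_nhds_unique h3 (h1.add h2)
  · obtain rfl := hΨlin hlin
    filter_upwards [hlima f hf, hlimsmul c f hf,
      ae_all_iff.2 fun j => hlin.2 c _ (ha f hf j).1] with x h1 h2 h3
    simp only [id, h3] at h1 h2
    exact tendsto_nhds_unique h2 (h1.const_mul _)

/-! ### Test functions in weighted spaces -/

lemma IsTest.add {f g : (Fin n → ℝ) → 𝕜} (hf : IsTest f) (hg : IsTest g) : IsTest (f + g) :=
  ⟨hf.1.add hg.1, hf.2.add hg.2⟩

lemma IsTest.const_smul {f : (Fin n → ℝ) → 𝕜} (hf : IsTest f) (c : 𝕜) : IsTest (c • f) :=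
  ⟨hf.1.const_smul c, hf.2.smul_left (f := fun _ => c)⟩

/-- Multiples `w h` of test functions `h` are dense in `L^p` when `w^p` is locally integrable. -/
lemma exists_isTest_eLpNorm_sub_le {w : (Fin n → ℝ) → ℝ} (hw : IsWeight w) {p q : ℝ}
    (hp : 1 ≤ p) (hpq : p ≤ q) (hwq : IsWeight fun x => w x ^ q) {f : (Fin n → ℝ) → 𝕜}
    (hf : MemLp f (ENNReal.ofReal p)) {ε : ℝ} (hε : 0 < ε) :
    ∃ h, IsTest h ∧ eLpNorm (f - fun x => w x • h x) (ENNReal.ofReal p) ≤ ENNReal.ofReal ε := by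
  have hp0 : 0 < p := by linarith
  have hwm := hw.1.aestronglyMeasurable
  have hVm : AEMeasurable fun x => ENNReal.ofReal (w x) ^ p :=
    hwm.aemeasurable.ennreal_ofReal.pow_const p
  set μ : Measure (Fin n → ℝ) := volume.withDensity fun x => ENNReal.ofReal (w x) ^ p with hμ
  have hac : μ ≪ volume := withDensity_absolutelyContinuous _ _
  have : IsFiniteMeasureOnCompacts μ := ⟨fun s hs => by
    rw [hμ, withDensity_apply _ hs.measurableSet]
    exact (hw.setLIntegral_ofReal_rpow_ne_top hp0 hpq hwq hs).lt_top⟩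
  have hnorm : ∀ u : (Fin n → ℝ) → 𝕜, AEStronglyMeasurable u →
      eLpNorm u (ENNReal.ofReal p) μ = eLpNorm (fun x => w x • u x) (ENNReal.ofReal p) := by
    intro u hu
    rw [eLpNorm_ofReal_eq hp0, eLpNorm_ofReal_eq hp0, hμ,
      lintegral_withDensity_eq_lintegral_mul₀ hVm (hu.enorm.pow_const p)]
    congr 1
    refine lintegral_congr_ae ?_
    filter_upwards [hw.2] with x hx
    rw [Pi.mul_apply, enorm_smul, Real.enorm_of_nonneg hx.le, ENNReal.mul_rpow_of_nonneg _ _ hp0.le]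
  set g : (Fin n → ℝ) → 𝕜 := fun x => (w x)⁻¹ • f x with hg
  have hgm : AEStronglyMeasurable g :=
    (hwm.aemeasurable.inv.aestronglyMeasurable).smul hf.aestronglyMeasurable
  have hwg : (fun x => w x • g x) =ᵐ[volume] f := by
    filter_upwards [hw.2] with x hx
    rw [hg, smul_inv_smul₀ hx.ne']
  have hgL : MemLp g (ENNReal.ofReal p) μ := by
    refine ⟨hgm.mono_ac hac, ?_⟩
    rw [hnorm g hgm, eLpNorm_congr_ae hwg]
    exact hf.2
  obtain ⟨h, hhc, hh, hle⟩ := hgL.exist_eLpNorm_sub_le ENNReal.ofReal_ne_top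
    (ENNReal.one_le_ofReal.2 hp) hε
  refine ⟨h, ⟨hh, hhc⟩, ?_⟩
  rw [hnorm _ (hgm.sub hh.continuous.aestronglyMeasurable)] at hle
  refine le_trans (le_of_eq (eLpNorm_congr_ae ?_)) hle
  filter_upwards [hwg] with x hx
  rw [Pi.sub_apply, Pi.sub_apply, smul_sub, hx]

/-- Test functions are determined by their products with a weight. -/
lemma IsTest.eq_of_smul_eq {w : (Fin n → ℝ) → ℝ} (hw : IsWeight w) {h h' : (Fin n → ℝ) → 𝕜}
    (hh : IsTest h) (hh' : IsTest h') (heq : (fun x => w x • h x) = fun x => w x • h' x) :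
    h = h' := by
  refine Continuous.ae_eq_iff_eq volume hh.1.continuous hh'.1.continuous |>.1 ?_
  filter_upwards [hw.2] with x hx
  exact smul_right_injective _ hx.ne' (congrFun heq x)

/-- A weak-type bound on test functions is a weak-type bound for the extended operator. -/
lemma multiplierWeakBound_of_isTest {w : (Fin n → ℝ) → ℝ} (hw : IsWeight w) {p q : ℝ}
    (hp : 1 ≤ p) (hpq : p ≤ q) (hwq : IsWeight fun x => w x ^ q)
    {T : ((Fin n → ℝ) → 𝕜) → (Fin n → ℝ) → 𝕜} (hT : SublinearOn IsTest T)
    (hTm : ∀ h, IsTest h → AEStronglyMeasurable (T h)) {B : ℝ≥0∞} (hB : B ≠ ⊤)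
    (hTB : ∀ h, IsTest h → weakNorm q (fun x => w x • T h x) ≤
      B * eLpNorm (fun x => w x • h x) (ENNReal.ofReal p) volume) :
    MultiplierWeakBound T w p q B := by
  classical
  refine ⟨hTB, ?_⟩
  have hp0 : 0 < p := by linarith
  set P : ((Fin n → ℝ) → 𝕜) → Prop := fun f => ∃ h, IsTest h ∧ f = fun x => w x • h x with hP
  set U : ((Fin n → ℝ) → 𝕜) → (Fin n → ℝ) → 𝕜 := fun f x =>
    if hf : P f then w x • T hf.choose x else 0 with hU
  have hUT : ∀ h, IsTest h → U (fun x => w x • h x) = fun x => w x • T h x := by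
    intro h hh
    have hf : P fun x => w x • h x := ⟨h, hh, rfl⟩
    -- `h` is recovered from `w h`, so the choice does not matter
    have h1 : h = hf.choose := hh.eq_of_smul_eq hw hf.choose_spec.1 hf.choose_spec.2
    funext x
    simp only [hU, dif_pos hf]
    rw [← h1]
  have hadd' : ∀ h h' : (Fin n → ℝ) → 𝕜, ((fun x => w x • h x) + fun x => w x • h' x) =
      fun x => w x • (h + h') x := fun h h' => by
    funext x
    simp [smul_add]
  have hsmul' : ∀ (c : 𝕜) (h : (Fin n → ℝ) → 𝕜), (c • fun x => w x • h x) =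
      fun x => w x • (c • h) x := fun c h => by
    funext x
    simp
  have haddP : ∀ f g, P f → P g → P (f + g) := by
    rintro _ _ ⟨h, hh, rfl⟩ ⟨h', hh', rfl⟩
    exact ⟨h + h', hh.add hh', hadd' h h'⟩
  have hsmulP : ∀ (c : 𝕜) f, P f → P (c • f) := by
    rintro c _ ⟨h, hh, rfl⟩
    exact ⟨c • h, hh.const_smul c, hsmul' c h⟩
  have hmemP : ∀ f, P f → MemLp f (ENNReal.ofReal p) := by
    rintro _ ⟨h, hh, rfl⟩
    refine ⟨hw.1.aestronglyMeasurable.smul hh.1.continuous.aestronglyMeasurable, ?_⟩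
    rw [eLpNorm_ofReal_eq hp0]
    exact ENNReal.rpow_lt_top_of_nonneg (by positivity)
      (lintegral_enorm_smul_rpow_ne_top hw hp0 hpq hwq hh)
  have hdenseP : ∀ f : (Fin n → ℝ) → 𝕜, MemLp f (ENNReal.ofReal p) → ∀ ε : ℝ, 0 < ε →
      ∃ g, P g ∧ eLpNorm (f - g) (ENNReal.ofReal p) ≤ ENNReal.ofReal ε := by
    intro f hf ε hε
    obtain ⟨h, hh, hle⟩ := exists_isTest_eLpNorm_sub_le hw hp hpq hwq hf hε
    exact ⟨_, ⟨h, hh, rfl⟩, hle⟩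
  have hUsub : SublinearOn P U := by
    refine ⟨?_, ?_⟩
    · rintro _ _ ⟨h, hh, rfl⟩ ⟨h', hh', rfl⟩
      rw [hadd', hUT _ hh, hUT _ hh', hUT _ (hh.add hh')]
      filter_upwards [hT.1 h h' hh hh'] with x hx
      rw [norm_smul, norm_smul, norm_smul, ← mul_add]
      exact mul_le_mul_of_nonneg_left hx (norm_nonneg _)
    · rintro c _ ⟨h, hh, rfl⟩
      rw [hsmul', hUT _ hh, hUT _ (hh.const_smul c)]
      filter_upwards [hT.2 c h hh] with x hx
      rw [norm_smul, norm_smul, hx]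
      ring
  have hUm : ∀ f, P f → AEStronglyMeasurable (U f) := by
    rintro _ ⟨h, hh, rfl⟩
    rw [hUT h hh]
    exact hw.1.aestronglyMeasurable.smul (hTm h hh)
  have hUB : ∀ f, P f → weakNorm q (U f) ≤ B * eLpNorm f (ENNReal.ofReal p) := by
    rintro _ ⟨h, hh, rfl⟩
    rw [hUT h hh]
    exact hTB h hh
  obtain ⟨S, hS, hSsub, hSlin, hSB⟩ := exists_extension haddP hsmulP (ENNReal.one_le_ofReal.2 hp)
    (by linarith) hmemP hdenseP hUsub hUm hB hUB
  refine ⟨S, fun h hh => ?_, hSsub, fun hlin => hSlin ⟨?_, ?_⟩, hSB⟩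
  · rw [hS _ ⟨h, hh, rfl⟩, hUT h hh]
    exact Eventually.of_forall fun _ => rfl
  · rintro _ _ ⟨h, hh, rfl⟩ ⟨h', hh', rfl⟩
    rw [hadd', hUT _ hh, hUT _ hh', hUT _ (hh.add hh')]
    filter_upwards [hlin.1 h h' hh hh'] with x hx
    rw [hx, smul_add]
  · rintro c _ ⟨h, hh, rfl⟩
    rw [hsmul', hUT _ hh, hUT _ (hh.const_smul c)]
    filter_upwards [hlin.2 c h hh] with x hx
    rw [hx, mul_smul_comm]

/-! ### The weak-type bound with explicit constants -/

/-- The weak-type bound for a weight whose power `w^{qσ}` is absolutely continuous with exponent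
`1 / s`; the bound is linear in `s`. -/
lemma multiplierWeakBound_of_setLIntegral_le (hn : 0 < n) {w : (Fin n → ℝ) → ℝ} (hw : IsWeight w)
    {α p₀ p q σ s η : ℝ} {q₀ : ℝ≥0∞} {N : ℕ} {K : ℝ≥0}
    {T : ((Fin n → ℝ) → 𝕜) → (Fin n → ℝ) → 𝕜} (hT : SparselyDominated α p₀ q₀ η N K T)
    (hp₀ : 1 ≤ p₀) (hp₀p : p₀ ≤ p) (hpq : p ≤ q) (hσ : 1 ≤ σ) (hs : 1 ≤ s) (hη : 0 < η)
    (hr : 1 ≤ (ENNReal.conjExponent q₀).toReal)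
    (hrel : 1 / p - 1 / q = α / (n * (ENNReal.conjExponent q₀).toReal))
    (hrq : 1 / (ENNReal.conjExponent q₀).toReal = 1 - 1 / q + 1 / (q * σ))
    (hA : MemA ((1 / p₀ - 1 / p) * q + 1) (fun x => w x ^ q))
    (hd : ∀ (Q : Cube n) (F : Set (Fin n → ℝ)), MeasurableSet F →
      ∫⁻ x in Q.carrier ∩ F, ENNReal.ofReal (w x ^ q) ^ σ ≤
        2 * (∫⁻ x in Q.carrier, ENNReal.ofReal (w x ^ q) ^ σ) *
          (volume (Q.carrier ∩ F) / volume Q.carrier) ^ (1 / s))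
    {L : ℝ} (hL : 0 ≤ L) {X : ℝ≥0∞} (hsX : ENNReal.ofReal s ≤ ENNReal.ofReal L * X)
    {B : ℝ≥0∞} (hB : B ≠ ⊤)
    (hBX : ENNReal.ofReal (8 * N * η⁻¹ * (2 * q * σ * L) * (5 ^ n) ^ 2) * K *
      constA ((1 / p₀ - 1 / p) * q + 1) (fun x => w x ^ q) ^ (1 / q) *
      (constRH σ (fun x => w x ^ q) ^ (1 / q) * X) ≤ B) :
    MultiplierWeakBound T w p q B := by
  have hp : 0 < p := by linarith
  have hq : 0 < q := by linarith
  have hσ0 : 0 < σ := by linarith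
  have hrq' : 1 - 1 / q < 1 / (ENNReal.conjExponent q₀).toReal := by
    rw [hrq]
    have : 0 < 1 / (q * σ) := by positivity
    linarith
  refine multiplierWeakBound_of_isTest hw (by linarith) hpq hA.1 hT.sublinear
    (fun h hh => (hT.locallyIntegrable h hh).aestronglyMeasurable) hB fun h hh => ?_
  set A := constA ((1 / p₀ - 1 / p) * q + 1) (fun x => w x ^ q) ^ (1 / q) with hAdef
  set R := constRH σ (fun x => w x ^ q) ^ (1 / q) with hRdef
  have hsparse := fun (F : Set (Fin n → ℝ)) (g : (Fin n → ℝ) → 𝕜) (S : Set (Cube n))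
    (hS : IsSparse η S) (hF : MeasurableSet F) (h0 : volume F ≠ 0) (htop : volume F ≠ ⊤) hg =>
    (sparseForm_le_of_goodPart (g := g) hn hw hp₀ hp₀p hpq hσ hs hη (by linarith) hrel hrq hA hd
      hh.1.continuous.aestronglyMeasurable hF h0 htop hg hS)
  have hnorm : ((∫⁻ x, ‖w x • h x‖ₑ ^ p) ^ (q / p)) ^ (1 / q) =
      eLpNorm (fun x => w x • h x) (ENNReal.ofReal p) volume := by
    rw [eLpNorm_ofReal_eq hp, ← ENNReal.rpow_mul]
    congr 1
    field_simp
  rw [hnorm] at hsparse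
  set E := eLpNorm (fun x => w x • h x) (ENNReal.ofReal p) volume with hE
  refine (weakNorm_le_of_sparseForm_le hn hw hT hp₀ hp₀p hpq hη hr hrel hrq' hA.1 hh
    (C := (A * (2 * R)) * ((ENNReal.ofReal η)⁻¹ * (ENNReal.ofReal (2 * q * σ * s) *
      (2 * (5 ^ n) ^ 2) * E)))
    fun F g S hS hF h0 htop hg => (hsparse F g S hS hF h0 htop hg).trans
      (le_of_eq (by ring))).trans ?_
  refine le_trans ?_ (mul_le_mul' hBX le_rfl)
  have h1 : ENNReal.ofReal (2 * q * σ * s) ≤ ENNReal.ofReal (2 * q * σ * L) * X := by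
    rw [ENNReal.ofReal_mul (by positivity), ENNReal.ofReal_mul (p := 2 * q * σ) (by positivity),
      mul_assoc (ENNReal.ofReal _)]
    exact mul_le_mul' le_rfl hsX
  have h2 : ENNReal.ofReal (8 * N * η⁻¹ * (2 * q * σ * L) * (5 ^ n) ^ 2) =
      8 * N * (ENNReal.ofReal η)⁻¹ * ENNReal.ofReal (2 * q * σ * L) * (5 ^ n) ^ 2 := by
    rw [ENNReal.ofReal_mul (by positivity), ENNReal.ofReal_mul (by positivity),
      ENNReal.ofReal_mul (by positivity), ENNReal.ofReal_mul (by positivity),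
      ENNReal.ofReal_natCast, ENNReal.ofReal_inv_of_pos hη, ENNReal.ofReal_pow (by positivity),
      ENNReal.ofReal_pow (by positivity)]
    norm_num
  rw [h2]
  calc 2 * (K * (N * ((A * (2 * R)) * ((ENNReal.ofReal η)⁻¹ * (ENNReal.ofReal (2 * q * σ * s) *
        (2 * (5 ^ n) ^ 2) * E)))))
      ≤ 2 * (K * (N * ((A * (2 * R)) * ((ENNReal.ofReal η)⁻¹ *
        ((ENNReal.ofReal (2 * q * σ * L) * X) * (2 * (5 ^ n) ^ 2) * E))))) := by gcongr
    _ = _ := by ring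

/-- The exponent of absolute continuity is comparable to the weight constant. -/
lemma ofReal_one_add_mul_toReal_le {X : ℝ≥0∞} (hX : X ≠ ⊤) (hX1 : 1 ≤ X) {c : ℝ} (hc : 1 ≤ c) :
    ENNReal.ofReal (1 + c * X.toReal) ≤ ENNReal.ofReal (2 * c) * X := by
  have h1 : 1 ≤ X.toReal := by
    rw [← ENNReal.toReal_one]
    exact ENNReal.toReal_mono hX hX1
  rw [← ENNReal.ofReal_toReal hX, ← ENNReal.ofReal_mul (by positivity), ENNReal.toReal_ofReal
    (by positivity)]
  refine ENNReal.ofReal_le_ofReal ?_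
  have : 1 ≤ c * X.toReal := one_le_mul_of_one_le_of_one_le hc h1
  linarith

lemma conjExponent_top : ENNReal.conjExponent ⊤ = 1 := by
  simp [ENNReal.conjExponent]

lemma toReal_conjExponent_ofReal {a : ℝ} (ha : 1 < a) :
    (ENNReal.conjExponent (ENNReal.ofReal a)).toReal = a / (a - 1) := by
  have h1 : 0 < a - 1 := by linarith
  rw [ENNReal.conjExponent, ← ENNReal.ofReal_one, ← ENNReal.ofReal_sub _ zero_le_one,
    ← ENNReal.ofReal_inv_of_pos h1, ← ENNReal.ofReal_add zero_le_one (by positivity),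
    ENNReal.toReal_ofReal (by positivity)]
  field_simp
  ring

end SparseWeak

end

open SparseWeak
theorem theorem1p3 {𝕜 : Type*} [RCLike 𝕜] (n : ℕ) (α p₀ p q : ℝ) (q₀ : ℝ≥0∞)
    (hα : 0 ≤ α) (hαn : α < n)
    (hp₀ : 1 ≤ p₀) (hp₀p : p₀ ≤ p) (hpq : p ≤ q) (hqq₀ : ENNReal.ofReal q < q₀)
    (hrel : 1 / p - 1 / q = α / (n * (ENNReal.conjExponent q₀).toReal))
    (η : ℝ) (hη : 0 < η) (hη1 : η ≤ 1) (N : ℕ) :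
    ∃ C : ℝ≥0, ∀ (K : ℝ≥0) (T : ((Fin n → ℝ) → 𝕜) → (Fin n → ℝ) → 𝕜) (w : (Fin n → ℝ) → ℝ),
      SparselyDominated α p₀ q₀ η N K T →
      IsWeight w →
      MemA ((1 / p₀ - 1 / p) * q + 1) (fun x => w x ^ q) →
      MemRH (ENNReal.conjExponent (q₀ / ENNReal.ofReal q)).toReal (fun x => w x ^ q) →
      (q₀ = ⊤ →
        MultiplierWeakBound T w p q
          (C * K * constA ((1 / p₀ - 1 / p) * q + 1) (fun x => w x ^ q) ^ (1 / q) *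
            constAInfty (fun x => w x ^ q))) ∧
      (q₀ < ⊤ →
        MultiplierWeakBound T w p q
          (C * K * constA ((1 / p₀ - 1 / p) * q + 1) (fun x => w x ^ q) ^ (1 / q) *
            constRH (ENNReal.conjExponent (q₀ / ENNReal.ofReal q)).toReal (fun x => w x ^ q) ^
              ((ENNReal.conjExponent (q₀ / ENNReal.ofReal q)).toReal + 2 / q))) := by
  have hn : 0 < n := by
    have : (0 : ℝ) < n := hα.trans_lt hαn
    exact_mod_cast this
  have hq : 0 < q := by linarith
  rcases eq_or_ne q₀ ⊤ with rfl | hq₀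
  · refine ⟨Real.toNNReal (8 * N * η⁻¹ * (2 * q * 1 * (2 * 2 ^ (n + 1))) * (5 ^ n) ^ 2),
      fun K T w hT hw hA hRH => ⟨fun _ => ?_, fun h => absurd h (lt_irrefl _)⟩⟩
    -- here `q₀' = (q₀ / q)' = 1` and the reverse Hölder class is `A_∞`
    have hr : (ENNReal.conjExponent ⊤).toReal = 1 := by rw [conjExponent_top, ENNReal.toReal_one]
    rw [ENNReal.top_div_of_ne_top ENNReal.ofReal_ne_top, hr, MemRH, if_pos rfl] at hRH
    have hAinf := hRH.constAInfty_lt_top hn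
    refine multiplierWeakBound_of_setLIntegral_le hn hw hT hp₀ hp₀p hpq le_rfl
      (s := 1 + 2 ^ (n + 1) * (constAInfty fun x => w x ^ q).toReal)
      (L := 2 * 2 ^ (n + 1)) (X := constAInfty fun x => w x ^ q)
      (le_add_of_nonneg_right (by positivity)) hη hr.ge hrel ?_ hA ?_ (by positivity) ?_ ?_ ?_
    · rw [hr]
      field_simp
      ring
    · intro Q F hF
      simp only [ENNReal.rpow_one]
      exact hA.1.setLIntegral_inter_le hAinf Q hF
    · exact ofReal_one_add_mul_toReal_le hAinf.ne hA.1.one_le_constAInfty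
        (one_le_pow₀ one_le_two)
    · exact ENNReal.mul_ne_top (ENNReal.mul_ne_top (by finiteness)
        (ENNReal.rpow_ne_top_of_nonneg (by positivity) hA.2.ne)) hAinf.ne
    · rw [constRH, if_pos rfl, ENNReal.one_rpow, one_mul]
      exact le_rfl
  · obtain ⟨a, ha⟩ : ∃ a : ℝ, q₀ = ENNReal.ofReal a := ⟨q₀.toReal, (ENNReal.ofReal_toReal hq₀).symm⟩
    subst ha
    have haq : q < a := ENNReal.ofReal_lt_ofReal_iff_of_nonneg hq.le |>.1 hqq₀
    have ha1 : 1 < a := by linarith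
    have haq1 : 1 < a / q := by rwa [lt_div_iff₀ hq, one_mul]
    have hr := toReal_conjExponent_ofReal ha1
    have hσ := toReal_conjExponent_ofReal haq1
    rw [ENNReal.ofReal_div_of_pos hq] at hσ
    rw [hσ]
    set σ := a / q / (a / q - 1) with hσdef
    have hσ1 : 1 < σ := by
      rw [hσdef, lt_div_iff₀ (by linarith)]
      linarith
    have hσ0 : 0 < σ := by linarith
    set c : ℝ := 2 ^ σ * 5 ^ n * (σ / (σ - 1)) with hc
    have hc1 : 1 ≤ c := by
      have h1 : (1 : ℝ) ≤ 2 ^ σ := Real.one_le_rpow (by norm_num) hσ0.le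
      have h2 : (1 : ℝ) ≤ 5 ^ n := one_le_pow₀ (by norm_num)
      have h3 : 1 ≤ σ / (σ - 1) := by
        rw [le_div_iff₀ (by linarith)]
        linarith
      exact one_le_mul_of_one_le_of_one_le (one_le_mul_of_one_le_of_one_le h1 h2) h3
    refine ⟨Real.toNNReal (8 * N * η⁻¹ * (2 * q * σ * (2 * (2 ^ (n + 1) * c))) * (5 ^ n) ^ 2),
      fun K T w hT hw hA hRH => ⟨fun h => absurd h hq₀, fun _ => ?_⟩⟩
    rw [MemRH, if_neg hσ1.ne'] at hRH
    set R := constRH σ fun x => w x ^ q with hR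
    have hR1 : 1 ≤ R := hA.1.one_le_constRH hσ1.le
    have hRtop : R ≠ ⊤ := hRH.2.ne
    have h2c : (1 : ℝ) ≤ 2 ^ (n + 1) * c :=
      one_le_mul_of_one_le_of_one_le (one_le_pow₀ one_le_two) hc1
    refine multiplierWeakBound_of_setLIntegral_le hn hw hT hp₀ hp₀p hpq hσ1.le
      (s := 1 + 2 ^ (n + 1) * c * (R ^ σ).toReal)
      (L := 2 * (2 ^ (n + 1) * c)) (X := R ^ σ)
      (le_add_of_nonneg_right (by positivity)) hη ?_ hrel ?_ hA ?_ (by positivity) ?_ ?_ ?_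
    · rw [hr, le_div_iff₀ (by linarith)]
      linarith
    · have h1 : a - 1 ≠ 0 := by linarith
      have h2 : a - q ≠ 0 := by linarith
      have h3 : a / q - 1 = (a - q) / q := by field_simp
      rw [hr, hσdef, h3]
      field_simp
      ring
    · intro Q F hF
      rw [← ENNReal.toReal_rpow, mul_assoc (2 ^ (n + 1))]
      exact hA.1.setLIntegral_rpow_inter_le hn hσ1 hRH.2 hc Q hF
    · exact ofReal_one_add_mul_toReal_le (ENNReal.rpow_ne_top_of_nonneg hσ0.le hRtop)
        (ENNReal.one_le_rpow hR1 hσ0) h2c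
    · exact ENNReal.mul_ne_top (ENNReal.mul_ne_top (by finiteness)
        (ENNReal.rpow_ne_top_of_nonneg (by positivity) hA.2.ne))
        (ENNReal.rpow_ne_top_of_nonneg (by positivity) hRtop)
    · refine mul_le_mul' le_rfl ?_
      -- the sparse form contributes `R^{1/q}` and the absolute continuity `R^σ`; as `1 ≤ R` this is
      -- below `R^{σ + 2/q}`
      rw [← ENNReal.rpow_add_of_nonneg _ _ (by positivity) hσ0.le]
      refine ENNReal.rpow_le_rpow_of_exponent_le hR1 ?_
      have : 1 / q ≤ 2 / q := by gcongr; norm_num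
      linarith
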